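/- **Setting.** Let $n\ge 1$, let $t_0,t_1,\dots\ge 2$ be integers (arities) and $c_0,c_1,\dots\ge 0$ reals (edge lengths). A *generalized mixed-radix (GMR) tree* is a finite rooted tree in which a node on level $j$ has at most $t_j$ children, joined to it by edges of length $c_j$; a node on level $i$ has depth $L(i)=\sum_{j<i}c_j$. For weights $p_1,\dots,p_n\ge 0$, a tree with exactly $n$ leaves labelled $v_1,\dots,v_n$ has cost $\sum_k \mathrm{depth}(v_k)\,p_k$. A *mixed-radix code* with $n$ words is a family of $n$ words, none a prefix of another, whose letter in position $j$ ($j=0,1,\dots$) is taken from an alphabet of size $t_j$; its cost is $\sum_k p_k|w_k|$. In 1–3 assume $p_1\ge\dots\ge p_n\ge0$ and $p_k=0$ for $k>n$, and put $W_m=\sum_{k>m}p_k$. An *$i$-level tree* is a GMR tree with all nodes on levels $\le i$, in which some nodes of level $i$ are tagged as internal. It is *full* if every node on a level $j$ that has children has $t_j$ of them. For $j\le i$, the signature of its truncation to level $j$ is $(m,b)$ with $m$ the number of leaves on levels $\le j$ and $b$ the number of internal (tagged or with children) nodes on level $j$. The pair $(m,b)$ is a *valid* $i$-level signature if either $b>0$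 and $m+b\le n$, or $b=0$, $i\ge1$ and $\max(n,t_{i-1})\le m\le n+t_{i-1}-1$. Let $OPT^i[m,b]$ be the minimum of $\sum_{k\le m}\mathrm{depth}(v_k)p_k+L(i)\sum_{k>m}p_k$ over all full $i$-level trees with $i$-level signature $(m,b)$ all of whose truncations to levels $j\le i$ have valid signatures, where $v_1,\dots,v_m$ are the leaves ordered from top to bottom; it is $\infty$ if there is no such tree. Running times count operations on a unit-cost random access machine with addition, truncated subtraction and comparison of natural numbers, addition, subtraction, multiplication and comparison of reals, and arrays of both kinds; all constants are absolute. **Theorem.** 1. (Batching.) For $d\ge 0$, $i\ge0$, $r=t_i$ and $0\le b'\le\lfloor d/r\rfloor$ put $\gamma(b')=OPT^{i}[d-b'r,b']+c_iW_{d-b'r}$. For every valid $(i+1)$-level signature $(m,b)$ with $m+b=d$, $$OPT^{i+1}[m,b]=\min\{\gamma(b') : b/r\le b'\le\lfloor d/r\rfloor\}$$ (with $\min\emptyset=\infty$). Hence, writing $X_m=(m,d-m)$ and $\tau=d\bmod r$, for valid signatures: $OPT^{i+1}[X_m]=\infty$ if $m<\tau$; $OPT^{i+1}[X_\tau]=\gamma(\lfloor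 d/r\rfloor)$; and for $\tau<m\le d$ with $X_{m-1}$ and $X_m$ valid, $OPT^{i+1}[X_m]$ equals $\min(OPT^{i+1}[X_{m-1}],\gamma((d-m)/r))$ if $r\mid d-m$, and $OPT^{i+1}[X_{m-1}]$ otherwise. Given $n$, $i$, $d\ge 1$, the valid entries of $OPT^{i}$, the values $t_j,c_j$ ($j\le i$) and $W_0,\dots,W_n$, all valid entries $OPT^{i+1}[m,b]$ with $m+b=d$ can be computed in $O(d)$ time. 2. (Filling the table.) Given $n$, $i$, the valid entries of $OPT^{i}$, the values $t_j,c_j$ ($j\le i$) and $p_1,\dots,p_n$, all valid entries of $OPT^{i+1}$ can be computed in $O(n^2)$ time. Given $n$, $t_j,c_j$ ($j<n$) and $p_1,\dots,p_n$, all valid entries of $OPT^0,\dots,OPT^n$ can be computed in $O(n^3)$ time. 3. (Optimal cost.) If $n\ge2$, the minimum cost of a GMR tree with $n$ leaves is the minimum of $OPT^i[m,0]$ over $1\le i\le n$ and $\max(n,t_{i-1})\le m\le n+t_{i-1}-1$. 4. (Optimal trees and codes.) Given $n$, arbitrary weights $p_1,\dots,p_n\ge0$ (in any order) and $t_j,c_j$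 ($j<n$), a minimum-cost GMR tree with $n$ leaves (given by the words that label the paths from the root to its leaves) can be found in $O(n^3)$ time. Given $n$, such weights and $t_j$ ($j<n$), a minimum-cost mixed-radix code with $n$ words can be found in $O(n^3)$ time. -/

import Mathlib

namespace MixedRadix

/-! ### The machine: a unit-cost random access machine

Natural numbers (indices, arities, digits) support only addition and truncated subtraction,
real numbers (weights, costs) support addition, subtraction and multiplication; both can be
compared. Memory consists of scalar variables and of arrays with three indices (an array of lower
dimension uses index `0` in the remaining places). A program is a finite piece of syntax; every
operation, memory access, test and assignment that is executed is charged one unit. -/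

/-- Memory contents: natural-number and real-number scalars and arrays. -/
structure Store where
  nvar : ℕ → ℕ
  narr : ℕ → ℕ → ℕ → ℕ → ℕ
  rvar : ℕ → ℝ
  rarr : ℕ → ℕ → ℕ → ℕ → ℝ

/-- Natural-number expressions; `get a i j k` is the array access `a[i, j, k]`. -/
inductive NExp where
  | lit (k : ℕ)
  | var (x : ℕ)
  | get (a : ℕ) (i j k : NExp)
  | add (e f : NExp)
  | sub (e f : NExp)

/-- Real-number expressions; the only constants are literals. -/
inductive RExp where
  | lit (k : ℕ)
  | var (x : ℕ)
  | get (a : ℕ) (i j k : NExp)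
  | add (e f : RExp)
  | sub (e f : RExp)
  | mul (e f : RExp)

/-- Tests. -/
inductive Test where
  | nle (e f : NExp)
  | rle (e f : RExp)
  | neg (b : Test)
  | conj (b c : Test)

/-- Programs. -/
inductive Prog where
  | skip
  | nset (x : ℕ) (e : NExp)
  | nput (a : ℕ) (i j k : NExp) (e : NExp)
  | rset (x : ℕ) (e : RExp)
  | rput (a : ℕ) (i j k : NExp) (e : RExp)
  | seq (P Q : Prog)
  | cond (b : Test) (P Q : Prog)
  | loop (b : Test) (P : Prog)

def NExp.eval (s : Store) : NExp → ℕ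
  | lit k => k
  | var x => s.nvar x
  | get a i j k => s.narr a (i.eval s) (j.eval s) (k.eval s)
  | add e f => e.eval s + f.eval s
  | sub e f => e.eval s - f.eval s

/-- Number of operations in the evaluation of an expression. -/
def NExp.ops : NExp → ℕ
  | lit _ => 1
  | var _ => 1
  | get _ i j k => i.ops + j.ops + k.ops + 1
  | add e f => e.ops + f.ops + 1
  | sub e f => e.ops + f.ops + 1

noncomputable def RExp.eval (s : Store) : RExp → ℝ
  | lit k => (k : ℝ)
  | var x => s.rvar x
  | get a i j k => s.rarr a (i.eval s) (j.eval s) (k.eval s)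
  | add e f => e.eval s + f.eval s
  | sub e f => e.eval s - f.eval s
  | mul e f => e.eval s * f.eval s

def RExp.ops : RExp → ℕ
  | lit _ => 1
  | var _ => 1
  | get _ i j k => i.ops + j.ops + k.ops + 1
  | add e f => e.ops + f.ops + 1
  | sub e f => e.ops + f.ops + 1
  | mul e f => e.ops + f.ops + 1

def Test.holds (s : Store) : Test → Prop
  | nle e f => e.eval s ≤ f.eval s
  | rle e f => e.eval s ≤ f.eval s
  | neg b => ¬ b.holds s
  | conj b c => b.holds s ∧ c.holds s

def Test.ops : Test → ℕ
  | nle e f => e.ops + f.ops + 1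
  | rle e f => e.ops + f.ops + 1
  | neg b => b.ops + 1
  | conj b c => b.ops + c.ops + 1

/-- Overwrite one cell of an array. -/
def putCell {α : Type} (A : ℕ → ℕ → ℕ → ℕ → α) (a i j k : ℕ) (v : α) : ℕ → ℕ → ℕ → ℕ → α :=
  fun a₁ i₁ j₁ k₁ => if a₁ = a ∧ i₁ = i ∧ j₁ = j ∧ k₁ = k then v else A a₁ i₁ j₁ k₁

/-- `Exec P s T s₁`: started in `s`, the program `P` halts in `s₁` after exactly `T` steps. -/
inductive Exec : Prog → Store → ℕ → Store → Prop where
  | skip (s : Store) : Exec .skip s 1 s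
  | nset (s : Store) (x : ℕ) (e : NExp) :
      Exec (.nset x e) s (e.ops + 1) { s with nvar := Function.update s.nvar x (e.eval s) }
  | nput (s : Store) (a : ℕ) (i j k e : NExp) :
      Exec (.nput a i j k e) s (i.ops + j.ops + k.ops + e.ops + 1)
        { s with narr := putCell s.narr a (i.eval s) (j.eval s) (k.eval s) (e.eval s) }
  | rset (s : Store) (x : ℕ) (e : RExp) :
      Exec (.rset x e) s (e.ops + 1) { s with rvar := Function.update s.rvar x (e.eval s) }
  | rput (s : Store) (a : ℕ) (i j k : NExp) (e : RExp) :
      Exec (.rput a i j k e) s (i.ops + j.ops + k.ops + e.ops + 1)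
        { s with rarr := putCell s.rarr a (i.eval s) (j.eval s) (k.eval s) (e.eval s) }
  | seq {P Q : Prog} {s s₁ s₂ : Store} {T₁ T₂ : ℕ} :
      Exec P s T₁ s₁ → Exec Q s₁ T₂ s₂ → Exec (.seq P Q) s (T₁ + T₂) s₂
  | cond_true {b : Test} {P Q : Prog} {s s₁ : Store} {T : ℕ} :
      b.holds s → Exec P s T s₁ → Exec (.cond b P Q) s (b.ops + T) s₁
  | cond_false {b : Test} {P Q : Prog} {s s₁ : Store} {T : ℕ} :
      ¬ b.holds s → Exec Q s T s₁ → Exec (.cond b P Q) s (b.ops + T) s₁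
  | loop_true {b : Test} {P : Prog} {s s₁ s₂ : Store} {T₁ T₂ : ℕ} :
      b.holds s → Exec P s T₁ s₁ → Exec (.loop b P) s₁ T₂ s₂ →
      Exec (.loop b P) s (b.ops + T₁ + T₂) s₂
  | loop_false {b : Test} {P : Prog} {s : Store} :
      ¬ b.holds s → Exec (.loop b P) s b.ops s

/-- From every store satisfying `pre` (cells not mentioned in `pre` hold arbitrary garbage), the
program halts within `T` steps in a store satisfying `post`. -/
def Prog.Solves (P : Prog) (T : ℕ) (pre post : Store → Prop) : Prop :=
  ∀ s, pre s → ∃ s₁ T₁, Exec P s T₁ s₁ ∧ T₁ ≤ T ∧ post s₁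

/-! ### Generalized mixed-radix trees

Levels are counted from `0`: a node at level `j` has at most `t j` children, and the edges to its
children have length `c j`. -/

/-- A finite rooted tree in which a node at level `j` has at most `t j` children. A node is the word
read off on the path from the root; the edges leaving a node at level `j` carry distinct labels
`< t j`. -/
structure RadixTree (t : ℕ → ℕ) where
  nodes : Finset (List ℕ)
  root_mem : [] ∈ nodes
  closed : ∀ (w : List ℕ) (a : ℕ), w ++ [a] ∈ nodes → w ∈ nodes ∧ a < t w.length

/-- The depth `L(i)` of a node at level `i`: the sum of the first `i` edge lengths. -/
noncomputable def depth (c : ℕ → ℝ) (i : ℕ) : ℝ := ∑ j ∈ Finset.range i, c j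

def RadixTree.HasChild {t : ℕ → ℕ} (T : RadixTree t) (w : List ℕ) : Prop :=
  ∃ a, w ++ [a] ∈ T.nodes

/-- `v` enumerates the leaves of `T`, each exactly once; in particular `T` has `n` leaves. -/
def RadixTree.IsLabelling {t : ℕ → ℕ} (T : RadixTree t) {n : ℕ} (v : Fin n → List ℕ) : Prop :=
  Function.Injective v ∧ ∀ w, (∃ k, v k = w) ↔ w ∈ T.nodes ∧ ¬ T.HasChild w

/-- Cost of a tree with leaves `v` carrying the weights `p`. -/
noncomputable def treeCost (c : ℕ → ℝ) {n : ℕ} (p : Fin n → ℝ) (v : Fin n → List ℕ) : ℝ :=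
  ∑ k, depth c (v k).length * p k

/-- `v` labels the leaves of a tree with `n` leaves that has minimum cost among all (labelled)
trees with `n` leaves. -/
def IsOptimalTree (t : ℕ → ℕ) (c : ℕ → ℝ) {n : ℕ} (p : Fin n → ℝ) (v : Fin n → List ℕ) : Prop :=
  (∃ T : RadixTree t, T.IsLabelling v) ∧
    ∀ (T : RadixTree t) (u : Fin n → List ℕ), T.IsLabelling u → treeCost c p v ≤ treeCost c p u

/-! ### Mixed-radix codes -/

/-- A prefix-free code of `n` words in which position `j` of a word uses an alphabet of size
`t j`. -/
def IsMixedRadixCode (t : ℕ → ℕ) {n : ℕ} (w : Fin n → List ℕ) : Prop :=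
  (∀ k (j : ℕ) (hj : j < (w k).length), (w k)[j] < t j) ∧ ∀ k l, k ≠ l → ¬ w k <+: w l

/-- Expected length of the code. -/
noncomputable def codeCost {n : ℕ} (p : Fin n → ℝ) (w : Fin n → List ℕ) : ℝ :=
  ∑ k, p k * ((w k).length : ℝ)

def IsOptimalCode (t : ℕ → ℕ) {n : ℕ} (p : Fin n → ℝ) (w : Fin n → List ℕ) : Prop :=
  IsMixedRadixCode t w ∧ ∀ u : Fin n → List ℕ, IsMixedRadixCode t u → codeCost p w ≤ codeCost p u

/-! ### The dynamic programming table -/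

/-- An `i`-level tree: all nodes are on levels `≤ i`, and some of the nodes on level `i` are tagged
as internal. -/
structure LevelTree (t : ℕ → ℕ) (i : ℕ) extends RadixTree t where
  level_le : ∀ w ∈ nodes, w.length ≤ i
  tagged : Finset (List ℕ)
  tagged_mem : ∀ w ∈ tagged, w ∈ nodes ∧ w.length = i

section

variable {t : ℕ → ℕ} {i : ℕ}

def LevelTree.Internal (T : LevelTree t i) (w : List ℕ) : Prop :=
  T.toRadixTree.HasChild w ∨ w ∈ T.tagged

open Classical in
noncomputable def LevelTree.leaves (T : LevelTree t i) : Finset (List ℕ) :=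
  T.nodes.filter fun w => ¬ T.Internal w

/-- Every node with children has all possible children. -/
def LevelTree.Full (T : LevelTree t i) : Prop :=
  ∀ w, T.toRadixTree.HasChild w → ∀ a < t w.length, w ++ [a] ∈ T.nodes

/-- The signature of the truncation of `T` to the levels `≤ j`: the number of leaves on these levels
and the number of internal nodes on level `j`. For `j = i` it is the signature of `T`. -/
noncomputable def LevelTree.sig (T : LevelTree t i) (j : ℕ) : ℕ × ℕ :=
  open Classical in
  ((T.leaves.filter fun w => w.length ≤ j).card,
    (T.nodes.filter fun w => T.Internal w ∧ w.length = j).card)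

/-- The levels of the leaves of `T`, from top to bottom. -/
noncomputable def LevelTree.leafLevels (T : LevelTree t i) : List ℕ :=
  (T.leaves.val.map List.length).sort (· ≤ ·)

/-- The `i`-level partial cost: the leaves, from top to bottom, carry the first weights, and all
remaining weights are charged the depth of level `i`. -/
noncomputable def LevelTree.partialCost (c p : ℕ → ℝ) (n : ℕ) (T : LevelTree t i) : ℝ :=
  ∑ k ∈ Finset.range T.leaves.card, depth c (T.leafLevels.getD k 0) * p k +
    depth c i * ∑ k ∈ Finset.Ico T.leaves.card n, p k

end

/-- `(m, b)` is a valid `i`-level signature. The arity of the nodes on level `i - 1` is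
`t (i - 1)`. -/
def Valid (t : ℕ → ℕ) (n i m b : ℕ) : Prop :=
  (0 < b ∧ m + b ≤ n) ∨
    (b = 0 ∧ 1 ≤ i ∧ max n (t (i - 1)) ≤ m ∧ m ≤ n + t (i - 1) - 1)

/-- The partial costs of the full `i`-level trees with signature `(m, b)` all of whose truncations
have valid signatures. -/
def costSet (t : ℕ → ℕ) (c p : ℕ → ℝ) (n i m b : ℕ) : Set ℝ :=
  {x | ∃ T : LevelTree t i, T.Full ∧ T.sig i = (m, b) ∧
    (∀ j ≤ i, Valid t n j (T.sig j).1 (T.sig j).2) ∧ x = T.partialCost c p n}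

open Classical in
/-- The table entry `OPT^i[m, b]`: the minimum of a finite set of costs, `⊤` if it is empty. -/
noncomputable def OPT (t : ℕ → ℕ) (c p : ℕ → ℝ) (n i m b : ℕ) : WithTop ℝ :=
  if (costSet t c p n i m b).Nonempty then ((sInf (costSet t c p n i m b) : ℝ) : WithTop ℝ) else ⊤

/-- `W_m`, the sum of all weights but the first `m`. -/
noncomputable def tailSum (p : ℕ → ℝ) (n m : ℕ) : ℝ := ∑ k ∈ Finset.Ico m n, p k

/-- The value `γ(b₁)` for the batch `m + b = d` on level `i + 1`. -/
noncomputable def gam (t : ℕ → ℕ) (c p : ℕ → ℝ) (n i d b₁ : ℕ) : WithTop ℝ :=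
  OPT t c p n i (d - b₁ * t i) b₁ + ((c i * tailSum p n (d - b₁ * t i) : ℝ) : WithTop ℝ)

/-- Weights in non-increasing order, padded with zeros from position `n` on. -/
def SortedWeights (n : ℕ) (p : ℕ → ℝ) : Prop :=
  Antitone p ∧ (∀ k, 0 ≤ p k) ∧ ∀ k, n ≤ k → p k = 0

/-! ### Input and output conventions -/

/-- Machine representation of a table entry: costs are nonnegative, and `-1` stands for `⊤`. -/
noncomputable def enc (x : WithTop ℝ) : ℝ := x.untopD (-1)

/-- Natural array `0` holds the first `l` arities. -/
def Store.HasArities (s : Store) (t : ℕ → ℕ) (l : ℕ) : Prop := ∀ j < l, s.narr 0 j 0 0 = t j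

/-- Real array `0` holds the weights `p`. -/
def Store.HasWeights (s : Store) {n : ℕ} (p : Fin n → ℝ) : Prop := ∀ k : Fin n, s.rarr 0 k 0 0 = p k

/-- Real array `1` holds the first `l` edge lengths. -/
def Store.HasLengths (s : Store) (c : ℕ → ℝ) (l : ℕ) : Prop := ∀ j < l, s.rarr 1 j 0 0 = c j

/-- Real array `3` holds `W_0, …, W_n`. -/
def Store.HasTails (s : Store) (p : ℕ → ℝ) (n : ℕ) : Prop :=
  ∀ m ≤ n, s.rarr 3 m 0 0 = tailSum p n m

/-- Real array `2` holds `OPT^i[m, b]` in cell `[i, m, b]`, for all valid `i`-level signatures. -/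
def Store.HasLevel (s : Store) (t : ℕ → ℕ) (c p : ℕ → ℝ) (n i : ℕ) : Prop :=
  ∀ m b, Valid t n i m b → s.rarr 2 i m b = enc (OPT t c p n i m b)

/-- The same for the batch of valid signatures with `m + b = d`. -/
def Store.HasBatch (s : Store) (t : ℕ → ℕ) (c p : ℕ → ℝ) (n i d : ℕ) : Prop :=
  ∀ m b, Valid t n i m b → m + b = d → s.rarr 2 i m b = enc (OPT t c p n i m b)

/-- Output words: natural array `2` holds the length of word `k` in cell `[k, 0, 0]`, natural array
`1` holds its letter at position `j` in cell `[k, j, 0]`. -/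
def Store.words (s : Store) (n : ℕ) (k : Fin n) : List ℕ :=
  List.ofFn fun j : Fin (s.narr 2 k 0 0) => s.narr 1 k j 0

end MixedRadix

open MixedRadix

namespace MixedRadix

/-! ### Reasoning about programs -/

-- The weight with index k pays the edge length c_j exactly when its leaf lies below level j, that
-- is, when m_j ≤ k, where m_j counts the leaves on levels ≤ j. Summed by levels instead of by
-- leaves, the partial cost of an i-level tree is Σ_{j<i} c_j W_{m_j}, so it depends on the tree
-- only through its signatures (`sum_depth_eq_pathCost`, `LevelTree.partialCost_eq`). A sequence of
-- valid signatures comes from a full tree iff it starts with (0, 1), m is non-decreasing and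
-- m_{j+1} + b_{j+1} = m_j + b_j t_j (`IsPath`, `LevelTree.Full.isPath`, `IsPath.exists_tree`).
-- Trees may therefore be replaced by number sequences (`mem_costSet_iff`).
--
-- Batching. A predecessor of (m, b) on level i + 1, with d = m + b, is (d - b' t_i, b'): it depends
-- on m and b through d only, and the condition that m does not decrease reads b ≤ b' t_i. Hence the
-- admissible b' of one batch form nested sets, and lowering b by one adds at most one b'. This
-- gives the minimum over γ (`OPT_succ`) and the running minimum (`OPT_batch`).
--
-- Optimal cost. Labelled leaves of trees are the same thing as prefix codes (`isOptimalTree_iff`).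
-- For the lower bound, take any code and let M_j be the number of its words of length ≤ j. The
-- other n - M_j words pay c_j, and their weights sum to at least W_{M_j}. A Kraft-type count shows
-- that the full tree with the same M_j has at least as many inner nodes as the code has proper
-- prefixes. Cutting this tree at the first level where leaves and inner nodes together reach n, and
-- keeping only as many inner nodes above the cut as are needed, yields a complete valid sequence of
-- at most n levels and no larger cost (`IsMixedRadixCode.exists_path_le`). For the upper bound, a
-- sequence with b_i = 0 has m_i ≥ n; its first n leaves from the top, listed as words in
-- lexicographic order, form a code of the same cost (`IsPath.exists_code`). Each word is obtained
-- from its predecessor by raising the last digit that can be raised and filling up with zeros.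
--
-- Programs. `Prog.Runs` is a total-correctness judgement with a time bound; loop-free code is
-- symbolically executed by `Prog.run`, and `Frame` records what is left alone. Multiples of t_i are
-- maintained by addition. A level costs O(n ^ 2): the batches d ≤ n take O(d) each, and the at most
-- n remaining entries, those with b = 0, take O(n) each however large t_i is. The optimal tree is
-- found by sorting, filling the table, choosing the best entry with b = 0, tracing back in O(n) per
-- level, and writing the words in O(n) each.

attribute [simp] NExp.eval RExp.eval Test.holds NExp.ops RExp.ops Test.ops

/-- Started in `s`, the program halts within `T` steps in a store satisfying `Q`. -/
def Prog.Runs (P : Prog) (s : Store) (T : ℕ) (Q : Store → Prop) : Prop :=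
  ∃ s₁ T₁, Exec P s T₁ s₁ ∧ T₁ ≤ T ∧ Q s₁

theorem Prog.Runs.mono {P : Prog} {s : Store} {T T' : ℕ} {Q Q' : Store → Prop}
    (h : P.Runs s T Q) (hT : T ≤ T') (hQ : ∀ s₁, Q s₁ → Q' s₁) : P.Runs s T' Q' := by
  obtain ⟨s₁, T₁, h₁, h₂, h₃⟩ := h
  exact ⟨s₁, T₁, h₁, h₂.trans hT, hQ _ h₃⟩

theorem Prog.Runs.seq {P R : Prog} {s : Store} {T₁ T₂ : ℕ} {Q Q' : Store → Prop}
    (h : P.Runs s T₁ Q) (hQ : ∀ s₁, Q s₁ → R.Runs s₁ T₂ Q') :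
    (Prog.seq P R).Runs s (T₁ + T₂) Q' := by
  obtain ⟨s₁, T, h₁, h₂, h₃⟩ := h
  obtain ⟨s₂, T', h₁', h₂', h₃'⟩ := hQ _ h₃
  exact ⟨s₂, T + T', .seq h₁ h₁', add_le_add h₂ h₂', h₃'⟩

open Classical in
theorem Prog.Runs.cond {b : Test} {P R : Prog} {s : Store} {T : ℕ} {Q : Store → Prop}
    (h₁ : b.holds s → P.Runs s T Q) (h₂ : ¬ b.holds s → R.Runs s T Q) :
    (Prog.cond b P R).Runs s (b.ops + T) Q := by
  by_cases hb : b.holds s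
  · obtain ⟨s₁, T₁, h, hT, hQ⟩ := h₁ hb
    exact ⟨s₁, _, .cond_true hb h, by omega, hQ⟩
  · obtain ⟨s₁, T₁, h, hT, hQ⟩ := h₂ hb
    exact ⟨s₁, _, .cond_false hb h, by omega, hQ⟩

/-- A loop that makes exactly `N` rounds. -/
theorem Prog.Runs.loop {b : Test} {P : Prog} {B : ℕ} (I : ℕ → Store → Prop) (N : ℕ) {s : Store}
    (h0 : I 0 s)
    (hstep : ∀ k s, k < N → I k s → b.holds s ∧ P.Runs s B (I (k + 1)))
    (hend : ∀ s, I N s → ¬ b.holds s) :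
    (Prog.loop b P).Runs s ((N + 1) * (B + b.ops)) (I N) := by
  -- Induction on the number `m` of rounds still to be made. The extra factor in `N + 1` pays for
  -- the final failing test.
  suffices H : ∀ m k s, k + m = N → I k s →
      (Prog.loop b P).Runs s ((m + 1) * (B + b.ops)) (I N) from H N 0 s (by simp) h0
  intro m
  induction m with
  | zero =>
    intro k s hk hI
    obtain rfl : k = N := by simpa using hk
    exact ⟨s, _, .loop_false (hend s hI), by simp, hI⟩
  | succ m ih =>
    intro k s hk hI
    obtain ⟨hb, s₁, T₁, h₁, h₂, h₃⟩ := hstep k s (by omega) hI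
    obtain ⟨s₂, T₂, h₁', h₂', h₃'⟩ := ih (k + 1) s₁ (by omega) h₃
    refine ⟨s₂, _, .loop_true hb h₁ h₁', ?_, h₃'⟩
    rw [add_mul (m + 1) 1]
    omega

/-- The effect of a program without loops. -/
noncomputable def Prog.run : Prog → Store → Store
  | skip, s => s
  | nset x e, s => { s with nvar := Function.update s.nvar x (e.eval s) }
  | nput a i j k e, s =>
      { s with narr := putCell s.narr a (i.eval s) (j.eval s) (k.eval s) (e.eval s) }
  | rset x e, s => { s with rvar := Function.update s.rvar x (e.eval s) }
  | rput a i j k e, s =>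
      { s with rarr := putCell s.rarr a (i.eval s) (j.eval s) (k.eval s) (e.eval s) }
  | seq P Q, s => Q.run (P.run s)
  | cond b P Q, s => open Classical in if b.holds s then P.run s else Q.run s
  -- A junk value: `Prog.loopFree` excludes this case wherever `Prog.run` is used.
  | loop _ _, s => s

attribute [simp] Prog.run

def Prog.loopFree : Prog → Bool
  | seq P Q => P.loopFree && Q.loopFree
  | cond _ P Q => P.loopFree && Q.loopFree
  | loop _ _ => false
  | _ => true

/-- A bound for the running time of a program without loops. -/
def Prog.cost : Prog → ℕ
  | skip => 1
  | nset _ e => e.ops + 1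
  | nput _ i j k e => i.ops + j.ops + k.ops + e.ops + 1
  | rset _ e => e.ops + 1
  | rput _ i j k e => i.ops + j.ops + k.ops + e.ops + 1
  | seq P Q => P.cost + Q.cost
  -- The sum of both branches instead of their maximum; only an upper bound is needed.
  | cond b P Q => b.ops + (P.cost + Q.cost)
  | loop _ _ => 0

theorem Prog.Runs.of_loopFree {P : Prog} (h : P.loopFree = true) {s : Store} {Q : Store → Prop}
    (hQ : Q (P.run s)) : P.Runs s P.cost Q := by
  suffices H : ∃ T, Exec P s T (P.run s) ∧ T ≤ P.cost by
    obtain ⟨T, h₁, h₂⟩ := H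
    exact ⟨_, T, h₁, h₂, hQ⟩
  clear hQ
  induction P generalizing s with
  | skip => exact ⟨_, .skip s, le_rfl⟩
  | nset x e => exact ⟨_, .nset s x e, le_rfl⟩
  | nput a i j k e => exact ⟨_, .nput s a i j k e, le_rfl⟩
  | rset x e => exact ⟨_, .rset s x e, le_rfl⟩
  | rput a i j k e => exact ⟨_, .rput s a i j k e, le_rfl⟩
  | seq P Q ihP ihQ =>
    simp only [Prog.loopFree, Bool.and_eq_true] at h
    obtain ⟨T₁, h₁, h₁'⟩ := ihP h.1 (s := s)
    obtain ⟨T₂, h₂, h₂'⟩ := ihQ h.2 (s := P.run s)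
    exact ⟨_, .seq h₁ h₂, add_le_add h₁' h₂'⟩
  | cond b P Q ihP ihQ =>
    simp only [Prog.loopFree, Bool.and_eq_true] at h
    obtain ⟨T₁, h₁, h₁'⟩ := ihP h.1 (s := s)
    obtain ⟨T₂, h₂, h₂'⟩ := ihQ h.2 (s := s)
    by_cases hb : b.holds s
    · exact ⟨_, by simpa [hb] using Exec.cond_true (Q := Q) hb h₁, by simp only [Prog.cost]; omega⟩
    · exact ⟨_, by simpa [hb] using Exec.cond_false (P := P) hb h₂, by simp only [Prog.cost]; omega⟩
  | loop b P => simp [Prog.loopFree] at h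

/-! ### Frames: what a program leaves unchanged -/

/-- Syntactic and Boolean-valued, so that for a concrete program the side condition of a frame fact
is closed by `rfl`. -/
def Prog.keepsN : Prog → ℕ → Bool
  | nset x _, y => x != y
  | seq P Q, y => P.keepsN y && Q.keepsN y
  | cond _ P Q, y => P.keepsN y && Q.keepsN y
  | loop _ P, y => P.keepsN y
  | _, _ => true

def Prog.keepsNA : Prog → ℕ → Bool
  | nput a _ _ _ _, y => a != y
  | seq P Q, y => P.keepsNA y && Q.keepsNA y
  | cond _ P Q, y => P.keepsNA y && Q.keepsNA y
  | loop _ P, y => P.keepsNA y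
  | _, _ => true

def Prog.keepsR : Prog → ℕ → Bool
  | rset x _, y => x != y
  | seq P Q, y => P.keepsR y && Q.keepsR y
  | cond _ P Q, y => P.keepsR y && Q.keepsR y
  | loop _ P, y => P.keepsR y
  | _, _ => true

def Prog.keepsRA : Prog → ℕ → Bool
  | rput a _ _ _ _, y => a != y
  | seq P Q, y => P.keepsRA y && Q.keepsRA y
  | cond _ P Q, y => P.keepsRA y && Q.keepsRA y
  | loop _ P, y => P.keepsRA y
  | _, _ => true

/-- `s₁` agrees with `s` on all variables and arrays to which `P` does not write. -/
structure Frame (P : Prog) (s s₁ : Store) : Prop where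
  n : ∀ x, P.keepsN x = true → s₁.nvar x = s.nvar x
  na : ∀ a, P.keepsNA a = true → s₁.narr a = s.narr a
  r : ∀ x, P.keepsR x = true → s₁.rvar x = s.rvar x
  ra : ∀ a, P.keepsRA a = true → s₁.rarr a = s.rarr a

theorem Frame.refl (P : Prog) (s : Store) : Frame P s s :=
  ⟨fun _ _ => rfl, fun _ _ => rfl, fun _ _ => rfl, fun _ _ => rfl⟩

theorem Frame.trans {P : Prog} {s s₁ s₂ : Store} (h : Frame P s s₁) (h' : Frame P s₁ s₂) :
    Frame P s s₂ :=
  ⟨fun x hx => (h'.n x hx).trans (h.n x hx), fun x hx => (h'.na x hx).trans (h.na x hx),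
    fun x hx => (h'.r x hx).trans (h.r x hx), fun x hx => (h'.ra x hx).trans (h.ra x hx)⟩

theorem Frame.mono {P Q : Prog} {s s₁ : Store} (h : Frame P s s₁)
    (hn : ∀ x, Q.keepsN x = true → P.keepsN x = true)
    (hna : ∀ x, Q.keepsNA x = true → P.keepsNA x = true)
    (hr : ∀ x, Q.keepsR x = true → P.keepsR x = true)
    (hra : ∀ x, Q.keepsRA x = true → P.keepsRA x = true) : Frame Q s s₁ :=
  ⟨fun x hx => h.n x (hn x hx), fun x hx => h.na x (hna x hx),
    fun x hx => h.r x (hr x hx), fun x hx => h.ra x (hra x hx)⟩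

theorem Frame.seq_left {P Q : Prog} {s s₁ : Store} (h : Frame P s s₁) :
    Frame (.seq P Q) s s₁ := by
  apply h.mono <;> simp +contextual [Prog.keepsN, Prog.keepsNA, Prog.keepsR, Prog.keepsRA]

theorem Frame.seq_right {P Q : Prog} {s s₁ : Store} (h : Frame Q s s₁) :
    Frame (.seq P Q) s s₁ := by
  apply h.mono <;> simp +contextual [Prog.keepsN, Prog.keepsNA, Prog.keepsR, Prog.keepsRA]

theorem Frame.loop {b : Test} {P : Prog} {s s₁ : Store} (h : Frame P s s₁) :
    Frame (.loop b P) s s₁ := by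
  apply h.mono <;> simp +contextual [Prog.keepsN, Prog.keepsNA, Prog.keepsR, Prog.keepsRA]

theorem Exec.frame {P : Prog} {s s₁ : Store} {T : ℕ} (h : Exec P s T s₁) : Frame P s s₁ := by
  induction h with
  | skip s => exact Frame.refl _ _
  | nset s x e =>
    refine ⟨fun y hy => ?_, fun _ _ => rfl, fun _ _ => rfl, fun _ _ => rfl⟩
    have : y ≠ x := by rintro rfl; simp [Prog.keepsN] at hy
    simp [this]
  | nput s a i j k e =>
    refine ⟨fun _ _ => rfl, fun y hy => ?_, fun _ _ => rfl, fun _ _ => rfl⟩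
    have : y ≠ a := by rintro rfl; simp [Prog.keepsNA] at hy
    funext i j k
    simp [putCell, this]
  | rset s x e =>
    refine ⟨fun _ _ => rfl, fun _ _ => rfl, fun y hy => ?_, fun _ _ => rfl⟩
    have : y ≠ x := by rintro rfl; simp [Prog.keepsR] at hy
    simp [this]
  | rput s a i j k e =>
    refine ⟨fun _ _ => rfl, fun _ _ => rfl, fun _ _ => rfl, fun y hy => ?_⟩
    have : y ≠ a := by rintro rfl; simp [Prog.keepsRA] at hy
    funext i j k
    simp [putCell, this]
  | seq _ _ ih₁ ih₂ => exact ih₁.seq_left.trans ih₂.seq_right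
  | cond_true _ _ ih =>
    apply ih.mono <;> simp +contextual [Prog.keepsN, Prog.keepsNA, Prog.keepsR, Prog.keepsRA]
  | cond_false _ _ ih =>
    apply ih.mono <;> simp +contextual [Prog.keepsN, Prog.keepsNA, Prog.keepsR, Prog.keepsRA]
  | loop_true _ _ _ ih₁ ih₂ => exact ih₁.loop.trans ih₂
  | loop_false _ => exact Frame.refl _ _

theorem Prog.Runs.frame {P : Prog} {s : Store} {T : ℕ} {Q : Store → Prop} (h : P.Runs s T Q) :
    P.Runs s T (fun s₁ => Frame P s s₁ ∧ Q s₁) := by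
  obtain ⟨s₁, T₁, h₁, h₂, h₃⟩ := h
  exact ⟨s₁, T₁, h₁, h₂, h₁.frame, h₃⟩

/-- Loop-free programs, with their frame. -/
theorem Prog.Runs.block {P : Prog} (h : P.loopFree = true) {s : Store} {Q : Store → Prop}
    (hQ : Frame P s (P.run s) → Q (P.run s)) : P.Runs s P.cost Q :=
  (Prog.Runs.of_loopFree (Q := fun s₁ => s₁ = P.run s) h rfl).frame.mono le_rfl
    (by rintro s₁ ⟨hF, rfl⟩; exact hQ hF)

/-- The rule for loops, where the invariant is strengthened by the frame of the loop. -/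
theorem Prog.Runs.loop_frame {b : Test} {P : Prog} {B : ℕ} (I : ℕ → Store → Prop) (N : ℕ)
    {s : Store} (h0 : I 0 s)
    (hstep : ∀ k s₁, k < N → Frame P s s₁ → I k s₁ → b.holds s₁ ∧ P.Runs s₁ B (I (k + 1)))
    (hend : ∀ s₁, Frame P s s₁ → I N s₁ → ¬ b.holds s₁) :
    (Prog.loop b P).Runs s ((N + 1) * (B + b.ops)) (fun s₁ => Frame P s s₁ ∧ I N s₁) := by
  refine Prog.Runs.loop (fun k s₁ => Frame P s s₁ ∧ I k s₁) N ⟨Frame.refl _ _, h0⟩ ?_ ?_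
  · rintro k s₁ hk ⟨hF, hI⟩
    obtain ⟨hb, h⟩ := hstep k s₁ hk hF hI
    exact ⟨hb, h.frame.mono le_rfl fun s₂ ⟨hF₂, hI₂⟩ => ⟨hF.trans hF₂, hI₂⟩⟩
  · rintro s₁ ⟨hF, hI⟩
    exact hend s₁ hF hI

/-! ### Counting loops -/

def Test.nlt (e f : NExp) : Test := .neg (.nle f e)

@[simp] theorem Test.nlt_holds (e f : NExp) (s : Store) :
    (Test.nlt e f).holds s ↔ e.eval s < f.eval s := by simp [Test.nlt]

/-- `for x < e do P`, starting from the current value of `x`. -/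
def Prog.upto (x : ℕ) (e : NExp) (P : Prog) : Prog :=
  .loop (Test.nlt (.var x) e) (.seq P (.nset x (.add (.var x) (.lit 1))))

/-- The store after an assignment to a natural-number variable. -/
def Store.setN (s : Store) (x v : ℕ) : Store := { s with nvar := Function.update s.nvar x v }

@[simp] theorem Store.setN_nvar (s : Store) (x v y : ℕ) :
    (s.setN x v).nvar y = if y = x then v else s.nvar y := by
  simp [Store.setN, Function.update_apply]

@[simp] theorem Store.setN_narr (s : Store) (x v : ℕ) : (s.setN x v).narr = s.narr := rfl
@[simp] theorem Store.setN_rvar (s : Store) (x v : ℕ) : (s.setN x v).rvar = s.rvar := rfl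
@[simp] theorem Store.setN_rarr (s : Store) (x v : ℕ) : (s.setN x v).rarr = s.rarr := rfl

/-- The rule for counting loops. -/
theorem Prog.Runs.upto {x : ℕ} {e : NExp} {P : Prog} {B : ℕ} (I : ℕ → Store → Prop) (k₀ N : ℕ)
    {s : Store} (hx : s.nvar x = k₀) (hk₀ : k₀ ≤ N) (hkeep : P.keepsN x = true)
    (h0 : I k₀ s)
    (he : ∀ k s₁, Frame (.upto x e P) s s₁ → I k s₁ → e.eval s₁ = N)
    (hstep : ∀ k s₁, k₀ ≤ k → k < N → Frame (.upto x e P) s s₁ → s₁.nvar x = k → I k s₁ →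
      P.Runs s₁ B (fun s₂ => I (k + 1) (s₂.setN x (k + 1)))) :
    (Prog.upto x e P).Runs s ((N - k₀ + 1) * (B + e.ops + 7))
      (fun s₁ => Frame (.upto x e P) s s₁ ∧ s₁.nvar x = N ∧ I N s₁) := by
  have hF' : ∀ s₁, Frame (.seq P (.nset x (.add (.var x) (.lit 1)))) s s₁ →
      Frame (.upto x e P) s s₁ := fun s₁ h => h.loop
  -- The increment costs 4 and the test `e.ops + 3`, which together give the constant 7.
  refine (Prog.Runs.loop_frame (B := B + 4) (fun k s₁ => s₁.nvar x = k₀ + k ∧ I (k₀ + k) s₁)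
    (N - k₀) ⟨by simpa using hx, by simpa using h0⟩ ?_ ?_).mono ?_ ?_
  · rintro k s₁ hk hF ⟨hx₁, hI⟩
    refine ⟨?_, ?_⟩
    · simp only [Test.nlt_holds, NExp.eval, he _ _ (hF' _ hF) hI, hx₁]
      omega
    · refine Prog.Runs.seq
        (hstep (k₀ + k) s₁ (by omega) (by omega) (hF' _ hF) hx₁ hI).frame ?_
      rintro s₂ ⟨hF₂, hI₂⟩
      refine Prog.Runs.of_loopFree (P := .nset x (.add (.var x) (.lit 1))) rfl ?_
      have : s₂.nvar x = k₀ + k := by rw [hF₂.n x hkeep, hx₁]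
      simp only [Prog.run, NExp.eval, this]
      exact ⟨by simp [add_assoc], hI₂⟩
  · rintro s₁ hF ⟨hx₁, hI⟩
    simp only [Test.nlt_holds, NExp.eval, he _ _ (hF' _ hF) hI, hx₁]
    omega
  · simp only [Test.nlt, Test.ops, NExp.ops]
    gcongr ?_ * ?_ <;> omega
  · rintro s₁ ⟨hF, hx₁, hI⟩
    rw [show k₀ + (N - k₀) = N by omega] at hx₁ hI
    exact ⟨hF' _ hF, hx₁, hI⟩

/-! ### Signatures of trees as number sequences -/

/-- The possible sequences of signatures of the truncations of a full tree. -/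
structure IsPath (t : ℕ → ℕ) (n i : ℕ) (m b : ℕ → ℕ) : Prop where
  m_zero : m 0 = 0
  b_zero : b 0 = 1
  step : ∀ j < i, m (j + 1) + b (j + 1) = m j + b j * t j
  mono : ∀ j < i, m j ≤ m (j + 1)
  valid : ∀ j ≤ i, Valid t n j (m j) (b j)

/-- The cost of a sequence of signatures. -/
noncomputable def pathCost (c p : ℕ → ℝ) (n i : ℕ) (m : ℕ → ℕ) : ℝ :=
  ∑ j ∈ Finset.range i, c j * tailSum p n (m j)

theorem depth_eq_sum_ite (c : ℕ → ℝ) {x i : ℕ} (h : x ≤ i) :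
    depth c x = ∑ j ∈ Finset.range i, if j < x then c j else 0 := by
  rw [← Finset.sum_filter, depth]
  congr 1
  ext j
  simp
  omega

/-- Interchange of summation: depth is a sum of edge lengths, and c_j is paid by exactly those
weights whose index is at least m_j, in total W_{m_j}. -/
theorem sum_depth_eq_pathCost (c p : ℕ → ℝ) (n i : ℕ) (m x : ℕ → ℕ)
    (hx : ∀ k < n, x k ≤ i) (h : ∀ k < n, ∀ j < i, j < x k ↔ m j ≤ k) :
    ∑ k ∈ Finset.range n, depth c (x k) * p k = pathCost c p n i m := by
  have h1 : ∀ k ∈ Finset.range n, depth c (x k) * p k =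
      ∑ j ∈ Finset.range i, if m j ≤ k then c j * p k else 0 := by
    intro k hk
    rw [Finset.mem_range] at hk
    rw [depth_eq_sum_ite c (hx k hk), Finset.sum_mul]
    refine Finset.sum_congr rfl fun j hj => ?_
    rw [Finset.mem_range] at hj
    simp [h k hk j hj, ite_mul]
  rw [Finset.sum_congr rfl h1, Finset.sum_comm, pathCost]
  refine Finset.sum_congr rfl fun j _ => ?_
  rw [← Finset.sum_filter, tailSum, Finset.mul_sum]
  refine Finset.sum_congr ?_ fun _ _ => rfl
  ext k
  simp
  omega

/-- In a sorted list the entries `≤ j` form an initial segment, so its length decides which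
positions hold them. -/
theorem getD_le_iff_lt_countP (l : List ℕ) (hl : l.Pairwise (· ≤ ·)) (j k : ℕ)
    (hk : k < l.length) : l.getD k 0 ≤ j ↔ k < l.countP (· ≤ j) := by
  induction l generalizing k with
  | nil => simp at hk
  | cons a l ih =>
    rw [List.pairwise_cons] at hl
    by_cases ha : a ≤ j
    · cases k with
      | zero => simp [ha]
      | succ k =>
        have := ih hl.2 k (by simpa using hk)
        simp [ha] at this ⊢
        exact this
    · have h0 : (a :: l).countP (· ≤ j) = 0 := by
        rw [List.countP_eq_zero]
        intro x hx
        rw [List.mem_cons] at hx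
        rcases hx with rfl | hx
        · simpa using ha
        · have := hl.1 x hx
          simp
          omega
      rw [h0]
      simp only [not_lt_zero, iff_false, not_le]
      cases k with
      | zero => simpa using ha
      | succ k =>
        have hk' : k < l.length := by simpa using hk
        have := hl.1 l[k] (List.getElem_mem _)
        simp [hk']
        omega

section

variable {t : ℕ → ℕ} {i : ℕ}

theorem LevelTree.getD_leafLevels_le_iff (T : LevelTree t i) (j k : ℕ) (hk : k < T.leaves.card) :
    T.leafLevels.getD k 0 ≤ j ↔ k < (T.sig j).1 := by
  classical
  have hl : T.leafLevels.length = T.leaves.card := by simp [LevelTree.leafLevels]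
  rw [getD_le_iff_lt_countP _ ?_ _ _ (hl ▸ hk)]
  · have : T.leafLevels.countP (· ≤ j) = (T.sig j).1 := by
      rw [← Multiset.coe_countP, LevelTree.leafLevels, Multiset.sort_eq, Multiset.countP_map]
      simp [LevelTree.sig, Finset.card_def]
    rw [this]
  · exact Multiset.pairwise_sort _ _

theorem LevelTree.leaves_level_le (T : LevelTree t i) {w : List ℕ} (hw : w ∈ T.leaves) :
    w.length ≤ i := by
  classical
  rw [LevelTree.leaves, Finset.mem_filter] at hw
  exact T.level_le w hw.1

theorem LevelTree.sig_self_fst (T : LevelTree t i) : (T.sig i).1 = T.leaves.card := by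
  classical
  simp only [LevelTree.sig]
  rw [Finset.filter_true_of_mem fun w hw => T.leaves_level_le hw]

/-- A weight that has no leaf yet is charged the depth of level i, so it behaves like a leaf on
level i; this defines `x` beyond `M`. If there are more than n leaves, the surplus ones carry weight
zero. -/
theorem LevelTree.partialCost_eq (T : LevelTree t i) (c : ℕ → ℝ) {p : ℕ → ℝ} {n : ℕ}
    (hp : ∀ k, n ≤ k → p k = 0) :
    T.partialCost c p n = pathCost c p n i fun j => (T.sig j).1 := by
  classical
  have hle : ∀ j, (T.sig j).1 ≤ T.leaves.card := fun j => Finset.card_filter_le _ _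
  set M := T.leaves.card with hM
  let x : ℕ → ℕ := fun k => if k < M then T.leafLevels.getD k 0 else i
  rw [← sum_depth_eq_pathCost c p n i _ x]
  · have h1 : ∑ k ∈ Finset.range n, depth c (x k) * p k =
        ∑ k ∈ Finset.range (max n M), depth c (x k) * p k := by
      apply Finset.sum_subset
      · intro k
        simp
        omega
      · intro k _ hk
        rw [hp k (by simpa using hk), mul_zero]
    have h2 : depth c i * ∑ k ∈ Finset.Ico M n, p k =
        ∑ k ∈ Finset.Ico M (max n M), depth c (x k) * p k := by
      rw [Finset.mul_sum]
      have : Finset.Ico M n = Finset.Ico M (max n M) := by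
        ext k
        simp
        omega
      rw [this]
      refine Finset.sum_congr rfl fun k hk => ?_
      rw [Finset.mem_Ico] at hk
      simp [x, not_lt.2 hk.1]
    rw [LevelTree.partialCost, ← hM, h1, h2, ← Finset.sum_range_add_sum_Ico _ (le_max_right n M)]
    congr 1
    refine Finset.sum_congr rfl fun k hk => ?_
    rw [Finset.mem_range] at hk
    simp [x, hk]
  · intro k _
    by_cases hk : k < M
    · simp only [x, hk, if_true]
      rw [T.getD_leafLevels_le_iff i k hk, T.sig_self_fst]
      exact hk
    · simp [x, hk]
  · intro k _ j hj
    by_cases hk : k < M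
    · simp only [x, hk, if_true]
      rw [← not_le, T.getD_leafLevels_le_iff j k hk, not_lt]
    · simp only [x, hk, if_false]
      exact ⟨fun _ => (hle j).trans (not_lt.1 hk), fun _ => hj⟩

/-- The alternative b = 0 of validity requires a level at least 1, so some node on level 0 is
internal, and that node is the root. -/
theorem LevelTree.sig_zero (T : LevelTree t i) {n : ℕ}
    (h : Valid t n 0 (T.sig 0).1 (T.sig 0).2) : T.sig 0 = (0, 1) := by
  classical
  have hb : 0 < (T.sig 0).2 := by
    rcases h with h | h
    · exact h.1
    · omega
  obtain ⟨w, hw⟩ := Finset.card_pos.1 hb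
  simp only [Finset.mem_filter, List.length_eq_zero_iff] at hw
  obtain ⟨hw, hI, rfl⟩ := hw
  have h1 : T.leaves.filter (fun w => w.length ≤ 0) = ∅ := by
    ext w
    simp only [LevelTree.leaves, Finset.mem_filter, Nat.le_zero, List.length_eq_zero_iff]
    constructor
    · rintro ⟨⟨-, h⟩, rfl⟩
      exact absurd hI h
    · simp
  have h2 : T.nodes.filter (fun w => T.Internal w ∧ w.length = 0) = {[]} := by
    ext w
    simp only [Finset.mem_filter, List.length_eq_zero_iff, Finset.mem_singleton]
    constructor
    · exact fun h => h.2.2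
    · rintro rfl
      exact ⟨hw, hI, rfl⟩
  simp only [LevelTree.sig, h1, h2]
  rfl

theorem LevelTree.sig_mono (T : LevelTree t i) {j j' : ℕ} (h : j ≤ j') :
    (T.sig j).1 ≤ (T.sig j').1 := by
  classical
  apply Finset.card_le_card
  intro w hw
  simp only [Finset.mem_filter] at hw ⊢
  exact ⟨hw.1, hw.2.trans h⟩

/-- A node on level `j + 1` is either a leaf, counted in the increase of the first component, or
internal. -/
theorem LevelTree.card_level (T : LevelTree t i) (j : ℕ) :
    (T.sig j).1 + (T.nodes.filter fun w => w.length = j + 1).card =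
      (T.sig (j + 1)).1 + (T.sig (j + 1)).2 := by
  classical
  have h1 : (T.sig (j + 1)).1 = (T.sig j).1 + (T.leaves.filter fun w => w.length = j + 1).card := by
    simp only [LevelTree.sig]
    rw [← Finset.card_union_of_disjoint]
    · congr 1
      ext w
      simp only [Finset.mem_filter, Finset.mem_union]
      constructor
      · rintro ⟨h, h'⟩
        rcases Nat.lt_or_ge j w.length with h2 | h2
        · exact Or.inr ⟨h, by omega⟩
        · exact Or.inl ⟨h, h2⟩
      · rintro (⟨h, h'⟩ | ⟨h, h'⟩)
        · exact ⟨h, by omega⟩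
        · exact ⟨h, by omega⟩
    · rw [Finset.disjoint_left]
      intro w h h'
      simp only [Finset.mem_filter] at h h'
      omega
  have h2 : (T.nodes.filter fun w => w.length = j + 1).card =
      (T.leaves.filter fun w => w.length = j + 1).card + (T.sig (j + 1)).2 := by
    simp only [LevelTree.sig, LevelTree.leaves]
    rw [← Finset.card_filter_add_card_filter_not (s := T.nodes.filter fun w => w.length = j + 1)
      (fun w => ¬ T.Internal w)]
    congr 2
    · ext w
      simp only [Finset.mem_filter]
      tauto
    · ext w
      simp only [Finset.mem_filter, not_not]
      tauto
  omega

/-- Tags occur on level i only, so for `j < i` an internal node on level j really has children, and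
by fullness all `t j` of them. -/
theorem LevelTree.Full.card_nodes {T : LevelTree t i} (hT : T.Full) {j : ℕ} (hj : j < i) :
    (T.nodes.filter fun w => w.length = j + 1).card = (T.sig j).2 * t j := by
  classical
  have : T.nodes.filter (fun w => w.length = j + 1) =
      ((T.nodes.filter fun w => T.Internal w ∧ w.length = j) ×ˢ Finset.range (t j)).image
        fun x => x.1 ++ [x.2] := by
    ext w
    simp only [Finset.mem_filter, Finset.mem_image, Finset.mem_product, Finset.mem_range,
      Prod.exists]
    constructor
    · rintro ⟨hw, hl⟩
      obtain ⟨u, a, rfl⟩ : ∃ u a, w = u ++ [a] := by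
        rcases List.eq_nil_or_concat w with rfl | ⟨u, a, h⟩
        · simp at hl
        · exact ⟨u, a, by simpa using h⟩
      have hu : u.length = j := by simpa using hl
      obtain ⟨h1, h2⟩ := T.closed u a hw
      exact ⟨u, a, ⟨⟨h1, Or.inl ⟨a, hw⟩, hu⟩, hu ▸ h2⟩, rfl⟩
    · rintro ⟨u, a, ⟨⟨hu, hI, rfl⟩, ha⟩, rfl⟩
      refine ⟨?_, by simp⟩
      rcases hI with hI | hI
      · exact hT u hI a ha
      · exact absurd (T.tagged_mem u hI).2 (by omega)
  rw [this, Finset.card_image_of_injective, Finset.card_product, Finset.card_range]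
  · rfl
  · rintro ⟨u, a⟩ ⟨v, b⟩ h
    simp only at h
    obtain ⟨h1, h2⟩ := List.append_inj' h rfl
    simp_all

theorem LevelTree.Full.isPath {T : LevelTree t i} (hT : T.Full) {n : ℕ}
    (hv : ∀ j ≤ i, Valid t n j (T.sig j).1 (T.sig j).2) :
    IsPath t n i (fun j => (T.sig j).1) (fun j => (T.sig j).2) where
  m_zero := by rw [T.sig_zero (hv 0 (Nat.zero_le _))]
  b_zero := by rw [T.sig_zero (hv 0 (Nat.zero_le _))]
  step j hj := by rw [← hT.card_nodes hj, T.card_level]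
  mono j _ := T.sig_mono (Nat.le_succ j)
  valid := hv

/-- The tree that consists of an internal root. -/
def LevelTree.single (t : ℕ → ℕ) : LevelTree t 0 where
  nodes := {[]}
  root_mem := by simp
  closed := by simp
  level_le := by simp
  tagged := {[]}
  tagged_mem := by simp

theorem LevelTree.single_full (t : ℕ → ℕ) : (LevelTree.single t).Full := by
  rintro w ⟨a, ha⟩
  simp [LevelTree.single] at ha

theorem LevelTree.single_sig (t : ℕ → ℕ) : (LevelTree.single t).sig 0 = (0, 1) := by
  classical
  have hI : ∀ w ∈ (LevelTree.single t).nodes, (LevelTree.single t).Internal w :=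
    fun w hw => Or.inr hw
  have h1 : (LevelTree.single t).leaves = ∅ :=
    Finset.filter_eq_empty_iff.2 fun w hw => by simpa using hI w hw
  have h2 : (LevelTree.single t).nodes.filter
      (fun w => (LevelTree.single t).Internal w ∧ w.length = 0) = {[]} := by
    rw [Finset.filter_true_of_mem]
    · rfl
    · intro w hw
      refine ⟨hI w hw, ?_⟩
      have : w = [] := by simpa [LevelTree.single] using hw
      simp [this]
  simp only [LevelTree.sig, h1, h2]
  simp

/-- Give all possible children to the tagged nodes. -/
def LevelTree.grow (T : LevelTree t i) (B : Finset (List ℕ))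
    (hB : B ⊆ (T.tagged ×ˢ Finset.range (t i)).image fun x => x.1 ++ [x.2]) :
    LevelTree t (i + 1) where
  nodes := T.nodes ∪ (T.tagged ×ˢ Finset.range (t i)).image fun x => x.1 ++ [x.2]
  root_mem := Finset.mem_union_left _ T.root_mem
  closed w a h := by
    rcases Finset.mem_union.1 h with h | h
    · exact ⟨Finset.mem_union_left _ (T.closed w a h).1, (T.closed w a h).2⟩
    · simp only [Finset.mem_image, Finset.mem_product, Finset.mem_range, Prod.exists] at h
      obtain ⟨u, b, ⟨hu, hb⟩, h⟩ := h
      obtain ⟨rfl, h2⟩ := List.append_inj' h rfl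
      obtain rfl : b = a := by simpa using h2
      obtain ⟨h1, h2⟩ := T.tagged_mem u hu
      exact ⟨Finset.mem_union_left _ h1, h2 ▸ hb⟩
  level_le w h := by
    rcases Finset.mem_union.1 h with h | h
    · exact (T.level_le w h).trans (Nat.le_succ i)
    · simp only [Finset.mem_image, Finset.mem_product, Finset.mem_range, Prod.exists] at h
      obtain ⟨u, b, ⟨hu, hb⟩, rfl⟩ := h
      simp [(T.tagged_mem u hu).2]
  tagged := B
  tagged_mem w h := by
    have h' := hB h
    refine ⟨Finset.mem_union_right _ h', ?_⟩
    simp only [Finset.mem_image, Finset.mem_product, Finset.mem_range, Prod.exists] at h'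
    obtain ⟨u, b, ⟨hu, hb⟩, rfl⟩ := h'
    simp [(T.tagged_mem u hu).2]

/-! ### Signatures of a tree grown by one level -/

section

variable (T : LevelTree t i) (B : Finset (List ℕ))
    (hB : B ⊆ (T.tagged ×ˢ Finset.range (t i)).image fun x => x.1 ++ [x.2])

theorem LevelTree.append_mem_grow {w : List ℕ} {a : ℕ} :
    w ++ [a] ∈ (T.grow B hB).nodes ↔ w ++ [a] ∈ T.nodes ∨ w ∈ T.tagged ∧ a < t i := by
  simp only [LevelTree.grow, Finset.mem_union, Finset.mem_image, Finset.mem_product,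
    Finset.mem_range, Prod.exists]
  refine or_congr Iff.rfl ⟨?_, ?_⟩
  · rintro ⟨u, b, ⟨hu, hb⟩, h⟩
    obtain ⟨rfl, h2⟩ := List.append_inj' h rfl
    obtain rfl : b = a := by simpa using h2
    exact ⟨hu, hb⟩
  · rintro ⟨hu, hb⟩
    exact ⟨w, a, ⟨hu, hb⟩, rfl⟩

theorem LevelTree.mem_grow {w : List ℕ} (hw : w.length ≤ i) :
    w ∈ (T.grow B hB).nodes ↔ w ∈ T.nodes := by
  simp only [LevelTree.grow, Finset.mem_union, Finset.mem_image, Finset.mem_product,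
    Finset.mem_range, Prod.exists, or_iff_left_iff_imp]
  rintro ⟨u, b, ⟨hu, hb⟩, rfl⟩
  have := (T.tagged_mem u hu).2
  simp at hw
  omega

theorem LevelTree.hasChild_grow {w : List ℕ} (ht : 0 < t i) :
    (T.grow B hB).toRadixTree.HasChild w ↔ T.Internal w := by
  simp only [RadixTree.HasChild, LevelTree.append_mem_grow, LevelTree.Internal]
  constructor
  · rintro ⟨a, h | h⟩
    · exact Or.inl ⟨a, h⟩
    · exact Or.inr h.1
  · rintro (⟨a, h⟩ | h)
    · exact ⟨a, Or.inl h⟩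
    · exact ⟨0, Or.inr ⟨h, ht⟩⟩

theorem LevelTree.internal_grow {w : List ℕ} (ht : 0 < t i) (hw : w.length ≤ i) :
    (T.grow B hB).Internal w ↔ T.Internal w := by
  rw [LevelTree.Internal, LevelTree.hasChild_grow T B hB ht, or_iff_left]
  intro h
  have := ((T.grow B hB).tagged_mem w h).2
  omega

/-- Growing replaces tags by children, so the internal nodes on levels `≤ i` remain the same. -/
theorem LevelTree.sig_grow (ht : 0 < t i) {j : ℕ} (hj : j ≤ i) :
    (T.grow B hB).sig j = T.sig j := by
  classical
  simp only [LevelTree.sig, LevelTree.leaves]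
  congr 2
  · ext w
    simp only [Finset.mem_filter]
    refine and_congr_left fun h => ?_
    rw [LevelTree.mem_grow T B hB (h.trans hj), LevelTree.internal_grow T B hB ht (h.trans hj)]
  · ext w
    simp only [Finset.mem_filter]
    constructor
    · rintro ⟨h1, h2, h3⟩
      rw [LevelTree.mem_grow T B hB (by omega)] at h1
      rw [LevelTree.internal_grow T B hB ht (by omega)] at h2
      exact ⟨h1, h2, h3⟩
    · rintro ⟨h1, h2, h3⟩
      rw [LevelTree.mem_grow T B hB (by omega), LevelTree.internal_grow T B hB ht (by omega)]
      exact ⟨h1, h2, h3⟩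

theorem LevelTree.sig_grow_succ : ((T.grow B hB).sig (i + 1)).2 = B.card := by
  classical
  simp only [LevelTree.sig]
  congr 1
  ext w
  simp only [Finset.mem_filter]
  constructor
  · rintro ⟨h1, ⟨a, h2⟩ | h2, h3⟩
    · have := (T.grow B hB).level_le _ h2
      simp at this
      omega
    · exact h2
  · intro h
    have := (T.grow B hB).tagged_mem w h
    exact ⟨this.1, Or.inr h, this.2⟩

theorem LevelTree.Full.grow {T : LevelTree t i} (hT : T.Full) (B : Finset (List ℕ))
    (hB : B ⊆ (T.tagged ×ˢ Finset.range (t i)).image fun x => x.1 ++ [x.2]) (ht : 0 < t i) :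
    (T.grow B hB).Full := by
  intro w hw a ha
  rw [LevelTree.hasChild_grow T B hB ht] at hw
  rw [LevelTree.append_mem_grow]
  rcases hw with hw | hw
  · exact Or.inl (hT w hw a ha)
  · exact Or.inr ⟨hw, (T.tagged_mem w hw).2 ▸ ha⟩

end

theorem LevelTree.card_tagged (T : LevelTree t i) : T.tagged.card = (T.sig i).2 := by
  classical
  simp only [LevelTree.sig]
  congr 1
  ext w
  simp only [Finset.mem_filter]
  constructor
  · intro h
    exact ⟨(T.tagged_mem w h).1, Or.inr h, (T.tagged_mem w h).2⟩
  · rintro ⟨-, ⟨a, h⟩ | h, h'⟩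
    · have := T.level_le _ h
      simp at this
      omega
    · exact h

/-- Level by level: all tagged nodes receive their `t i` children, and `b (i + 1)` of the new nodes
are tagged. There are enough of them because m does not decrease; the number of leaves is then
forced by `LevelTree.card_level`. -/
theorem IsPath.exists_tree (ht : ∀ j, 2 ≤ t j) {n : ℕ} {m b : ℕ → ℕ} (h : IsPath t n i m b) :
    ∃ T : LevelTree t i, T.Full ∧ ∀ j ≤ i, T.sig j = (m j, b j) := by
  classical
  induction i with
  | zero =>
    refine ⟨.single t, LevelTree.single_full t, ?_⟩
    intro j hj
    obtain rfl : j = 0 := by omega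
    rw [LevelTree.single_sig, h.m_zero, h.b_zero]
  | succ i ih =>
    obtain ⟨T, hT, hsig⟩ := ih ⟨h.m_zero, h.b_zero, fun j hj => h.step j (by omega),
      fun j hj => h.mono j (by omega), fun j hj => h.valid j (by omega)⟩
    have ht0 : 0 < t i := by have := ht i; omega
    have hc : ((T.tagged ×ˢ Finset.range (t i)).image fun x => x.1 ++ [x.2]).card =
        b i * t i := by
      rw [Finset.card_image_of_injective, Finset.card_product, Finset.card_range, T.card_tagged,
        hsig i le_rfl]
      rintro ⟨u, a⟩ ⟨v, b⟩ h
      simp only at h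
      obtain ⟨h1, h2⟩ := List.append_inj' h rfl
      simp_all
    have hstep := h.step i (Nat.lt_succ_self i)
    have hmono := h.mono i (Nat.lt_succ_self i)
    obtain ⟨B, hB, hBc⟩ := Finset.exists_subset_card_eq (n := b (i + 1)) (by rw [hc]; omega)
    have hfull := hT.grow B hB ht0
    refine ⟨T.grow B hB, hfull, fun j hj => ?_⟩
    rcases Nat.lt_or_ge i j with hij | hij
    · obtain rfl : j = i + 1 := by omega
      have h1 := (T.grow B hB).card_level i
      rw [hfull.card_nodes (Nat.lt_succ_self i), LevelTree.sig_grow T B hB ht0 le_rfl,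
        hsig i le_rfl, LevelTree.sig_grow_succ, hBc] at h1
      ext
      · simp only at h1 ⊢
        omega
      · rw [LevelTree.sig_grow_succ, hBc]
    · rw [LevelTree.sig_grow T B hB ht0 hij, hsig j hij]

/-- The bridge from trees to number sequences; the later arguments about `costSet` use only this
form. -/
theorem mem_costSet_iff (ht : ∀ j, 2 ≤ t j) (c : ℕ → ℝ) {p : ℕ → ℝ} {n : ℕ}
    (hp : ∀ k, n ≤ k → p k = 0) (M B : ℕ) (x : ℝ) :
    x ∈ costSet t c p n i M B ↔
      ∃ m b, IsPath t n i m b ∧ m i = M ∧ b i = B ∧ x = pathCost c p n i m := by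
  constructor
  · rintro ⟨T, hT, hsig, hv, rfl⟩
    exact ⟨_, _, hT.isPath hv, by simp [hsig], by simp [hsig], T.partialCost_eq c hp⟩
  · rintro ⟨m, b, h, rfl, rfl, rfl⟩
    obtain ⟨T, hT, hsig⟩ := h.exists_tree ht
    refine ⟨T, hT, hsig i le_rfl, fun j hj => by rw [hsig j hj]; exact h.valid j hj, ?_⟩
    rw [T.partialCost_eq c hp]
    refine Finset.sum_congr rfl fun j hj => ?_
    simp only [hsig j (Finset.mem_range.1 hj).le]

end

/-! ### The recursion for the table -/

section

variable {t : ℕ → ℕ} {c p : ℕ → ℝ} {n i : ℕ}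

theorem SortedWeights.tailSum_nonneg (hp : SortedWeights n p) (m : ℕ) : 0 ≤ tailSum p n m :=
  Finset.sum_nonneg fun k _ => hp.2.1 k

theorem tailSum_of_le {m : ℕ} (h : n ≤ m) : tailSum p n m = 0 := by
  simp [tailSum, Finset.Ico_eq_empty_of_le h]

theorem pathCost_nonneg (hc : ∀ j, 0 ≤ c j) (hp : SortedWeights n p) (m : ℕ → ℕ) :
    0 ≤ pathCost c p n i m :=
  Finset.sum_nonneg fun j _ => mul_nonneg (hc j) (hp.tailSum_nonneg _)

/-- The last signature of a sequence is cut off or appended. With `b₁ = b i` the step equation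
determines `m i`, and `m i ≤ M` turns into `B ≤ b₁ * t i`; the condition `b₁ * t i ≤ M + B` makes
the truncated subtraction exact. -/
theorem mem_costSet_succ_iff (ht : ∀ j, 2 ≤ t j) (hp : ∀ k, n ≤ k → p k = 0) {M B : ℕ}
    (hv : Valid t n (i + 1) M B) (x : ℝ) :
    x ∈ costSet t c p n (i + 1) M B ↔ ∃ b₁, b₁ * t i ≤ M + B ∧ B ≤ b₁ * t i ∧
      ∃ y ∈ costSet t c p n i (M + B - b₁ * t i) b₁,
        x = y + c i * tailSum p n (M + B - b₁ * t i) := by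
  rw [mem_costSet_iff ht c hp]
  constructor
  · rintro ⟨m, b, h, rfl, rfl, rfl⟩
    have h1 := h.step i (Nat.lt_succ_self i)
    have h2 := h.mono i (Nat.lt_succ_self i)
    have h3 : m (i + 1) + b (i + 1) - b i * t i = m i := by omega
    refine ⟨b i, by omega, by omega, pathCost c p n i m, ?_, ?_⟩
    · rw [mem_costSet_iff ht c hp, h3]
      exact ⟨m, b, ⟨h.m_zero, h.b_zero, fun j hj => h.step j (by omega),
        fun j hj => h.mono j (by omega), fun j hj => h.valid j (by omega)⟩, rfl, rfl, rfl⟩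
    · rw [h3, pathCost, Finset.sum_range_succ, pathCost]
  · rintro ⟨b₁, h1, h2, y, hy, rfl⟩
    rw [mem_costSet_iff ht c hp] at hy
    obtain ⟨m, b, h, hm, hb, rfl⟩ := hy
    refine ⟨fun j => if j ≤ i then m j else M, fun j => if j ≤ i then b j else B,
      ⟨by simpa using h.m_zero, by simpa using h.b_zero, ?_, ?_, ?_⟩, by simp, by simp, ?_⟩
    · intro j hj
      rcases Nat.lt_or_ge j i with hji | hji
      · simpa [hji.le, Nat.succ_le_of_lt hji] using h.step j hji
      · obtain rfl : j = i := by omega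
        simp [hm, hb]
        omega
    · intro j hj
      rcases Nat.lt_or_ge j i with hji | hji
      · simpa [hji.le, Nat.succ_le_of_lt hji] using h.mono j hji
      · obtain rfl : j = i := by omega
        simp [hm]
        omega
    · intro j hj
      rcases Nat.lt_or_ge i j with hji | hji
      · obtain rfl : j = i + 1 := by omega
        simpa using hv
      · simpa [hji] using h.valid j hji
    · rw [pathCost, pathCost, Finset.sum_range_succ]
      simp only [le_refl, if_true, hm]
      congr 1
      refine Finset.sum_congr rfl fun j hj => ?_
      simp [(Finset.mem_range.1 hj).le]

/-- Characterizes the entry by its lower bounds, so that identities between entries follow from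
`eq_of_forall_le_iff` without exhibiting minimizers. Nonnegativity of costs supplies the lower bound
that the real `sInf` needs. -/
theorem le_OPT_iff (ht : ∀ j, 2 ≤ t j) (hc : ∀ j, 0 ≤ c j) (hp : SortedWeights n p) {m b : ℕ}
    (y : WithTop ℝ) :
    y ≤ OPT t c p n i m b ↔ ∀ x ∈ costSet t c p n i m b, y ≤ (x : WithTop ℝ) := by
  rw [OPT]
  split_ifs with h
  · have hbdd : BddBelow (costSet t c p n i m b) := by
      refine ⟨0, fun x hx => ?_⟩
      rw [mem_costSet_iff ht c hp.2.2] at hx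
      obtain ⟨m, b, -, -, -, rfl⟩ := hx
      exact pathCost_nonneg hc hp m
    induction y using WithTop.recTopCoe with
    | top =>
      obtain ⟨x, hx⟩ := h
      refine iff_of_false (by simp) fun H => ?_
      simpa using H x hx
    | coe y =>
      simp only [WithTop.coe_le_coe]
      exact le_csInf_iff hbdd h
  · rw [Set.not_nonempty_iff_eq_empty] at h
    simp [h]

theorem OPT_le (ht : ∀ j, 2 ≤ t j) (hc : ∀ j, 0 ≤ c j) (hp : SortedWeights n p) {m b : ℕ} {x : ℝ}
    (hx : x ∈ costSet t c p n i m b) : OPT t c p n i m b ≤ x :=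
  (le_OPT_iff ht hc hp _).1 le_rfl x hx

theorem OPT_nonneg (ht : ∀ j, 2 ≤ t j) (hc : ∀ j, 0 ≤ c j) (hp : SortedWeights n p) (m b : ℕ) :
    0 ≤ OPT t c p n i m b := by
  rw [le_OPT_iff ht hc hp]
  intro x hx
  rw [mem_costSet_iff ht c hp.2.2] at hx
  obtain ⟨m, b, -, -, -, rfl⟩ := hx
  exact_mod_cast pathCost_nonneg hc hp m

theorem OPT_of_not_valid {m b : ℕ} (h : ¬ Valid t n i m b) : OPT t c p n i m b = ⊤ := by
  rw [OPT, if_neg]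
  rintro ⟨x, T, -, hsig, hv, -⟩
  have := hv i le_rfl
  rw [hsig] at this
  exact h this

theorem OPT_zero (ht : ∀ j, 2 ≤ t j) (hc : ∀ j, 0 ≤ c j) (hp : SortedWeights n p) (hn : 1 ≤ n)
    (m b : ℕ) : OPT t c p n 0 m b = if m = 0 ∧ b = 1 then 0 else ⊤ := by
  refine eq_of_forall_le_iff fun y => ?_
  rw [le_OPT_iff ht hc hp]
  split_ifs with h
  · obtain ⟨rfl, rfl⟩ := h
    have : costSet t c p n 0 0 1 = {0} := by
      ext x
      rw [mem_costSet_iff ht c hp.2.2, Set.mem_singleton_iff]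
      constructor
      · rintro ⟨m, b, -, -, -, rfl⟩
        simp [pathCost]
      · rintro rfl
        refine ⟨fun _ => 0, fun _ => 1, ⟨rfl, rfl, by simp, by simp, ?_⟩, rfl, rfl, ?_⟩
        · intro j _
          exact Or.inl ⟨one_pos, by simpa using hn⟩
        · simp [pathCost]
    simp [this]
  · refine iff_of_true (fun x hx => ?_) le_top
    rw [mem_costSet_iff ht c hp.2.2] at hx
    obtain ⟨m', b', hP, rfl, rfl, -⟩ := hx
    exact absurd ⟨hP.m_zero, hP.b_zero⟩ h

/-- A finite summand can be moved across the inequality even when `y` or `z` is infinite; this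
carries `le_OPT_iff` over to `gam`. -/
theorem le_add_coe_iff (y z : WithTop ℝ) (r : ℝ) :
    y ≤ z + r ↔ y + ((-r : ℝ) : WithTop ℝ) ≤ z := by
  induction y using WithTop.recTopCoe with
  | top => induction z using WithTop.recTopCoe with
    | top => simp
    | coe z =>
      rw [← WithTop.coe_add]
      simp
  | coe y => induction z using WithTop.recTopCoe with
    | top => simp
    | coe z =>
      norm_cast
      constructor <;> intro h <;> linarith

theorem le_gam_iff (ht : ∀ j, 2 ≤ t j) (hc : ∀ j, 0 ≤ c j) (hp : SortedWeights n p) {d b₁ : ℕ}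
    (y : WithTop ℝ) :
    y ≤ gam t c p n i d b₁ ↔ ∀ x ∈ costSet t c p n i (d - b₁ * t i) b₁,
      y ≤ ((x + c i * tailSum p n (d - b₁ * t i) : ℝ) : WithTop ℝ) := by
  rw [gam, le_add_coe_iff, le_OPT_iff ht hc hp]
  simp only [← le_add_coe_iff, WithTop.coe_add]

theorem gam_nonneg (ht : ∀ j, 2 ≤ t j) (hc : ∀ j, 0 ≤ c j) (hp : SortedWeights n p) (d b₁ : ℕ) :
    0 ≤ gam t c p n i d b₁ := by
  refine add_nonneg (OPT_nonneg ht hc hp _ _) ?_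
  exact_mod_cast mul_nonneg (hc i) (hp.tailSum_nonneg _)

/-- The least value of `γ` over all `b₁` with `b ≤ b₁ * t i ≤ d`. -/
noncomputable def batchMin (t : ℕ → ℕ) (c p : ℕ → ℝ) (n i d b : ℕ) : WithTop ℝ :=
  ((Finset.range (d / t i + 1)).filter fun b₁ => b ≤ b₁ * t i).inf (gam t c p n i d)

/-- Both sides have the same lower bounds: every cost on level `i + 1` is a cost at some admissible
predecessor plus the charge of one level. -/
theorem OPT_succ (ht : ∀ j, 2 ≤ t j) (hc : ∀ j, 0 ≤ c j) (hp : SortedWeights n p) {m b : ℕ}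
    (hv : Valid t n (i + 1) m b) :
    OPT t c p n (i + 1) m b = batchMin t c p n i (m + b) b := by
  refine eq_of_forall_le_iff fun y => ?_
  rw [le_OPT_iff ht hc hp, batchMin, Finset.le_inf_iff]
  have ht0 : 0 < t i := by have := ht i; omega
  simp only [mem_costSet_succ_iff ht hp.2.2 hv, le_gam_iff ht hc hp, Finset.mem_filter,
    Finset.mem_range, Nat.lt_succ_iff, Nat.le_div_iff_mul_le ht0]
  constructor
  · rintro H b₁ ⟨h1, h2⟩ x hx
    exact H _ ⟨b₁, h1, h2, x, hx, rfl⟩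
  · rintro H _ ⟨b₁, h1, h2, x, hx, rfl⟩
    exact H b₁ ⟨h1, h2⟩ x hx

theorem batchMin_nonneg (ht : ∀ j, 2 ≤ t j) (hc : ∀ j, 0 ≤ c j) (hp : SortedWeights n p)
    (d b : ℕ) : 0 ≤ batchMin t c p n i d b :=
  Finset.le_inf fun _ _ => gam_nonneg ht hc hp _ _

theorem batchMin_of_lt {d b : ℕ} (h : d / t i * t i < b) :
    batchMin t c p n i d b = ⊤ := by
  rw [batchMin, Finset.filter_false_of_mem, Finset.inf_empty]
  intro b₁ hb₁
  rw [Finset.mem_range, Nat.lt_succ_iff] at hb₁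
  have := Nat.mul_le_mul_right (t i) hb₁
  omega

/-- When the threshold passes from `b₁ * t i` to the next integer, `b₁` is the only candidate that
is lost. At a non-multiple nothing is lost (`batchMin_of_not_dvd`). -/
theorem batchMin_mul (ht : ∀ j, 2 ≤ t j) {d b₁ : ℕ} (h : b₁ * t i ≤ d) :
    batchMin t c p n i d (b₁ * t i) =
      min (batchMin t c p n i d (b₁ * t i + 1)) (gam t c p n i d b₁) := by
  have ht0 : 0 < t i := by have := ht i; omega
  have : ((Finset.range (d / t i + 1)).filter fun a => b₁ * t i ≤ a * t i) =
      insert b₁ ((Finset.range (d / t i + 1)).filter fun a => b₁ * t i + 1 ≤ a * t i) := by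
    ext a
    simp only [Finset.mem_filter, Finset.mem_range, Finset.mem_insert, Nat.lt_succ_iff,
      Nat.succ_le_iff, Nat.mul_lt_mul_right ht0, Nat.mul_le_mul_right_iff ht0]
    have := (Nat.le_div_iff_mul_le ht0).2 h
    omega
  rw [batchMin, this, Finset.inf_insert, inf_comm]
  rfl

theorem batchMin_of_not_dvd {d b : ℕ} (h : ¬ t i ∣ b) :
    batchMin t c p n i d b = batchMin t c p n i d (b + 1) := by
  rw [batchMin, batchMin]
  congr 1
  ext a
  simp only [Finset.mem_filter]
  refine and_congr_right fun _ => ⟨fun h' => ?_, fun h' => by omega⟩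
  rcases h'.lt_or_eq with h' | rfl
  · exact h'
  · exact absurd (Dvd.intro_left a rfl) h

theorem batchMin_zero {d : ℕ} :
    batchMin t c p n i d 0 = (Finset.range (d / t i + 1)).inf (gam t c p n i d) := by
  simp [batchMin]

/-- In a fixed batch the threshold `d - m` drops by one as m grows by one. For `m < d % t i` it
still exceeds the largest multiple of `t i` below or at d, so no candidate exists. -/
theorem OPT_batch (ht : ∀ j, 2 ≤ t j) (hc : ∀ j, 0 ≤ c j) (hp : SortedWeights n p) (d : ℕ) :
    (∀ m < d % t i, Valid t n (i + 1) m (d - m) → OPT t c p n (i + 1) m (d - m) = ⊤) ∧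
      (Valid t n (i + 1) (d % t i) (d - d % t i) →
        OPT t c p n (i + 1) (d % t i) (d - d % t i) = gam t c p n i d (d / t i)) ∧
      (∀ m, d % t i < m → m ≤ d → Valid t n (i + 1) (m - 1) (d - (m - 1)) →
        Valid t n (i + 1) m (d - m) →
        OPT t c p n (i + 1) m (d - m) =
          if t i ∣ d - m then
            min (OPT t c p n (i + 1) (m - 1) (d - (m - 1))) (gam t c p n i d ((d - m) / t i))
          else OPT t c p n (i + 1) (m - 1) (d - (m - 1))) := by
  have hd := Nat.div_add_mod' d (t i)
  have ht0 : 0 < t i := by have := ht i; omega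
  refine ⟨fun m hm hv => ?_, fun hv => ?_, fun m hm hmd hv hv' => ?_⟩
  · rw [OPT_succ ht hc hp hv]
    apply batchMin_of_lt
    rw [show m + (d - m) = d by omega]
    omega
  · rw [OPT_succ ht hc hp hv, show d % t i + (d - d % t i) = d by omega,
      show d - d % t i = d / t i * t i by omega, batchMin_mul ht (by omega),
      batchMin_of_lt (Nat.lt_succ_self _), min_eq_right le_top]
  · rw [OPT_succ ht hc hp hv, OPT_succ ht hc hp hv', show m + (d - m) = d by omega,
      show m - 1 + (d - (m - 1)) = d by omega, show d - (m - 1) = d - m + 1 by omega]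
    split_ifs with h
    · have h' := Nat.div_mul_cancel h
      have := batchMin_mul (c := c) (p := p) (n := n) ht
        (show (d - m) / t i * t i ≤ d by omega)
      rwa [h'] at this
    · exact batchMin_of_not_dvd h

end

/-! ### Trees and codes -/

section

variable {t : ℕ → ℕ} {n : ℕ}

theorem RadixTree.mem_of_append (T : RadixTree t) (w u : List ℕ) (h : w ++ u ∈ T.nodes) :
    w ∈ T.nodes := by
  induction u using List.reverseRecOn with
  | nil => simpa using h
  | append_singleton u a ih =>
    rw [← List.append_assoc] at h
    exact ih (T.closed _ _ h).1

theorem RadixTree.IsLabelling.isMixedRadixCode {T : RadixTree t} {v : Fin n → List ℕ}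
    (h : T.IsLabelling v) : IsMixedRadixCode t v := by
  refine ⟨fun k j hj => ?_, fun k l hkl hpre => ?_⟩
  · have hk := ((h.2 (v k)).1 ⟨k, rfl⟩).1
    have h1 : (v k).take j ++ [(v k)[j]] ∈ T.nodes := by
      rw [List.take_append_getElem]
      apply T.mem_of_append _ ((v k).drop (j + 1))
      rwa [List.take_append_drop]
    have := (T.closed _ _ h1).2
    rwa [List.length_take, min_eq_left hj.le] at this
  · obtain ⟨u, hu⟩ := hpre
    cases u with
    | nil => exact hkl (h.1 (by simpa using hu))
    | cons a u =>
      refine ((h.2 (v k)).1 ⟨k, rfl⟩).2 ⟨a, T.mem_of_append _ u ?_⟩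
      rw [List.append_assoc, List.singleton_append, hu]
      exact ((h.2 (v l)).1 ⟨l, rfl⟩).1

/-- The tree formed by the prefixes of the words of a code. -/
def IsMixedRadixCode.tree {w : Fin n → List ℕ} (h : IsMixedRadixCode t w) (hn : 1 ≤ n) :
    RadixTree t where
  nodes := Finset.univ.biUnion fun k => (w k).inits.toFinset
  root_mem := by
    simp only [Finset.mem_biUnion, Finset.mem_univ, true_and, List.mem_toFinset, List.mem_inits]
    exact ⟨⟨0, hn⟩, _, List.nil_append _⟩
  closed u a hu := by
    simp only [Finset.mem_biUnion, Finset.mem_univ, true_and, List.mem_toFinset,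
      List.mem_inits] at hu ⊢
    obtain ⟨k, v, hv⟩ := hu
    refine ⟨⟨k, [a] ++ v, by rw [← List.append_assoc, hv]⟩, ?_⟩
    have h1 : u.length < (w k).length := by rw [← hv]; simp
    have := h.1 k u.length h1
    simpa [← hv] using this

theorem IsMixedRadixCode.isLabelling {w : Fin n → List ℕ} (h : IsMixedRadixCode t w)
    (hn : 1 ≤ n) : (h.tree hn).IsLabelling w := by
  have hmem : ∀ u, u ∈ (h.tree hn).nodes ↔ ∃ k, u <+: w k := fun u => by
    simp [IsMixedRadixCode.tree]
  refine ⟨fun k l hkl => ?_, fun u => ?_⟩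
  · by_contra hne
    exact h.2 k l hne (hkl ▸ List.prefix_rfl)
  · rw [hmem]
    constructor
    · rintro ⟨k, rfl⟩
      refine ⟨⟨k, List.prefix_rfl⟩, ?_⟩
      rintro ⟨a, ha⟩
      rw [hmem] at ha
      obtain ⟨l, hl⟩ := ha
      by_cases hkl : k = l
      · subst hkl
        have := hl.length_le
        simp at this
      · exact h.2 k l hkl ((List.prefix_append _ _).trans hl)
    · rintro ⟨⟨k, v, hv⟩, hnc⟩
      cases v with
      | nil => exact ⟨k, by simpa using hv.symm⟩
      | cons a v =>
        refine absurd ⟨a, (hmem _).2 ⟨k, v, ?_⟩⟩ hnc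
        rw [List.append_assoc, List.singleton_append, hv]

/-- The leaves of a tree form a prefix code, and the prefixes of a code form a tree whose leaves are
its words. A nonempty code is needed for the tree to contain its root. -/
theorem isOptimalTree_iff (c : ℕ → ℝ) (hn : 1 ≤ n) (p : Fin n → ℝ) (v : Fin n → List ℕ) :
    IsOptimalTree t c p v ↔ IsMixedRadixCode t v ∧
      ∀ u, IsMixedRadixCode t u → treeCost c p v ≤ treeCost c p u := by
  constructor
  · rintro ⟨⟨T, hT⟩, h⟩
    exact ⟨hT.isMixedRadixCode, fun u hu => h _ u (hu.isLabelling hn)⟩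
  · rintro ⟨hv, h⟩
    exact ⟨⟨_, hv.isLabelling hn⟩, fun T u hu => h u hu.isMixedRadixCode⟩

end

/-! ### Every code costs at least as much as some sequence of signatures -/

section

variable {t : ℕ → ℕ} {c p : ℕ → ℝ} {n : ℕ}

theorem SortedWeights.tailSum_antitone (hp : SortedWeights n p) : Antitone (tailSum p n) := by
  intro m m' h
  apply Finset.sum_le_sum_of_subset_of_nonneg
  · exact Finset.Ico_subset_Ico_left h
  · exact fun k _ _ => hp.2.1 k

/-- Exchange with threshold `p M`: indices of [M, n) outside S weigh at most `p M`, indices of S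
outside [M, n) are smaller than M and weigh at least `p M`, and the latter are at least as numerous.
-/
theorem SortedWeights.tailSum_le_sum (hp : SortedWeights n p) {M : ℕ} (S : Finset ℕ)
    (hSn : ∀ k ∈ S, k < n) (hS : n ≤ M + S.card) : tailSum p n M ≤ ∑ k ∈ S, p k := by
  have hcard : (Finset.Ico M n \ S).card ≤ (S \ Finset.Ico M n).card := by
    rw [Finset.card_sdiff_le_card_sdiff_iff, Nat.card_Ico]
    omega
  have h1 : ∑ k ∈ Finset.Ico M n \ S, p k ≤ (Finset.Ico M n \ S).card • p M :=
    Finset.sum_le_card_nsmul _ _ _ fun k hk => by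
      simp only [Finset.mem_sdiff, Finset.mem_Ico] at hk
      exact hp.1 hk.1.1
  have h2 : (Finset.Ico M n \ S).card • p M ≤ (S \ Finset.Ico M n).card • p M :=
    nsmul_le_nsmul_left (hp.2.1 M) hcard
  have h3 : (S \ Finset.Ico M n).card • p M ≤ ∑ k ∈ S \ Finset.Ico M n, p k :=
    Finset.card_nsmul_le_sum _ _ _ fun k hk => by
      simp only [Finset.mem_sdiff, Finset.mem_Ico] at hk
      have := hSn k hk.1
      exact hp.1 (by omega)
  have h4 := Finset.sum_inter_add_sum_sdiff (Finset.Ico M n) S p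
  have h5 := Finset.sum_inter_add_sum_sdiff S (Finset.Ico M n) p
  rw [Finset.inter_comm] at h5
  rw [tailSum]
  linarith

/-- The number of words of length at most `j`. -/
def shortCount (u : Fin n → List ℕ) (j : ℕ) : ℕ :=
  (Finset.univ.filter fun k => (u k).length ≤ j).card

/-- The prefixes of length `j` of the words that are longer than `j`. -/
def properPrefixes (u : Fin n → List ℕ) (j : ℕ) : Finset (List ℕ) :=
  (Finset.univ.filter fun k => j < (u k).length).image fun k => (u k).take j

theorem shortCount_mono (u : Fin n → List ℕ) {j j' : ℕ} (h : j ≤ j') :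
    shortCount u j ≤ shortCount u j' := by
  apply Finset.card_le_card
  intro k
  simp only [Finset.mem_filter]
  exact fun hk => ⟨hk.1, hk.2.trans h⟩

theorem card_properPrefixes_pos {u : Fin n → List ℕ} {j : ℕ} (h : shortCount u j < n) :
    0 < (properPrefixes u j).card := by
  rw [Finset.card_pos, properPrefixes, Finset.image_nonempty, Finset.nonempty_iff_ne_empty]
  intro h0
  rw [Finset.filter_eq_empty_iff] at h0
  rw [shortCount, Finset.filter_true_of_mem fun k hk => not_lt.1 (h0 hk)] at h
  simp at h

theorem IsMixedRadixCode.shortCount_zero {u : Fin n → List ℕ} (hu : IsMixedRadixCode t u)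
    (hn : 2 ≤ n) : shortCount u 0 = 0 := by
  rw [shortCount, Finset.card_eq_zero, Finset.filter_eq_empty_iff]
  intro k _ hk
  obtain ⟨l, hl⟩ : ∃ l : Fin n, k ≠ l := by
    by_cases h : k = ⟨0, by omega⟩
    · exact ⟨⟨1, by omega⟩, by rw [h]; simp⟩
    · exact ⟨_, h⟩
  have : u k = [] := by simpa using hk
  exact hu.2 k l hl (this ▸ ⟨_, List.nil_append _⟩)

/-- Words of length `j + 1` and proper prefixes of length `j + 1` are different nodes by
prefix-freeness, and all of them are children of proper prefixes of length j, which have at most `t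
j` children each. -/
theorem IsMixedRadixCode.shortCount_succ {u : Fin n → List ℕ} (hu : IsMixedRadixCode t u)
    (j : ℕ) : shortCount u (j + 1) + (properPrefixes u (j + 1)).card ≤
      shortCount u j + (properPrefixes u j).card * t j := by
  set X := Finset.univ.filter fun k => (u k).length = j + 1 with hX
  have h1 : shortCount u (j + 1) = shortCount u j + X.card := by
    rw [shortCount, shortCount, ← Finset.card_union_of_disjoint]
    · congr 1
      ext k
      simp only [hX, Finset.mem_filter, Finset.mem_union, Finset.mem_univ, true_and]
      omega
    · rw [Finset.disjoint_left]
      intro k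
      simp only [hX, Finset.mem_filter, Finset.mem_univ, true_and]
      omega
  have hinj : Function.Injective u := by
    intro k l hkl
    by_contra hne
    exact hu.2 k l hne (hkl ▸ List.prefix_rfl)
  have h2 : Disjoint (X.image u) (properPrefixes u (j + 1)) := by
    rw [Finset.disjoint_left]
    intro w hw hw'
    simp only [hX, properPrefixes, Finset.mem_image, Finset.mem_filter, Finset.mem_univ,
      true_and] at hw hw'
    obtain ⟨k, hk, rfl⟩ := hw
    obtain ⟨l, hl, hlk⟩ := hw'
    refine hu.2 k l ?_ (hlk ▸ ⟨_, List.take_append_drop _ _⟩)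
    rintro rfl
    omega
  have h3 : X.image u ∪ properPrefixes u (j + 1) ⊆
      (properPrefixes u j ×ˢ Finset.range (t j)).image fun x => x.1 ++ [x.2] := by
    have key : ∀ k, j < (u k).length → (u k).take (j + 1) ∈
        (properPrefixes u j ×ˢ Finset.range (t j)).image fun x => x.1 ++ [x.2] := by
      intro k hk
      rw [Finset.mem_image]
      refine ⟨((u k).take j, (u k)[j]), ?_, List.take_append_getElem hk⟩
      rw [Finset.mem_product, Finset.mem_range]
      exact ⟨Finset.mem_image_of_mem _ (by simpa using hk), hu.1 k j hk⟩
    intro w hw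
    rw [Finset.mem_union] at hw
    simp only [hX, properPrefixes, Finset.mem_image (s := Finset.filter _ _), Finset.mem_filter,
      Finset.mem_univ, true_and] at hw
    rcases hw with ⟨k, hk, rfl⟩ | ⟨k, hk, rfl⟩
    · have := key k (by omega)
      rwa [List.take_of_length_le hk.le] at this
    · exact key k (by omega)
  have h4 := (Finset.card_le_card h3).trans Finset.card_image_le
  rw [Finset.card_union_of_disjoint h2, Finset.card_image_of_injective _ hinj,
    Finset.card_product, Finset.card_range] at h4
  omega

/-- At least `n - shortCount u j` words are longer than j and pay `c j`; their weights sum to at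
least the corresponding tail. Edges from level J on are dropped. -/
theorem sum_tailSum_shortCount_le (hc : ∀ j, 0 ≤ c j) (hp : SortedWeights n p)
    (u : Fin n → List ℕ) (J : ℕ) :
    pathCost c p n J (shortCount u) ≤ treeCost c (fun k : Fin n => p k) u := by
  have h1 : ∀ k : Fin n, ∑ j ∈ Finset.range J, (if j < (u k).length then c j * p k else 0) ≤
      depth c (u k).length * p k := by
    intro k
    rw [depth, Finset.sum_mul, ← Finset.sum_filter]
    apply Finset.sum_le_sum_of_subset_of_nonneg
    · intro j
      simp
    · exact fun j _ _ => mul_nonneg (hc j) (hp.2.1 _)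
  refine le_trans ?_ (Finset.sum_le_sum fun k _ => h1 k)
  rw [Finset.sum_comm, pathCost]
  refine Finset.sum_le_sum fun j _ => ?_
  rw [← Finset.sum_filter, ← Finset.mul_sum]
  refine mul_le_mul_of_nonneg_left ?_ (hc j)
  have h2 : ∑ k ∈ Finset.univ.filter (fun k => j < (u k).length), p (k : ℕ) =
      ∑ k ∈ (Finset.univ.filter fun k => j < (u k).length).map Fin.valEmbedding, p k := by
    rw [Finset.sum_map]
    rfl
  rw [h2]
  apply hp.tailSum_le_sum
  · intro k hk
    simp only [Finset.mem_map, Fin.valEmbedding_apply] at hk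
    obtain ⟨l, -, rfl⟩ := hk
    exact l.2
  · rw [Finset.card_map]
    have := Finset.card_filter_add_card_filter_not (s := (Finset.univ : Finset (Fin n)))
      (fun k => (u k).length ≤ j)
    simp only [not_le, Finset.card_univ, Fintype.card_fin] at this
    rw [shortCount]
    omega

/-- Numbers of inner nodes of a full tree in which `M j` leaves are on levels `≤ j`. -/
def innerCount (t M : ℕ → ℕ) : ℕ → ℕ
  | 0 => 1
  | j + 1 => M j + innerCount t M j * t j - M (j + 1)

theorem IsMixedRadixCode.card_le_innerCount {u : Fin n → List ℕ} (hu : IsMixedRadixCode t u)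
    (j : ℕ) : (properPrefixes u j).card ≤ innerCount t (shortCount u) j := by
  induction j with
  | zero =>
    have : properPrefixes u 0 ⊆ {[]} := by
      intro w
      simp only [properPrefixes, List.take_zero, Finset.mem_image, Finset.mem_singleton]
      rintro ⟨k, -, rfl⟩
      rfl
    simpa [innerCount] using Finset.card_le_card this
  | succ j ih =>
    have h1 := hu.shortCount_succ j
    have h2 := Nat.mul_le_mul_right (t j) ih
    rw [innerCount]
    omega

/-- The truncated subtraction in `innerCount` is exact, since by `card_le_innerCount` the full tree
has room for all words of length `j + 1`. -/
theorem IsMixedRadixCode.add_innerCount_succ {u : Fin n → List ℕ} (hu : IsMixedRadixCode t u)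
    (j : ℕ) : shortCount u (j + 1) + innerCount t (shortCount u) (j + 1) =
      shortCount u j + innerCount t (shortCount u) j * t j := by
  have h1 := hu.shortCount_succ j
  have h2 := Nat.mul_le_mul_right (t j) (hu.card_le_innerCount j)
  rw [innerCount]
  omega

/-- While words remain there is an inner node, and replacing it by its at least two children raises
the count by at least one. This is what bounds the number of levels by n. -/
theorem IsMixedRadixCode.min_le_add_innerCount (ht : ∀ j, 2 ≤ t j) {u : Fin n → List ℕ}
    (hu : IsMixedRadixCode t u) (j : ℕ) :
    min n (j + 1) ≤ shortCount u j + innerCount t (shortCount u) j := by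
  induction j with
  | zero => simp [innerCount]
  | succ j ih =>
    rw [hu.add_innerCount_succ]
    have h3 := hu.card_le_innerCount j
    by_cases h : shortCount u j < n
    · have h1 := card_properPrefixes_pos h
      have h2 : innerCount t (shortCount u) j * 2 ≤ innerCount t (shortCount u) j * t j :=
        Nat.mul_le_mul_left _ (ht j)
      omega
    · omega

/-- A code is at least as expensive as some complete sequence of signatures. -/
theorem IsMixedRadixCode.exists_path_le (ht : ∀ j, 2 ≤ t j) (hc : ∀ j, 0 ≤ c j) (hn : 2 ≤ n)
    (hp : SortedWeights n p) {u : Fin n → List ℕ} (hu : IsMixedRadixCode t u) :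
    ∃ i m b, 1 ≤ i ∧ i ≤ n ∧ IsPath t n i m b ∧ b i = 0 ∧
      pathCost c p n i m ≤ treeCost c (fun k : Fin n => p k) u := by
  set M := shortCount u with hM
  set b' := innerCount t M with hb'
  have hM0 : M 0 = 0 := hu.shortCount_zero hn
  have hb0 : b' 0 = 1 := rfl
  have hstep : ∀ j, M (j + 1) + b' (j + 1) = M j + b' j * t j := hu.add_innerCount_succ
  have hmono : ∀ {j j'}, j ≤ j' → M j ≤ M j' := fun h => shortCount_mono u h
  have hpos : ∀ j, M j < n → 0 < b' j := fun j h =>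
    (card_properPrefixes_pos h).trans_le (hu.card_le_innerCount j)
  have hmin : ∀ j, min n (j + 1) ≤ M j + b' j := hu.min_le_add_innerCount ht
  -- The tree will be cut below the first level i such that leaves and inner nodes on level `i + 1`
  -- reach n.
  have hex : ∃ j, n ≤ M (j + 1) + b' (j + 1) :=
    ⟨n, by have := hmin (n + 1); omega⟩
  classical
  obtain ⟨i, hi, hi', hin⟩ : ∃ i, n ≤ M (i + 1) + b' (i + 1) ∧ (∀ j ≤ i, M j + b' j < n) ∧
      i + 1 ≤ n := by
    refine ⟨Nat.find hex, Nat.find_spec hex, fun j hj => ?_, ?_⟩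
    · cases j with
      | zero => omega
      | succ j => exact not_le.1 (Nat.find_min hex (by omega))
    -- `n - 2` works because `hmin` at `n - 1` already gives the bound n.
    · have : Nat.find hex ≤ n - 2 := by
        apply Nat.find_min' hex
        have := hmin (n - 2 + 1)
        omega
      omega
  have hD := hi' i le_rfl
  -- Replacing `a` inner nodes by all their children adds `a * (t i - 1)` nodes.
  have htt : ∀ a, a * t i = a + a * (t i - 1) := fun a => by
    obtain ⟨r, hr⟩ : ∃ r, t i = r + 1 := ⟨t i - 1, by have := ht i; omega⟩
    rw [hr]
    simp
    ring
  rw [hstep i, htt] at hi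
  -- Only the least number `a` of inner nodes on level i that still produces n leaves is kept.
  -- Minimality will give the upper bound in the validity of the last signature, and `a > 0` the
  -- lower bound `t i`.
  have hex' : ∃ a, n ≤ M i + b' i + a * (t i - 1) := ⟨b' i, by omega⟩
  obtain ⟨a, ha, ha', hab⟩ : ∃ a, n ≤ M i + b' i + a * (t i - 1) ∧
      (∀ a' < a, M i + b' i + a' * (t i - 1) < n) ∧ a ≤ b' i :=
    ⟨Nat.find hex', Nat.find_spec hex', fun a' h => not_le.1 (Nat.find_min hex' h),
      Nat.find_min' hex' (by omega)⟩
  have ha0 : 0 < a := by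
    by_contra h0
    obtain rfl : a = 0 := by omega
    omega
  have ha1 := ha' (a - 1) (by omega)
  have ha2 : a * (t i - 1) = (a - 1) * (t i - 1) + (t i - 1) := by
    obtain ⟨a, rfl⟩ : ∃ x, a = x + 1 := ⟨a - 1, by omega⟩
    simp
    ring
  have ht2 := ht i
  have hta := htt a
  have htle : t i ≤ a * t i := Nat.le_mul_of_pos_left _ ha0
  -- Above level i nothing changes; on level i all but `a` inner nodes become leaves; on level `i +
  -- 1` every node is a leaf.
  let m : ℕ → ℕ := fun j => if j < i then M j else if j = i then M i + b' i - a
    else M i + b' i + a * (t i - 1)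
  let b : ℕ → ℕ := fun j => if j < i then b' j else if j = i then a else 0
  have hmi : m i = M i + b' i - a := by simp [m]
  have hbi : b i = a := by simp [b]
  have hmi1 : m (i + 1) = M i + b' i + a * (t i - 1) := by simp [m]
  have hbi1 : b (i + 1) = 0 := by simp [b]
  have hmlt : ∀ j < i, m j = M j := fun j hj => by simp [m, hj]
  have hblt : ∀ j < i, b j = b' j := fun j hj => by simp [b, hj]
  have hMm : ∀ j ≤ i, M j ≤ m j := by
    intro j hj
    rcases hj.lt_or_eq with hj | rfl
    · rw [hmlt j hj]
    · rw [hmi]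
      omega
  have hsum : ∀ j ≤ i, m j + b j = M j + b' j := by
    intro j hj
    rcases hj.lt_or_eq with hj | rfl
    · rw [hmlt j hj, hblt j hj]
    · rw [hmi, hbi]
      omega
  refine ⟨i + 1, m, b, by omega, hin, ⟨?_, ?_, ?_, ?_, ?_⟩, hbi1, ?_⟩
  · rcases Nat.eq_zero_or_pos i with h0 | h0
    · rw [h0] at hmi hab
      rw [hmi]
      omega
    · rw [hmlt 0 h0, hM0]
  · rcases Nat.eq_zero_or_pos i with h0 | h0
    · rw [h0] at hbi hab
      rw [hbi]
      omega
    · rw [hblt 0 h0, hb0]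
  · intro j hj
    rcases (Nat.lt_succ_iff.1 hj).lt_or_eq with hj | rfl
    · rw [hsum (j + 1) hj, hmlt j hj, hblt j hj, hstep]
    · rw [hmi, hbi, hmi1, hbi1, htt]
      omega
  · intro j hj
    rcases (Nat.lt_succ_iff.1 hj).lt_or_eq with hj | rfl
    · rw [hmlt j hj]
      exact (hmono (Nat.le_succ j)).trans (hMm (j + 1) hj)
    · rw [hmi, hmi1]
      omega
  · intro j hj
    rcases hj.lt_or_eq with hj | rfl
    · have hj := Nat.lt_succ_iff.1 hj
      refine Or.inl ⟨?_, by rw [hsum j hj]; exact (hi' j hj).le⟩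
      rcases hj.lt_or_eq with hj' | rfl
      · rw [hblt j hj']
        exact hpos j (by have := hi' j hj; omega)
      · rw [hbi]
        exact ha0
    · refine Or.inr ⟨hbi1, by omega, ?_, ?_⟩
      · rw [hmi1, Nat.add_sub_cancel]
        omega
      · rw [hmi1, Nat.add_sub_cancel]
        omega
  -- Turning nodes into leaves only increases the leaf counts, so the tail sums, and with them the
  -- cost, do not increase.
  · refine le_trans ?_ (sum_tailSum_shortCount_le hc hp u (i + 1))
    refine Finset.sum_le_sum fun j hj => ?_
    refine mul_le_mul_of_nonneg_left (hp.tailSum_antitone ?_) (hc j)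
    exact hMm j (Nat.lt_succ_iff.1 (Finset.mem_range.1 hj))

end

/-! ### The words of a code with given numbers of leaves -/

section

variable {t : ℕ → ℕ} {c p : ℕ → ℝ} {n i : ℕ}

/-- The number of words of length `x` that do not precede the word with digits `d`. -/
def avail (t d : ℕ → ℕ) : ℕ → ℕ
  | 0 => 1
  | x + 1 => (avail t d x - 1) * t x + (t x - d x)

/-- Increase the digit at position `q` and clear all later digits. -/
def bump (d : ℕ → ℕ) (q j : ℕ) : ℕ := if j < q then d j else if j = q then d q + 1 else 0

/-- `q` is the last position before `x` whose digit is not the largest possible one. -/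
def IsCarry (t d : ℕ → ℕ) (x q : ℕ) : Prop :=
  q < x ∧ d q + 1 < t q ∧ ∀ j, q < j → j < x → t j ≤ d j + 1

theorem avail_congr {d d' : ℕ → ℕ} {x : ℕ} (h : ∀ j < x, d j = d' j) :
    avail t d x = avail t d' x := by
  induction x with
  | zero => rfl
  | succ x ih => rw [avail, avail, ih fun j hj => h j (by omega), h x (by omega)]

theorem one_le_avail {d : ℕ → ℕ} {x : ℕ} (h : ∀ j < x, d j < t j) : 1 ≤ avail t d x := by
  cases x with
  | zero => exact le_rfl
  | succ x =>
    have := h x (by omega)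
    rw [avail]
    omega

theorem avail_succ_of_eq_zero {d : ℕ → ℕ} {x : ℕ} (h : ∀ j < x, d j < t j) (hx : d x = 0) :
    avail t d (x + 1) = avail t d x * t x := by
  obtain ⟨a, ha⟩ : ∃ a, avail t d x = a + 1 := ⟨avail t d x - 1, by have := one_le_avail h; omega⟩
  rw [avail, ha, hx]
  simp
  ring

/-- If every digit were maximal, the word would be the last one of its length and only one word
would be left. -/
theorem exists_isCarry {d : ℕ → ℕ} {x : ℕ} (h : ∀ j < x, d j < t j) (ha : 2 ≤ avail t d x) :
    ∃ q, IsCarry t d x q := by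
  induction x with
  | zero => simp [avail] at ha
  | succ x ih =>
    by_cases hx : d x + 1 < t x
    · exact ⟨x, by omega, hx, fun j h1 h2 => by omega⟩
    · have h1 := h x (by omega)
      have h2 : 2 ≤ avail t d x := by
        by_contra h3
        rw [avail, show avail t d x - 1 = 0 by omega] at ha
        omega
      obtain ⟨q, hq, hq', hq''⟩ := ih (fun j hj => h j (by omega)) h2
      refine ⟨q, by omega, hq', fun j hj hj' => ?_⟩
      rcases (Nat.lt_succ_iff.1 hj').lt_or_eq with hj' | rfl
      · exact hq'' j hj hj'
      · omega

theorem IsCarry.bump_lt (ht : ∀ j, 2 ≤ t j) {d : ℕ → ℕ} {x q : ℕ} (hq : IsCarry t d x q)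
    (h : ∀ j < x, d j < t j) (j : ℕ) : bump d q j < t j := by
  have h1 := hq.1
  rw [bump]
  split_ifs with h2 h3
  · exact h j (by omega)
  · rw [h3]
    exact hq.2.1
  · have := ht j
    omega

/-- Raising digit q removes one word of length `q + 1`. Beyond q the old digits are maximal and the
new ones are zero, so the counts A and A' evolve as (A - 1) t + 1 and A' t; from A' = A - 1 the
difference stays one. -/
theorem IsCarry.avail_bump (ht : ∀ j, 2 ≤ t j) {d : ℕ → ℕ} {x q : ℕ} (hq : IsCarry t d x q)
    (h : ∀ j < x, d j < t j) : avail t (bump d q) x + 1 = avail t d x := by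
  obtain ⟨hqx, hq1, hq2⟩ := hq
  have hb : ∀ j, bump d q j < t j := IsCarry.bump_lt ht ⟨hqx, hq1, hq2⟩ h
  suffices H : ∀ y, q < y → y ≤ x → avail t (bump d q) y + 1 = avail t d y from H x hqx le_rfl
  intro y hy
  induction y, hy using Nat.le_induction with
  | base =>
    intro _
    rw [avail, avail, avail_congr (d := bump d q) (d' := d) fun j hj => by simp [bump, hj]]
    simp only [bump, lt_irrefl, if_false, if_true]
    omega
  | succ y hy ih =>
    intro hyx
    have ih := ih (by omega)
    have h1 := hq2 y hy (by omega)
    have h2 := h y (by omega)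
    have h3 : bump d q y = 0 := by
      rw [bump, if_neg (by omega), if_neg (by omega)]
    rw [avail_succ_of_eq_zero (fun j _ => hb j) h3, avail, ← ih, Nat.add_sub_cancel]
    omega

/-- The word of length `x` with digits `d` can serve as the `k`-th word. -/
def GoodWord (t m b : ℕ → ℕ) (k x : ℕ) (d : ℕ → ℕ) : Prop :=
  (∀ j < x, d j < t j) ∧ avail t d x + k = m x + b x

/-- `x k` is the level of the `k`-th leaf from the top. -/
def IsLevels (m : ℕ → ℕ) (n i : ℕ) (x : ℕ → ℕ) : Prop :=
  ∀ k < n, x k ≤ i ∧ k < m (x k) ∧ ∀ j < x k, m j ≤ k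

theorem GoodWord.congr {m b d d' : ℕ → ℕ} {k x : ℕ} (h : GoodWord t m b k x d)
    (hd : ∀ j < x, d j = d' j) : GoodWord t m b k x d' :=
  ⟨fun j hj => hd j hj ▸ h.1 j hj, by rw [← avail_congr hd, h.2]⟩

theorem IsPath.m_mono {m b : ℕ → ℕ} (h : IsPath t n i m b) {j j' : ℕ} (hj : j ≤ j')
    (hj' : j' ≤ i) : m j ≤ m j' := by
  induction j', hj using Nat.le_induction with
  | base => exact le_rfl
  | succ j' _ ih => exact (ih (by omega)).trans (h.mono j' (by omega))

theorem IsLevels.le_succ {m x : ℕ → ℕ} (hx : IsLevels m n i x) {k : ℕ} (hk : k + 1 < n) :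
    x k ≤ x (k + 1) := by
  by_contra h
  have h1 := (hx k (by omega)).2.2 _ (not_le.1 h)
  have h2 := (hx (k + 1) hk).2.1
  omega

theorem IsPath.le_of_b_eq_zero {m b : ℕ → ℕ} (h : IsPath t n i m b) {j : ℕ} (hj : j ≤ i)
    (hb : b j = 0) : n ≤ m j := by
  rcases h.valid j hj with h | h
  · omega
  · have := h.2.2.1
    omega

theorem IsPath.exists_isLevels {m b : ℕ → ℕ} (h : IsPath t n i m b) (hb : b i = 0) :
    ∃ x, IsLevels m n i x := by
  classical
  have hm := h.le_of_b_eq_zero le_rfl hb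
  refine ⟨fun k => if hk : ∃ j, k < m j then Nat.find hk else 0, fun k hk => ?_⟩
  have hex : ∃ j, k < m j := ⟨i, by omega⟩
  simp only [dif_pos hex]
  exact ⟨Nat.find_min' hex (by omega), Nat.find_spec hex, fun j hj => not_lt.1 (Nat.find_min hex hj)⟩

theorem goodWord_zero (ht : ∀ j, 2 ≤ t j) {m b x : ℕ → ℕ} (h : IsPath t n i m b)
    (hx : IsLevels m n i x) (hn : 0 < n) : GoodWord t m b 0 (x 0) fun _ => 0 := by
  have h0 : ∀ j, 0 < t j := fun j => by have := ht j; omega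
  refine ⟨fun j _ => h0 j, ?_⟩
  obtain ⟨h1, -, h3⟩ := hx 0 hn
  suffices H : ∀ j ≤ x 0, avail t (fun _ => 0) j = m j + b j from H _ le_rfl
  intro j
  induction j with
  | zero => simp [avail, h.m_zero, h.b_zero]
  | succ j ih =>
    intro hj
    have := h3 j (by omega)
    rw [avail_succ_of_eq_zero (fun j _ => h0 j) rfl, ih (by omega), h.step j (by omega),
      show m j = 0 by omega]
    simp

/-- At least two nodes are left: if `b (x k) > 0` this follows from `k < m (x k)`, and otherwise
from `m (x k) ≥ n > k + 1`. -/
theorem GoodWord.exists_isCarry {m b x d : ℕ → ℕ} {k : ℕ} (h : IsPath t n i m b)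
    (hx : IsLevels m n i x) (hk : k + 1 < n) (hd : GoodWord t m b k (x k) d) :
    ∃ q, IsCarry t d (x k) q := by
  refine MixedRadix.exists_isCarry hd.1 ?_
  have h1 := hd.2
  obtain ⟨h2, h3, -⟩ := hx k (by omega)
  have : b (x k) = 0 → n ≤ m (x k) := h.le_of_b_eq_zero h2
  omega

/-- On level `x k` one node is used up while k grows by one, which keeps the sum. On each further
level j passed on the way to `x (k + 1)` all leaves so far are used, so `m j = k + 1` and the
available nodes are the `b j` inner ones; appending a zero multiplies them by `t j`, in accordance
with the step equation. -/
theorem GoodWord.bump (ht : ∀ j, 2 ≤ t j) {m b x d : ℕ → ℕ} {k q : ℕ} (h : IsPath t n i m b)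
    (hx : IsLevels m n i x) (hk : k + 1 < n) (hd : GoodWord t m b k (x k) d)
    (hq : IsCarry t d (x k) q) : GoodWord t m b (k + 1) (x (k + 1)) (bump d q) := by
  have hb := hq.bump_lt ht hd.1
  refine ⟨fun j _ => hb j, ?_⟩
  obtain ⟨h1, -, h3⟩ := hx (k + 1) hk
  have hkx := (hx k (by omega)).2.1
  suffices H : ∀ j, x k ≤ j → j ≤ x (k + 1) → avail t (MixedRadix.bump d q) j + (k + 1) =
    m j + b j from H _ (hx.le_succ hk) le_rfl
  intro j hj
  induction j, hj using Nat.le_induction with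
  | base =>
    intro _
    have := hq.avail_bump ht hd.1
    have := hd.2
    omega
  | succ j hj ih =>
    intro hj'
    have h4 := h3 j (by omega)
    have h5 := h.m_mono hj (by omega)
    have h6 : MixedRadix.bump d q j = 0 := by
      have := hq.1
      rw [MixedRadix.bump, if_neg (by omega), if_neg (by omega)]
    have h7 : avail t (MixedRadix.bump d q) j = b j := by
      have := ih (by omega)
      omega
    rw [avail_succ_of_eq_zero (fun j _ => hb j) h6, h7, h.step j (by omega)]
    omega

/-- The digits `d` precede the digits `d'` and differ from them before position `x`. -/
def LexLt (x : ℕ) (d d' : ℕ → ℕ) : Prop := ∃ q < x, (∀ j < q, d j = d' j) ∧ d q < d' q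

theorem LexLt.trans {x x' : ℕ} {d d' d'' : ℕ → ℕ} (h : LexLt x d d') (h' : LexLt x' d' d'') :
    LexLt x d d'' := by
  obtain ⟨q, hq, h1, h2⟩ := h
  obtain ⟨q', hq', h1', h2'⟩ := h'
  rcases lt_trichotomy q q' with h | rfl | h
  · exact ⟨q, hq, fun j hj => (h1 j hj).trans (h1' j (by omega)), by rw [← h1' q h]; exact h2⟩
  · exact ⟨q, hq, fun j hj => (h1 j hj).trans (h1' j (by omega)), h2.trans h2'⟩
  · exact ⟨q', by omega, fun j hj => (h1 j (by omega)).trans (h1' j hj), by rw [h1 q' h]; exact h2'⟩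

theorem IsCarry.lexLt {d : ℕ → ℕ} {x q : ℕ} (h : IsCarry t d x q) : LexLt x d (bump d q) :=
  ⟨q, h.1, fun j hj => by simp [bump, hj], by simp [bump]⟩

/-- Words in lexicographic order and of non-decreasing length form a code. -/
theorem isMixedRadixCode_of_lexLt {x : ℕ → ℕ} {d : ℕ → ℕ → ℕ}
    (hd : ∀ k < n, ∀ j < x k, d k j < t j) (hx : ∀ k, k + 1 < n → x k ≤ x (k + 1))
    (hlex : ∀ k, k + 1 < n → LexLt (x k) (d k) (d (k + 1))) :
    IsMixedRadixCode t fun k : Fin n => List.ofFn fun j : Fin (x k) => d k j := by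
  -- The first difference lies before `x k`, hence inside both words since lengths do not decrease;
  -- so neither can be a prefix of the other.
  have key : ∀ k l, k < l → l < n → x k ≤ x l ∧ LexLt (x k) (d k) (d l) := by
    intro k l hkl
    induction l, hkl using Nat.le_induction with
    | base => exact fun h => ⟨hx k h, hlex k h⟩
    | succ l _ ih =>
      intro hl
      obtain ⟨h1, h2⟩ := ih (by omega)
      exact ⟨h1.trans (hx l hl), h2.trans (hlex l hl)⟩
  have hpre : ∀ k l, (List.ofFn fun j : Fin (x k) => d k j) <+:
      (List.ofFn fun j : Fin (x l) => d l j) → ∀ j < x k, d k j = d l j := by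
    intro k l h j hj
    have h1 := h.length_le
    rw [List.length_ofFn, List.length_ofFn] at h1
    have := h.getElem (i := j) (by simpa using hj)
    simpa using this
  refine ⟨fun k j hj => ?_, fun k l hkl h => ?_⟩
  · have hj' : j < x k := by simpa using hj
    simpa using hd k k.2 j hj'
  · have hp := hpre k l h
    rcases lt_or_gt_of_ne (fun h => hkl (Fin.ext h) : (k : ℕ) ≠ l) with h1 | h1
    · obtain ⟨-, q, hq, -, hlt⟩ := key k l h1 l.2
      have := hp q hq
      omega
    · obtain ⟨hle, q, hq, -, hlt⟩ := key l k h1 k.2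
      have := hp q (by omega)
      omega

theorem treeCost_ofFn {m b x : ℕ → ℕ} {d : ℕ → ℕ → ℕ} (h : IsPath t n i m b)
    (hx : IsLevels m n i x) :
    treeCost c (fun k : Fin n => p k) (fun k : Fin n => List.ofFn fun j : Fin (x k) => d k j) =
      pathCost c p n i m := by
  rw [← sum_depth_eq_pathCost c p n i m x (fun k hk => (hx k hk).1), Finset.sum_range]
  · simp [treeCost]
  · intro k hk j hj
    obtain ⟨h1, h2, h3⟩ := hx k hk
    refine ⟨h3 j, fun hmk => ?_⟩
    by_contra hjx
    have := h.m_mono (not_lt.1 hjx) hj.le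
    omega

/-- A complete sequence of signatures is realized by a code. -/
theorem IsPath.exists_code (ht : ∀ j, 2 ≤ t j) {m b : ℕ → ℕ}
    (h : IsPath t n i m b) (hb : b i = 0) (c p : ℕ → ℝ) :
    ∃ w, IsMixedRadixCode t w ∧
      treeCost c (fun k : Fin n => p k) w = pathCost c p n i m := by
  classical
  obtain ⟨x, hx⟩ := h.exists_isLevels hb
  -- The default branch is irrelevant: as long as another word is needed, a carry position exists.
  let d : ℕ → ℕ → ℕ := fun k => Nat.rec (fun _ => 0)
    (fun k dk => if hq : ∃ q, IsCarry t dk (x k) q then MixedRadix.bump dk hq.choose else dk) k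
  have hd : ∀ k < n, GoodWord t m b k (x k) (d k) := by
    intro k
    induction k with
    | zero => exact fun hk => goodWord_zero ht h hx hk
    | succ k ih =>
      intro hk
      have hg := ih (by omega)
      have hq := hg.exists_isCarry h hx hk
      have : d (k + 1) = MixedRadix.bump (d k) hq.choose := dif_pos hq
      rw [this]
      exact hg.bump ht h hx hk hq.choose_spec
  refine ⟨fun k => List.ofFn fun j : Fin (x k) => d k j, ?_, treeCost_ofFn h hx⟩
  refine isMixedRadixCode_of_lexLt (fun k hk => (hd k hk).1) (fun k hk => hx.le_succ hk) ?_
  intro k hk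
  have hq := (hd k (by omega)).exists_isCarry h hx hk
  have : d (k + 1) = MixedRadix.bump (d k) hq.choose := dif_pos hq
  rw [this]
  exact hq.choose_spec.lexLt

/-- The least table entry with `b = 0`. -/
noncomputable def bestEntry (t : ℕ → ℕ) (c p : ℕ → ℝ) (n : ℕ) : WithTop ℝ :=
  (Finset.Icc 1 n).inf fun i =>
    (Finset.Icc (max n (t (i - 1))) (n + t (i - 1) - 1)).inf fun m => OPT t c p n i m 0

/-! ### The optimal cost as the least entry with b = 0 -/

theorem bestEntry_le_treeCost (ht : ∀ j, 2 ≤ t j) (hc : ∀ j, 0 ≤ c j) (hn : 2 ≤ n)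
    (hp : SortedWeights n p) {u : Fin n → List ℕ} (hu : IsMixedRadixCode t u) :
    bestEntry t c p n ≤ (treeCost c (fun k : Fin n => p k) u : ℝ) := by
  obtain ⟨i, m, b, hi, hin, hP, hb, hle⟩ := hu.exists_path_le ht hc hn hp
  have hmem : pathCost c p n i m ∈ costSet t c p n i (m i) 0 := by
    rw [mem_costSet_iff ht c hp.2.2]
    exact ⟨m, b, hP, rfl, hb, rfl⟩
  have hv : max n (t (i - 1)) ≤ m i ∧ m i ≤ n + t (i - 1) - 1 := by
    rcases hP.valid i le_rfl with h | h
    · omega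
    · exact h.2.2
  calc bestEntry t c p n ≤ OPT t c p n i (m i) 0 :=
        (Finset.inf_le (Finset.mem_Icc.2 ⟨hi, hin⟩)).trans (Finset.inf_le (Finset.mem_Icc.2 hv))
    _ ≤ (pathCost c p n i m : ℝ) := OPT_le ht hc hp hmem
    _ ≤ _ := by exact_mod_cast hle

/-- Each cost behind an entry with b = 0 is the cost of an actual code, which an optimal tree does
not exceed. The tabulated trees may have more than n leaves; the surplus is discarded by using only
the first n. -/
theorem treeCost_eq_bestEntry (ht : ∀ j, 2 ≤ t j) (hc : ∀ j, 0 ≤ c j) (hn : 2 ≤ n)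
    (hp : SortedWeights n p) {v : Fin n → List ℕ}
    (hv : IsOptimalTree t c (fun k : Fin n => p k) v) :
    ((treeCost c (fun k : Fin n => p k) v : ℝ) : WithTop ℝ) = bestEntry t c p n := by
  rw [isOptimalTree_iff c (by omega)] at hv
  refine le_antisymm ?_ (bestEntry_le_treeCost ht hc hn hp hv.1)
  refine Finset.le_inf fun i _ => Finset.le_inf fun M _ => ?_
  rw [le_OPT_iff ht hc hp]
  intro x hx
  rw [mem_costSet_iff ht c hp.2.2] at hx
  obtain ⟨m, b, hP, -, hb, rfl⟩ := hx
  obtain ⟨w, hw, hwc⟩ := hP.exists_code ht hb c p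
  rw [← hwc]
  exact_mod_cast hv.2 w hw

end

/-! ### Programs for one batch

Natural variables: `0` holds `n`, `1` holds `i`, `2` holds `d`, `3` holds `t i`, `4` holds `b₁`, `5`
holds `b₁ * t i`, `6` holds `m`. Real variables: `0` holds the running minimum, `1` a value of `γ`. -/

theorem Prog.run_frame {P : Prog} (h : P.loopFree = true) (s : Store) : Frame P s (P.run s) := by
  obtain ⟨s₁, T, h₁, -, rfl⟩ := Prog.Runs.of_loopFree (Q := fun s₁ => s₁ = P.run s) h rfl
  exact h₁.frame

@[simp] theorem enc_top : enc ⊤ = -1 := rfl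

@[simp] theorem enc_coe (x : ℝ) : enc (x : WithTop ℝ) = x := rfl

/-- `table[i, d - b₁ * t i, b₁]`. -/
def entryExp : RExp := .get 2 (.var 1) (.sub (.var 2) (.var 5)) (.var 4)

/-- Compute `γ(b₁)`. -/
def gamVal : Prog :=
  .cond (.conj (.nle (.lit 1) (.var 4))
      (.conj (.nle (.add (.sub (.var 2) (.var 5)) (.var 4)) (.var 0)) (.rle (.lit 0) entryExp)))
    (.rset 1 (.add entryExp (.mul (.get 1 (.var 1) (.lit 0) (.lit 0))
      (.get 3 (.sub (.var 2) (.var 5)) (.lit 0) (.lit 0)))))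
    (.cond (.conj (.nle (.var 4) (.lit 0)) (.conj (.nle (.lit 1) (.var 1))
        (.conj (.nle (.var 0) (.var 2))
          (.conj (.nle (.get 0 (.sub (.var 1) (.lit 1)) (.lit 0) (.lit 0)) (.var 2))
            (.nle (.add (.var 2) (.lit 1))
              (.add (.var 0) (.get 0 (.sub (.var 1) (.lit 1)) (.lit 0) (.lit 0))))))))
      (.rset 1 entryExp)
      (.rset 1 (.sub (.lit 0) (.lit 1))))

/-- Update the running minimum. -/
def minStep : Prog :=
  .cond (.conj (.rle (.lit 0) (.var 1)) (.neg (.conj (.rle (.lit 0) (.var 0))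
    (.rle (.var 0) (.var 1))))) (.rset 0 (.var 1)) .skip

def gamStep : Prog := .seq gamVal minStep

/-- The data from which level `i + 1` is computed. -/
structure LevelData (s : Store) (t : ℕ → ℕ) (c p : ℕ → ℝ) (n i : ℕ) : Prop where
  n_eq : s.nvar 0 = n
  i_eq : s.nvar 1 = i
  arities : s.HasArities t (i + 1)
  lengths : s.HasLengths c (i + 1)
  tails : s.HasTails p n
  level : s.HasLevel t c p n i

section

variable {t : ℕ → ℕ} {c p : ℕ → ℝ} {n i : ℕ}

theorem LevelData.of_eq {s s' : Store} (h : LevelData s t c p n i) (h0 : s'.nvar 0 = s.nvar 0)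
    (h1 : s'.nvar 1 = s.nvar 1) (ha : s'.narr 0 = s.narr 0) (hc : s'.rarr 1 = s.rarr 1)
    (hW : s'.rarr 3 = s.rarr 3) (hO : ∀ m b, s'.rarr 2 i m b = s.rarr 2 i m b) :
    LevelData s' t c p n i where
  n_eq := h0.trans h.n_eq
  i_eq := h1.trans h.i_eq
  arities j hj := by rw [ha]; exact h.arities j hj
  lengths j hj := by rw [hc]; exact h.lengths j hj
  tails m hm := by rw [hW]; exact h.tails m hm
  level m b hv := by rw [hO]; exact h.level m b hv

/-- Cells of invalid signatures hold garbage, so validity is tested before an entry is used. In the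
valid case b₁ = 0 one has `n ≤ d`; the tail is then zero and must not be read, because the array of
tails ends at n. -/
theorem gamVal_run (ht : ∀ j, 2 ≤ t j) (hc : ∀ j, 0 ≤ c j) (hp : SortedWeights n p) {s : Store}
    (h : LevelData s t c p n i) {d b₁ : ℕ} (h2 : s.nvar 2 = d) (h4 : s.nvar 4 = b₁)
    (h5 : s.nvar 5 = b₁ * t i) :
    (gamVal.run s).rvar 1 = enc (gam t c p n i d b₁) := by
  have hO := OPT_nonneg (i := i) ht hc hp (d - b₁ * t i) b₁
  have hlen := h.lengths i (Nat.lt_succ_self i)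
  have hlev := h.level (d - b₁ * t i) b₁
  by_cases hb : 1 ≤ b₁
  · by_cases hv : d - b₁ * t i + b₁ ≤ n
    · have hlev := hlev (Or.inl ⟨hb, hv⟩)
      have htail := h.tails (d - b₁ * t i) (by omega)
      rw [gam]
      induction hx : OPT t c p n i (d - b₁ * t i) b₁ using WithTop.recTopCoe with
      | top =>
        rw [hx, enc_top] at hlev
        simp [gamVal, entryExp, h.i_eq, h.n_eq, h2, h4, h5, hlev, Nat.one_le_iff_ne_zero.1 hb,
          show ¬ (1 : ℝ) ≤ 0 by norm_num]
      | coe x =>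
        rw [hx] at hO hlev
        rw [enc_coe] at hlev
        have hO : 0 ≤ x := by exact_mod_cast hO
        rw [← WithTop.coe_add, enc_coe]
        simp [gamVal, entryExp, h.i_eq, h.n_eq, h2, h4, h5, hlev, hb, hv, hO, hlen, htail]
    · have : ¬ Valid t n i (d - b₁ * t i) b₁ := by
        rintro (h | h) <;> omega
      rw [gam, OPT_of_not_valid this]
      simp [gamVal, entryExp, h.i_eq, h.n_eq, h2, h4, h5, hb, hv, Nat.one_le_iff_ne_zero.1 hb]
  · obtain rfl : b₁ = 0 := by omega
    simp only [zero_mul, Nat.sub_zero] at h5 hO hlev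
    by_cases hv : 1 ≤ i ∧ n ≤ d ∧ t (i - 1) ≤ d ∧ d + 1 ≤ n + t (i - 1)
    · have hlev := hlev (Or.inr ⟨rfl, hv.1, by omega, by omega⟩)
      have har := h.arities (i - 1) (by omega)
      simp only [gam, zero_mul, Nat.sub_zero, tailSum_of_le hv.2.1, mul_zero, WithTop.coe_zero,
        add_zero]
      rw [← hlev]
      simp [gamVal, entryExp, h.i_eq, h.n_eq, h2, h4, h5, har, hv]
    · have hv' : ¬ Valid t n i d 0 := by
        have := ht (i - 1)
        rintro (h | h) <;> omega
      have hv'' : ¬ (1 ≤ i ∧ n ≤ d ∧ s.narr 0 (i - 1) 0 0 ≤ d ∧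
          d < n + s.narr 0 (i - 1) 0 0) := by
        rwa [h.arities (i - 1) (by omega)]
      simp only [gam, zero_mul, Nat.sub_zero, OPT_of_not_valid hv', WithTop.top_add, enc_top]
      simp [gamVal, entryExp, h.i_eq, h.n_eq, h2, h4, h5, hv'']

theorem minStep_run {s : Store} {y z : WithTop ℝ} (hy : 0 ≤ y) (hz : 0 ≤ z)
    (h0 : s.rvar 0 = enc y) (h1 : s.rvar 1 = enc z) :
    (minStep.run s).rvar 0 = enc (min y z) := by
  induction y using WithTop.recTopCoe with
  | top =>
    induction z using WithTop.recTopCoe with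
    | top => simp [minStep, h0, h1, show ¬ (1 : ℝ) ≤ 0 by norm_num]
    | coe z =>
      have hz : 0 ≤ z := by exact_mod_cast hz
      simp only [enc_top, enc_coe] at h0 h1
      simp [minStep, h0, h1, hz]
  | coe y =>
    have hy : 0 ≤ y := by exact_mod_cast hy
    induction z using WithTop.recTopCoe with
    | top =>
      simp only [enc_top, enc_coe] at h0 h1
      simp [minStep, h0, h1, show ¬ (1 : ℝ) ≤ 0 by norm_num]
    | coe z =>
      have hz : 0 ≤ z := by exact_mod_cast hz
      rw [enc_coe] at h0 h1
      rw [← WithTop.coe_min, enc_coe]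
      by_cases hyz : y ≤ z
      · simp [minStep, h0, h1, hy, hz, hyz]
      · simp [minStep, h0, h1, hy, hz, hyz, (not_le.1 hyz).le]

@[simp] theorem gamStep_nvar (s : Store) : (gamStep.run s).nvar = s.nvar :=
  funext fun x => (Prog.run_frame (P := gamStep) rfl s).n x rfl

@[simp] theorem gamStep_narr (s : Store) : (gamStep.run s).narr = s.narr :=
  funext fun x => (Prog.run_frame (P := gamStep) rfl s).na x rfl

@[simp] theorem gamStep_rarr (s : Store) : (gamStep.run s).rarr = s.rarr :=
  funext fun x => (Prog.run_frame (P := gamStep) rfl s).ra x rfl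

theorem gamStep_run (ht : ∀ j, 2 ≤ t j) (hc : ∀ j, 0 ≤ c j) (hp : SortedWeights n p) {s : Store}
    (h : LevelData s t c p n i) {d b₁ : ℕ} (h2 : s.nvar 2 = d) (h4 : s.nvar 4 = b₁)
    (h5 : s.nvar 5 = b₁ * t i) {y : WithTop ℝ} (hy : 0 ≤ y) (h0 : s.rvar 0 = enc y) :
    (gamStep.run s).rvar 0 = enc (min y (gam t c p n i d b₁)) := by
  refine minStep_run hy (gam_nonneg ht hc hp d b₁) ?_ (gamVal_run ht hc hp h h2 h4 h5)
  rw [← h0]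
  exact (Prog.run_frame (P := gamVal) rfl s).r 0 rfl

/-- Compute the entry with `b = 0` of the batch `d`. -/
def finalInit : Prog :=
  .seq (.nset 4 (.lit 0)) (.seq (.nset 5 (.lit 0)) (.rset 0 (.sub (.lit 0) (.lit 1))))

def finalBody : Prog :=
  .seq gamStep (.seq (.nset 4 (.add (.var 4) (.lit 1))) (.nset 5 (.add (.var 5) (.var 3))))

def finalProg : Prog :=
  .seq finalInit (.seq (.loop (.nle (.var 5) (.var 2)) finalBody)
    (.rput 2 (.add (.var 1) (.lit 1)) (.var 2) (.lit 0) (.var 0)))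

/-- For b = 0 every `b₁ ≤ d / t i` is admissible, so one sweep suffices. The time depends on the
quotient and not on d, which keeps the entries with b = 0 affordable for large arities. -/
theorem finalProg_runs : ∃ K : ℕ, ∀ (t : ℕ → ℕ) (c p : ℕ → ℝ) (n i d : ℕ) (s : Store),
    (∀ j, 2 ≤ t j) → (∀ j, 0 ≤ c j) → SortedWeights n p → LevelData s t c p n i →
    s.nvar 2 = d → s.nvar 3 = t i →
    finalProg.Runs s (K * (d / t i + 1)) fun s₁ =>
      s₁.rarr 2 (i + 1) d 0 = enc (batchMin t c p n i d 0) ∧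
      ∀ j m b, ¬ (j = i + 1 ∧ m + b = d ∧ b = 0) → s₁.rarr 2 j m b = s.rarr 2 j m b := by
  refine ⟨finalInit.cost + (2 * (finalBody.cost + 3) + 7), ?_⟩
  intro t c p n i d s ht hc hp hs h2 h3
  have ht0 : 0 < t i := by have := ht i; omega
  refine Prog.Runs.mono (T := finalInit.cost + ((d / t i + 1 + 1) * (finalBody.cost + 3) + 7)) ?_
    (by nlinarith [Nat.zero_le (finalInit.cost * (d / t i)), Nat.zero_le (d / t i),
      Nat.zero_le (finalBody.cost * (d / t i))]) fun _ h => h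
  refine Prog.Runs.seq (Prog.Runs.block (P := finalInit) rfl (Q := fun s₁ => Frame finalInit s s₁ ∧
    s₁.nvar 4 = 0 ∧ s₁.nvar 5 = 0 ∧ s₁.rvar 0 = enc ⊤) fun hF => ⟨hF, ?_⟩) ?_
  · simp [finalInit]
  rintro s₀ ⟨hF₀, h4, h5, h0⟩
  refine Prog.Runs.seq (Prog.Runs.loop_frame (P := finalBody) (B := finalBody.cost)
    (fun k s₁ => s₁.nvar 4 = k ∧ s₁.nvar 5 = k * t i ∧
      s₁.rvar 0 = enc ((Finset.range k).inf (gam t c p n i d)))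
    (d / t i + 1) ⟨h4, by simpa using h5, by simpa using h0⟩ ?_ ?_) ?_
  · rintro k s₁ hk hF ⟨h4, h5, h0⟩
    have hk' : k * t i ≤ d := (Nat.le_div_iff_mul_le ht0).1 (Nat.lt_succ_iff.1 hk)
    have e2 : s₁.nvar 2 = d := by rw [hF.n 2 rfl, hF₀.n 2 rfl, h2]
    have e3 : s₁.nvar 3 = t i := by rw [hF.n 3 rfl, hF₀.n 3 rfl, h3]
    have hs₁ : LevelData s₁ t c p n i := hs.of_eq (by rw [hF.n 0 rfl, hF₀.n 0 rfl])
      (by rw [hF.n 1 rfl, hF₀.n 1 rfl]) (by rw [hF.na 0 rfl, hF₀.na 0 rfl])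
      (by rw [hF.ra 1 rfl, hF₀.ra 1 rfl]) (by rw [hF.ra 3 rfl, hF₀.ra 3 rfl])
      (by rw [hF.ra 2 rfl, hF₀.ra 2 rfl]; simp)
    refine ⟨by simpa [h5, e2] using hk', Prog.Runs.block rfl fun _ => ?_⟩
    have := gamStep_run ht hc hp hs₁ e2 h4 h5
      (Finset.le_inf fun b₁ _ => gam_nonneg ht hc hp d b₁) h0
    rw [Finset.range_add_one, Finset.inf_insert, inf_comm]
    refine ⟨by simp [finalBody, h4], by simp [finalBody, h5, e3]; ring, ?_⟩
    simpa [finalBody] using this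
  · rintro s₁ hF ⟨h4, h5, h0⟩
    have e2 : s₁.nvar 2 = d := by rw [hF.n 2 rfl, hF₀.n 2 rfl, h2]
    simpa [h5, e2] using Nat.lt_mul_of_div_lt (Nat.lt_succ_self _) ht0
  · rintro s₁ ⟨hF, -, -, h0⟩
    have e1 : s₁.nvar 1 = i := by rw [hF.n 1 rfl, hF₀.n 1 rfl, hs.i_eq]
    have e2 : s₁.nvar 2 = d := by rw [hF.n 2 rfl, hF₀.n 2 rfl, h2]
    have e3 : s₁.rarr 2 = s.rarr 2 := by rw [hF.ra 2 rfl, hF₀.ra 2 rfl]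
    refine Prog.Runs.block rfl fun _ => ⟨?_, fun j m b hj => ?_⟩
    · rw [batchMin_zero]
      simpa [putCell, e1, e2] using h0
    · simp only [Prog.run, putCell, NExp.eval, e1, e2, true_and, e3]
      rw [if_neg]
      omega

/-- Compute `d / t i` and its product with `t i`. -/
def countInit : Prog := .seq (.nset 4 (.lit 0)) (.nset 5 (.lit 0))

def countBody : Prog :=
  .seq (.nset 4 (.add (.var 4) (.lit 1))) (.nset 5 (.add (.var 5) (.var 3)))

def countProg : Prog :=
  .seq countInit (.loop (.nle (.add (.var 5) (.var 3)) (.var 2)) countBody)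

/-- Naturals cannot be multiplied or divided by the machine: quotient and product are built up
together by repeated addition. -/
theorem countProg_runs (ht : ∀ j, 2 ≤ t j) {d : ℕ} {s : Store} (h2 : s.nvar 2 = d)
    (h3 : s.nvar 3 = t i) :
    countProg.Runs s (countInit.cost + (d + 1) * (countBody.cost + 5)) fun s₁ =>
      s₁.nvar 4 = d / t i ∧ s₁.nvar 5 = d / t i * t i := by
  have ht0 : 0 < t i := by have := ht i; omega
  have hdd : d / t i ≤ d := Nat.div_le_self d (t i)
  refine Prog.Runs.mono (T := countInit.cost + (d / t i + 1) * (countBody.cost + 5)) ?_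
    (by gcongr) fun _ h => h
  refine Prog.Runs.seq (Prog.Runs.block (P := countInit) rfl (Q := fun s₁ => Frame countInit s s₁ ∧
    s₁.nvar 4 = 0 ∧ s₁.nvar 5 = 0) fun hF => ⟨hF, by simp [countInit]⟩) ?_
  rintro s₀ ⟨hF₀, h4, h5⟩
  refine (Prog.Runs.loop_frame (P := countBody) (B := countBody.cost)
    (fun k s₁ => s₁.nvar 4 = k ∧ s₁.nvar 5 = k * t i) (d / t i) ⟨h4, by simpa using h5⟩
    ?_ ?_).mono le_rfl fun s₁ h => h.2
  · rintro k s₁ hk hF ⟨h4, h5⟩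
    have e2 : s₁.nvar 2 = d := by rw [hF.n 2 rfl, hF₀.n 2 rfl, h2]
    have e3 : s₁.nvar 3 = t i := by rw [hF.n 3 rfl, hF₀.n 3 rfl, h3]
    have hk' : (k + 1) * t i ≤ d := (Nat.le_div_iff_mul_le ht0).1 hk
    refine ⟨?_, Prog.Runs.block rfl fun _ => ⟨by simp [countBody, h4], ?_⟩⟩
    · simp [h5, e2, e3]
      linarith
    · simp [countBody, h5, e3]
      ring
  · rintro s₁ hF ⟨h4, h5⟩
    have e2 : s₁.nvar 2 = d := by rw [hF.n 2 rfl, hF₀.n 2 rfl, h2]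
    have e3 : s₁.nvar 3 = t i := by rw [hF.n 3 rfl, hF₀.n 3 rfl, h3]
    have := Nat.lt_mul_of_div_lt (Nat.lt_succ_self (d / t i)) ht0
    simp [h5, e2, e3]
    linarith

/-- Compute the entries with `b > 0` of the batch `d`. -/
def fillInit : Prog := .seq (.rset 0 (.sub (.lit 0) (.lit 1))) (.nset 6 (.lit 0))

def fillBody : Prog :=
  .seq (.cond (.nle (.var 2) (.add (.var 5) (.var 6)))
      (.seq gamStep (.seq (.nset 4 (.sub (.var 4) (.lit 1))) (.nset 5 (.sub (.var 5) (.var 3)))))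
      .skip)
    (.rput 2 (.add (.var 1) (.lit 1)) (.var 6) (.sub (.var 2) (.var 6)) (.var 0))

def fillProg : Prog := .seq countProg (.seq fillInit (.upto 6 (.var 2) fillBody))

/-- The running minimum of `OPT_batch`. The second conclusion confines the writes to entries with `b
> 0` of one batch, so level i survives and batches can be computed one after another. -/
theorem fillProg_runs : ∃ K : ℕ, ∀ (t : ℕ → ℕ) (c p : ℕ → ℝ) (n i d : ℕ) (s : Store),
    (∀ j, 2 ≤ t j) → (∀ j, 0 ≤ c j) → SortedWeights n p → LevelData s t c p n i →
    s.nvar 2 = d → s.nvar 3 = t i →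
    fillProg.Runs s (K * (d + 1)) fun s₁ =>
      (∀ m < d, s₁.rarr 2 (i + 1) m (d - m) = enc (batchMin t c p n i d (d - m))) ∧
      ∀ j m b, ¬ (j = i + 1 ∧ m + b = d ∧ 0 < b) → s₁.rarr 2 j m b = s.rarr 2 j m b := by
  refine ⟨countInit.cost + (countBody.cost + 5) + (fillInit.cost + (fillBody.cost + 8)), ?_⟩
  intro t c p n i d s ht hc hp hs h2 h3
  have ht0 : 0 < t i := by have := ht i; omega
  refine Prog.Runs.mono (T := (countInit.cost + (d + 1) * (countBody.cost + 5)) +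
    (fillInit.cost + (d - 0 + 1) * (fillBody.cost + 1 + 7))) ?_
    (by rw [Nat.sub_zero]
        nlinarith [Nat.zero_le (countInit.cost * d), Nat.zero_le (fillInit.cost * d)])
    fun _ h => h
  refine Prog.Runs.seq (countProg_runs ht h2 h3).frame ?_
  rintro s₀ ⟨hF₀, h4, h5⟩
  refine Prog.Runs.seq (Prog.Runs.block (P := fillInit) rfl (Q := fun s₁ => Frame fillInit s₀ s₁ ∧
    s₁.nvar 6 = 0 ∧ s₁.rvar 0 = enc ⊤) fun hF => ⟨hF, by simp [fillInit]⟩) ?_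
  rintro s₁ ⟨hF₁, h6, h0⟩
  have e2 : s₁.nvar 2 = d := by rw [hF₁.n 2 rfl, hF₀.n 2 rfl, h2]
  have e3 : s₁.nvar 3 = t i := by rw [hF₁.n 3 rfl, hF₀.n 3 rfl, h3]
  have hd := Nat.div_add_mod' d (t i)
  have hd' := Nat.mod_lt d ht0
  -- At the start of round k, `b₁` is the quotient of `d - k` by `t i`, and the running minimum
  -- covers all candidates with `b₁ * t i > d - k`.
  refine (Prog.Runs.upto (B := fillBody.cost) (fun k s₂ => ∃ b₁, s₂.nvar 4 = b₁ ∧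
      s₂.nvar 5 = b₁ * t i ∧ b₁ * t i + k ≤ d ∧ d < (b₁ + 1) * t i + k ∧
      s₂.rvar 0 = enc (batchMin t c p n i d (d - k + 1)) ∧
      (∀ m < k, s₂.rarr 2 (i + 1) m (d - m) = enc (batchMin t c p n i d (d - m))) ∧
      ∀ j m b, ¬ (j = i + 1 ∧ m + b = d ∧ 0 < b) → s₂.rarr 2 j m b = s.rarr 2 j m b) 0 d
    h6 (Nat.zero_le d) rfl ?_ ?_ ?_).mono le_rfl ?_
  · refine ⟨d / t i, by rw [hF₁.n 4 rfl, h4], by rw [hF₁.n 5 rfl, h5], by omega,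
      by rw [add_mul, one_mul]; omega, ?_, by simp, ?_⟩
    · rw [h0, batchMin_of_lt (by omega)]
    · intro j m b _
      rw [hF₁.ra 2 rfl, hF₀.ra 2 rfl]
  · intro k s₂ hF _
    rw [NExp.eval, hF.n 2 rfl, e2]
  · rintro k s₂ - hk hF h6 ⟨b₁, h4, h5, hle, hlt, h0, hm, hj⟩
    have e0 : s₂.nvar 0 = s.nvar 0 := by rw [hF.n 0 rfl, hF₁.n 0 rfl, hF₀.n 0 rfl]
    have e1 : s₂.nvar 1 = i := by rw [hF.n 1 rfl, hF₁.n 1 rfl, hF₀.n 1 rfl, hs.i_eq]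
    have e2 : s₂.nvar 2 = d := by rw [hF.n 2 rfl, e2]
    have e3 : s₂.nvar 3 = t i := by rw [hF.n 3 rfl, e3]
    have hs₂ : LevelData s₂ t c p n i := hs.of_eq e0 (by rw [e1, hs.i_eq])
      (by rw [hF.na 0 rfl, hF₁.na 0 rfl, hF₀.na 0 rfl])
      (by rw [hF.ra 1 rfl, hF₁.ra 1 rfl, hF₀.ra 1 rfl])
      (by rw [hF.ra 3 rfl, hF₁.ra 3 rfl, hF₀.ra 3 rfl])
      (fun m b => hj i m b (by omega))
    refine Prog.Runs.block rfl fun _ => ?_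
    by_cases hkd : d = b₁ * t i + k
    -- Here `d - k` is a positive multiple of `t i`, so `b₁ ≥ 1`; its γ is taken into the minimum
    -- and `b₁` decreases.
    · obtain ⟨a, rfl⟩ : ∃ a, b₁ = a + 1 := by
        refine ⟨b₁ - 1, ?_⟩
        rcases Nat.eq_zero_or_pos b₁ with rfl | h
        · simp at hkd
          omega
        · omega
      have hg := gamStep_run ht hc hp hs₂ e2 h4 h5 (batchMin_nonneg ht hc hp _ _) h0
      rw [show d - k + 1 = (a + 1) * t i + 1 by omega, ← batchMin_mul ht (by omega),
        show (a + 1) * t i = d - k by omega] at hg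
      have hamul : (a + 1) * t i = a * t i + t i := by ring
      refine ⟨a, ?_, ?_, by omega, by omega, ?_, ?_, ?_⟩
      · simp [fillBody, e2, h5, h6, ← hkd, h4]
      · simp [fillBody, e2, h5, h6, e3, hamul, show d ≤ a * t i + t i + k by omega]
      · rw [show d - (k + 1) + 1 = d - k by omega, ← hg]
        simp [fillBody, e2, h5, h6, ← hkd]
      · intro m hm'
        by_cases hmk : m = k
        · subst hmk
          simp [fillBody, e2, h5, h6, ← hkd, putCell, e1, hg]
        · simp [fillBody, e2, h5, h6, ← hkd, putCell, e1, hmk]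
          exact hm m (by omega)
      · intro j m b hne
        rw [← hj j m b hne]
        simp [fillBody, e2, h5, h6, ← hkd, putCell, e1]
        omega
    -- Now `d - k` lies strictly between two consecutive multiples of `t i`, so the set of
    -- candidates does not change.
    · have hg : batchMin t c p n i d (d - k) = batchMin t c p n i d (d - k + 1) := by
        apply batchMin_of_not_dvd
        rintro ⟨a, ha⟩
        rw [mul_comm] at ha
        have h1 : b₁ * t i < a * t i := by omega
        have h2 : a * t i < (b₁ + 1) * t i := by omega
        have := Nat.lt_of_mul_lt_mul_right h1
        have := Nat.lt_of_mul_lt_mul_right h2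
        omega
      have hkd' : ¬ d ≤ b₁ * t i + k := by omega
      refine ⟨b₁, ?_, ?_, by omega, by omega, ?_, ?_, ?_⟩
      · simp [fillBody, e2, h5, h6, hkd', h4]
      · simp [fillBody, e2, h5, h6, hkd']
      · rw [show d - (k + 1) + 1 = d - k by omega, hg, ← h0]
        simp [fillBody, e2, h5, h6, hkd']
      · intro m hm'
        by_cases hmk : m = k
        · subst hmk
          simp [fillBody, e2, h5, h6, hkd', putCell, e1, hg, h0]
        · simp [fillBody, e2, h5, h6, hkd', putCell, e1, hmk]
          exact hm m (by omega)
      · intro j m b hne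
        rw [← hj j m b hne]
        simp [fillBody, e2, h5, h6, hkd', putCell, e1]
        omega
  · rintro s₂ ⟨-, -, b₁, -, -, -, -, -, h, h'⟩
    exact ⟨h, h'⟩

/-- For `d > n` the only signature of the batch that can be valid has b = 0. The final cell is
written in every case; if its signature is invalid, its contents do not matter. -/
def batchProg : Prog :=
  .seq (.nset 3 (.get 0 (.var 1) (.lit 0) (.lit 0)))
    (.seq (.cond (.nle (.var 2) (.var 0)) fillProg .skip) finalProg)

theorem batchProg_solves : ∃ K : ℕ, ∀ (t : ℕ → ℕ) (c p : ℕ → ℝ) (n i d : ℕ),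
    (∀ j, 2 ≤ t j) → (∀ j, 0 ≤ c j) → 1 ≤ n → SortedWeights n p → 1 ≤ d →
    batchProg.Solves (K * d)
      (fun s => s.nvar 0 = n ∧ s.nvar 1 = i ∧ s.nvar 2 = d ∧ s.HasArities t (i + 1) ∧
        s.HasLengths c (i + 1) ∧ s.HasTails p n ∧ s.HasLevel t c p n i)
      (fun s => s.HasBatch t c p n (i + 1) d) := by
  obtain ⟨K₁, hK₁⟩ := fillProg_runs
  obtain ⟨K₂, hK₂⟩ := finalProg_runs
  refine ⟨5 + ((3 + (2 * K₁ + 1)) + 2 * K₂), ?_⟩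
  rintro t c p n i d ht hc hn hp hd s ⟨h0, h1, h2, har, hlen, htl, hlev⟩
  have hs : LevelData s t c p n i := ⟨h0, h1, har, hlen, htl, hlev⟩
  have hq : d / t i + 1 ≤ 2 * d := by have := Nat.div_le_self d (t i); omega
  have hT : 5 + ((3 + (K₁ * (d + 1) + 1)) + K₂ * (d / t i + 1)) ≤
      (5 + ((3 + (2 * K₁ + 1)) + 2 * K₂)) * d := by
    have h1 : K₂ * (d / t i + 1) ≤ K₂ * (2 * d) := by gcongr
    nlinarith [Nat.mul_le_mul_left K₁ hd]
  refine Prog.Runs.mono ?_ hT fun _ h => h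
  refine Prog.Runs.seq (Prog.Runs.block (P := .nset 3 (.get 0 (.var 1) (.lit 0) (.lit 0))) rfl
    (Q := fun s₁ => LevelData s₁ t c p n i ∧ s₁.nvar 2 = d ∧ s₁.nvar 3 = t i) ?_) ?_
  · intro hF
    refine ⟨hs.of_eq (hF.n 0 rfl) (hF.n 1 rfl) (hF.na 0 rfl) (hF.ra 1 rfl) (hF.ra 3 rfl)
      (by rw [hF.ra 2 rfl]; simp), by rw [hF.n 2 rfl, h2], ?_⟩
    simpa [h1] using har i (Nat.lt_succ_self i)
  rintro s₁ ⟨hs₁, h2₁, h3₁⟩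
  refine Prog.Runs.seq (Q := fun s₂ => LevelData s₂ t c p n i ∧ s₂.nvar 2 = d ∧
    s₂.nvar 3 = t i ∧ (d ≤ n → ∀ m < d, s₂.rarr 2 (i + 1) m (d - m) =
      enc (batchMin t c p n i d (d - m)))) ?_ ?_
  · refine Prog.Runs.cond (b := .nle (.var 2) (.var 0)) ?_ ?_
    · intro _
      refine (hK₁ t c p n i d s₁ ht hc hp hs₁ h2₁ h3₁).frame.mono (Nat.le_succ _) ?_
      rintro s₂ ⟨hF, hm, hj⟩
      exact ⟨hs₁.of_eq (hF.n 0 rfl) (hF.n 1 rfl) (hF.na 0 rfl) (hF.ra 1 rfl) (hF.ra 3 rfl)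
        (fun m b => hj i m b (by omega)), by rw [hF.n 2 rfl, h2₁], by rw [hF.n 3 rfl, h3₁],
        fun _ => hm⟩
    · intro hb
      refine (Prog.Runs.block (P := .skip) rfl (Q := fun s₂ => s₂ = s₁) fun _ => rfl).mono
        (show Prog.cost .skip ≤ _ from Nat.le_add_left _ _) ?_
      rintro s₂ rfl
      refine ⟨hs₁, h2₁, h3₁, fun h => absurd ?_ hb⟩
      simpa [h2₁, hs₁.n_eq] using h
  rintro s₂ ⟨hs₂, h2₂, h3₂, hm⟩
  refine (hK₂ t c p n i d s₂ ht hc hp hs₂ h2₂ h3₂).mono le_rfl ?_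
  rintro s₃ ⟨hfin, hj⟩ m b hv rfl
  rw [OPT_succ ht hc hp hv]
  rcases hv with hv | hv
  · rw [hj _ _ _ (by omega)]
    have := hm hv.2 m (by omega)
    rwa [Nat.add_sub_cancel_left] at this
  · obtain rfl := hv.1
    exact hfin

end

/-! ### Programs for one level and for the whole table -/

theorem tailSum_eq_add (p : ℕ → ℝ) {n m : ℕ} (h : m < n) :
    tailSum p n m = tailSum p n (m + 1) + p m := by
  rw [tailSum, Finset.sum_eq_sum_Ico_succ_bot h, add_comm]
  rfl

/-- Compute `W_0, …, W_n`. -/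
def tailsInit : Prog := .seq (.nset 7 (.lit 0)) (.rput 3 (.var 0) (.lit 0) (.lit 0) (.lit 0))

def tailsBody : Prog :=
  .rput 3 (.sub (.var 0) (.add (.var 7) (.lit 1))) (.lit 0) (.lit 0)
    (.add (.get 3 (.sub (.var 0) (.var 7)) (.lit 0) (.lit 0))
      (.get 0 (.sub (.var 0) (.add (.var 7) (.lit 1))) (.lit 0) (.lit 0)))

def tailsProg : Prog := .seq tailsInit (.upto 7 (.var 0) tailsBody)

theorem tailsProg_runs (p : ℕ → ℝ) {n : ℕ} {s : Store} (h0 : s.nvar 0 = n)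
    (hw : s.HasWeights fun k : Fin n => p k) :
    tailsProg.Runs s (tailsInit.cost + (n + 1) * (tailsBody.cost + 8)) fun s₁ =>
      s₁.HasTails p n := by
  refine Prog.Runs.seq (Prog.Runs.block (P := tailsInit) rfl (Q := fun s₁ => Frame tailsInit s s₁ ∧
    s₁.nvar 7 = 0 ∧ s₁.rarr 3 n 0 0 = 0) fun hF => ⟨hF, ?_⟩) ?_
  · simp [tailsInit, putCell, h0]
  rintro s₀ ⟨hF₀, h7, h3⟩
  refine (Prog.Runs.upto (B := tailsBody.cost) (fun k s₁ => ∀ m, n ≤ m + k → m ≤ n →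
    s₁.rarr 3 m 0 0 = tailSum p n m) 0 n h7 (Nat.zero_le n) rfl ?_ ?_ ?_).mono le_rfl ?_
  · intro m h1 h2
    obtain rfl : m = n := by omega
    rw [h3, tailSum_of_le le_rfl]
  · intro k s₁ hF _
    rw [NExp.eval, hF.n 0 rfl, hF₀.n 0 rfl, h0]
  · intro k s₁ _ hk hF h7 hI
    have e0 : s₁.nvar 0 = n := by rw [hF.n 0 rfl, hF₀.n 0 rfl, h0]
    refine Prog.Runs.block rfl fun _ m h1 h2 => ?_
    by_cases hm : m = n - (k + 1)
    · have hmn : m < n := by omega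
      have e1 : s₁.rarr 0 m 0 0 = p m := by
        rw [hF.ra 0 rfl, hF₀.ra 0 rfl]
        exact hw ⟨m, hmn⟩
      have e2 := hI (m + 1) (by omega) hmn
      rw [tailSum_eq_add p hmn, ← e1, ← e2]
      simp [tailsBody, putCell, e0, h7, ← hm, show n - k = m + 1 by omega]
    · rw [← hI m (by omega) h2]
      simp [tailsBody, putCell, e0, h7, hm]
  · rintro s₁ ⟨-, -, hI⟩ m hm
    exact hI m (by omega) hm

/-- Compute the entries with `b > 0` on level `i + 1`. -/
def innerProg : Prog :=
  .seq (.nset 2 (.lit 1)) (.upto 2 (.add (.var 0) (.lit 1)) fillProg)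

theorem innerProg_runs : ∃ K : ℕ, ∀ (t : ℕ → ℕ) (c p : ℕ → ℝ) (n i : ℕ) (s : Store),
    (∀ j, 2 ≤ t j) → (∀ j, 0 ≤ c j) → SortedWeights n p → LevelData s t c p n i →
    s.nvar 3 = t i →
    innerProg.Runs s (K * (n + 1) ^ 2) fun s₁ =>
      (∀ m b, 0 < b → m + b ≤ n →
        s₁.rarr 2 (i + 1) m b = enc (batchMin t c p n i (m + b) b)) ∧
      ∀ j m b, j ≠ i + 1 → s₁.rarr 2 j m b = s.rarr 2 j m b := by
  obtain ⟨K₁, hK₁⟩ := fillProg_runs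
  refine ⟨2 + (K₁ + 10), ?_⟩
  intro t c p n i s ht hc hp hs h3
  refine Prog.Runs.mono (T := 2 + (n + 1 - 1 + 1) * (K₁ * (n + 1) + 3 + 7)) ?_
    (by rw [Nat.add_sub_cancel]; nlinarith [Nat.zero_le n]) fun _ h => h
  refine Prog.Runs.seq (Prog.Runs.block (P := .nset 2 (.lit 1)) rfl (Q := fun s₁ =>
    Frame (.nset 2 (.lit 1)) s s₁ ∧ s₁.nvar 2 = 1) fun hF => ⟨hF, by simp⟩) ?_
  rintro s₀ ⟨hF₀, h2⟩
  refine (Prog.Runs.upto (B := K₁ * (n + 1)) (fun k s₁ =>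
    (∀ m b, 0 < b → m + b < k →
      s₁.rarr 2 (i + 1) m b = enc (batchMin t c p n i (m + b) b)) ∧
    ∀ j m b, j ≠ i + 1 → s₁.rarr 2 j m b = s.rarr 2 j m b) 1 (n + 1) h2 (by omega) rfl
    ?_ ?_ ?_).mono le_rfl ?_
  · exact ⟨fun m b h1 h2 => by omega, fun j m b _ => by rw [hF₀.ra 2 rfl]⟩
  · intro k s₁ hF _
    rw [NExp.eval, NExp.eval, NExp.eval, hF.n 0 rfl, hF₀.n 0 rfl, hs.n_eq]
  · rintro k s₁ h1k hk hF h2 ⟨hI, hJ⟩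
    have hs₁ : LevelData s₁ t c p n i := hs.of_eq (by rw [hF.n 0 rfl, hF₀.n 0 rfl])
      (by rw [hF.n 1 rfl, hF₀.n 1 rfl]) (by rw [hF.na 0 rfl, hF₀.na 0 rfl])
      (by rw [hF.ra 1 rfl, hF₀.ra 1 rfl]) (by rw [hF.ra 3 rfl, hF₀.ra 3 rfl])
      (fun m b => hJ i m b (by omega))
    refine (hK₁ t c p n i k s₁ ht hc hp hs₁ h2 (by rw [hF.n 3 rfl, hF₀.n 3 rfl, h3])).mono
      (Nat.mul_le_mul_left _ (by omega)) ?_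
    rintro s₂ ⟨hm, hj⟩
    refine ⟨fun m b hb hmb => ?_, fun j m b hji => ?_⟩
    · rw [Store.setN_rarr]
      by_cases hmk : m + b = k
      · have := hm m (by omega)
        rw [show k - m = b by omega] at this
        rw [this, hmk]
      · rw [hj _ _ _ (by omega)]
        exact hI m b hb (by omega)
    · rw [Store.setN_rarr, hj _ _ _ (by tauto), hJ j m b hji]
  · rintro s₁ ⟨-, -, hI, hJ⟩
    exact ⟨fun m b h1 h2 => hI m b h1 (by omega), hJ⟩

/-- Compute the entries with `b = 0` on level `i + 1`. -/
def bottomInit : Prog := .cond (.nle (.var 0) (.var 3)) (.nset 2 (.var 3)) (.nset 2 (.var 0))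

def bottomProg : Prog := .seq bottomInit (.upto 2 (.add (.var 0) (.var 3)) finalProg)

/-- There are `n + t i - max n (t i)`, that is, `min n (t i)` batches. Each d is below `n + t i`, so
its quotient by `t i` is at most n. Hence O(n ^ 2), independently of `t i`. -/
theorem bottomProg_runs : ∃ K : ℕ, ∀ (t : ℕ → ℕ) (c p : ℕ → ℝ) (n i : ℕ) (s : Store),
    (∀ j, 2 ≤ t j) → (∀ j, 0 ≤ c j) → SortedWeights n p → LevelData s t c p n i →
    s.nvar 3 = t i → 1 ≤ n →
    bottomProg.Runs s (K * (n + 1) ^ 2) fun s₁ =>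
      (∀ m, max n (t i) ≤ m → m < n + t i →
        s₁.rarr 2 (i + 1) m 0 = enc (batchMin t c p n i m 0)) ∧
      ∀ j m b, ¬ (j = i + 1 ∧ b = 0) → s₁.rarr 2 j m b = s.rarr 2 j m b := by
  obtain ⟨K₂, hK₂⟩ := finalProg_runs
  refine ⟨bottomInit.cost + (K₂ + 10), ?_⟩
  intro t c p n i s ht hc hp hs h3 hn
  have ht0 := ht i
  refine Prog.Runs.mono
    (T := bottomInit.cost + (n + t i - max n (t i) + 1) * (K₂ * (n + 1) + 3 + 7)) ?_ ?_ fun _ h => h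
  swap
  · have : (n + t i - max n (t i) + 1) * (K₂ * (n + 1) + 3 + 7) ≤
        (n + 1) * (K₂ * (n + 1) + 3 + 7) := Nat.mul_le_mul_right _ (by omega)
    nlinarith [Nat.zero_le n, Nat.zero_le (bottomInit.cost * n ^ 2),
      Nat.zero_le (bottomInit.cost * n)]
  refine Prog.Runs.seq (Prog.Runs.block (P := bottomInit) rfl (Q := fun s₁ =>
    Frame bottomInit s s₁ ∧ s₁.nvar 2 = max n (t i)) fun hF => ⟨hF, ?_⟩) ?_
  · by_cases hnt : n ≤ t i
    · simp [bottomInit, hs.n_eq, h3, hnt]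
    · simp [bottomInit, hs.n_eq, h3, hnt]
      omega
  rintro s₀ ⟨hF₀, h2⟩
  refine (Prog.Runs.upto (B := K₂ * (n + 1)) (fun k s₁ =>
    (∀ m, max n (t i) ≤ m → m < k →
      s₁.rarr 2 (i + 1) m 0 = enc (batchMin t c p n i m 0)) ∧
    ∀ j m b, ¬ (j = i + 1 ∧ b = 0) → s₁.rarr 2 j m b = s.rarr 2 j m b) (max n (t i)) (n + t i) h2
    (by omega) rfl ?_ ?_ ?_).mono le_rfl ?_
  · exact ⟨fun m h1 h2 => by omega, fun j m b _ => by rw [hF₀.ra 2 rfl]⟩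
  · intro k s₁ hF _
    rw [NExp.eval, NExp.eval, NExp.eval, hF.n 0 rfl, hF₀.n 0 rfl, hs.n_eq, hF.n 3 rfl,
      hF₀.n 3 rfl, h3]
  · rintro k s₁ h1k hk hF h2 ⟨hI, hJ⟩
    have hs₁ : LevelData s₁ t c p n i := hs.of_eq (by rw [hF.n 0 rfl, hF₀.n 0 rfl])
      (by rw [hF.n 1 rfl, hF₀.n 1 rfl]) (by rw [hF.na 0 rfl, hF₀.na 0 rfl])
      (by rw [hF.ra 1 rfl, hF₀.ra 1 rfl]) (by rw [hF.ra 3 rfl, hF₀.ra 3 rfl])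
      (fun m b => hJ i m b (by omega))
    have hkt : k / t i < n + 1 := by
      rw [Nat.div_lt_iff_lt_mul (by omega)]
      nlinarith
    refine (hK₂ t c p n i k s₁ ht hc hp hs₁ h2 (by rw [hF.n 3 rfl, hF₀.n 3 rfl, h3])).mono
      (Nat.mul_le_mul_left _ hkt) ?_
    rintro s₂ ⟨hm, hj⟩
    refine ⟨fun m hm1 hm2 => ?_, fun j m b hji => ?_⟩
    · rw [Store.setN_rarr]
      by_cases hmk : m = k
      · rw [hmk, hm]
      · rw [hj _ _ _ (by omega)]
        exact hI m hm1 (by omega)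
    · rw [Store.setN_rarr, hj _ _ _ (by tauto), hJ j m b hji]
  · rintro s₁ ⟨-, -, hI, hJ⟩
    exact ⟨hI, hJ⟩

def levelProg : Prog :=
  .seq tailsProg (.seq (.nset 3 (.get 0 (.var 1) (.lit 0) (.lit 0))) (.seq innerProg bottomProg))

theorem levelProg_runs : ∃ K : ℕ, ∀ (t : ℕ → ℕ) (c p : ℕ → ℝ) (n i : ℕ) (s : Store),
    (∀ j, 2 ≤ t j) → (∀ j, 0 ≤ c j) → 1 ≤ n → SortedWeights n p →
    s.nvar 0 = n → s.nvar 1 = i → s.HasArities t (i + 1) → s.HasLengths c (i + 1) →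
    s.HasWeights (fun k : Fin n => p k) → s.HasLevel t c p n i →
    levelProg.Runs s (K * n ^ 2) fun s₁ => s₁.HasLevel t c p n (i + 1) ∧
      ∀ j m b, j ≠ i + 1 → s₁.rarr 2 j m b = s.rarr 2 j m b := by
  obtain ⟨K₁, hK₁⟩ := innerProg_runs
  obtain ⟨K₂, hK₂⟩ := bottomProg_runs
  refine ⟨tailsInit.cost + 2 * (tailsBody.cost + 8) + (5 + (4 * K₁ + 4 * K₂)), ?_⟩
  intro t c p n i s ht hc hn hp h0 h1 har hlen hw hlev
  refine Prog.Runs.mono (T := (tailsInit.cost + (n + 1) * (tailsBody.cost + 8)) +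
    (5 + (K₁ * (n + 1) ^ 2 + K₂ * (n + 1) ^ 2))) ?_ ?_ fun _ h => h
  swap
  · have e1 : 1 ≤ n ^ 2 := Nat.one_le_pow _ _ hn
    have e2 : n + 1 ≤ 2 * n ^ 2 := by nlinarith
    have e3 : (n + 1) ^ 2 ≤ 4 * n ^ 2 := by nlinarith
    have e4 := Nat.mul_le_mul_left K₁ e3
    have e5 := Nat.mul_le_mul_left K₂ e3
    have e6 := Nat.mul_le_mul_right (tailsBody.cost + 8) e2
    have e7 := Nat.mul_le_mul_left tailsInit.cost e1
    nlinarith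
  refine Prog.Runs.seq (tailsProg_runs p h0 hw).frame ?_
  rintro s₁ ⟨hF₁, htl⟩
  refine Prog.Runs.seq (Prog.Runs.block (P := .nset 3 (.get 0 (.var 1) (.lit 0) (.lit 0))) rfl
    (Q := fun s₂ => LevelData s₂ t c p n i ∧ s₂.nvar 3 = t i ∧ s₂.rarr 2 = s.rarr 2) ?_) ?_
  · intro hF
    refine ⟨⟨by rw [hF.n 0 rfl, hF₁.n 0 rfl, h0], by rw [hF.n 1 rfl, hF₁.n 1 rfl, h1],
      fun j hj => ?_, fun j hj => ?_, fun m hm => ?_, fun m b hv => ?_⟩, ?_, ?_⟩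
    · rw [hF.na 0 rfl, hF₁.na 0 rfl]
      exact har j hj
    · rw [hF.ra 1 rfl, hF₁.ra 1 rfl]
      exact hlen j hj
    · rw [hF.ra 3 rfl]
      exact htl m hm
    · rw [hF.ra 2 rfl, hF₁.ra 2 rfl]
      exact hlev m b hv
    · simpa [hF₁.n 1 rfl, h1, hF₁.na 0 rfl] using har i (Nat.lt_succ_self i)
    · rw [hF.ra 2 rfl, hF₁.ra 2 rfl]
  rintro s₂ ⟨hs₂, h3, hr2⟩
  refine Prog.Runs.seq (hK₁ t c p n i s₂ ht hc hp hs₂ h3).frame ?_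
  rintro s₃ ⟨hF₃, hI, hJ⟩
  have hs₃ : LevelData s₃ t c p n i := hs₂.of_eq (hF₃.n 0 rfl) (hF₃.n 1 rfl) (hF₃.na 0 rfl)
    (hF₃.ra 1 rfl) (hF₃.ra 3 rfl) (fun m b => hJ i m b (by omega))
  refine (hK₂ t c p n i s₃ ht hc hp hs₃ (by rw [hF₃.n 3 rfl, h3]) hn).mono le_rfl ?_
  rintro s₄ ⟨hI', hJ'⟩
  refine ⟨fun m b hv => ?_, fun j m b hj => ?_⟩
  · rw [OPT_succ ht hc hp hv]
    have := ht i
    rcases hv with hv | ⟨rfl, -, h1, h2⟩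
    · rw [hJ' _ _ _ (by omega)]
      exact hI m b hv.1 hv.2
    · rw [Nat.add_sub_cancel] at h1 h2
      exact hI' m h1 (by omega)
  · rw [hJ' _ _ _ (by tauto), hJ _ _ _ hj, hr2]

theorem levelProg_solves : ∃ K : ℕ, ∀ (t : ℕ → ℕ) (c p : ℕ → ℝ) (n i : ℕ),
    (∀ j, 2 ≤ t j) → (∀ j, 0 ≤ c j) → 1 ≤ n → SortedWeights n p →
    levelProg.Solves (K * n ^ 2)
      (fun s => s.nvar 0 = n ∧ s.nvar 1 = i ∧ s.HasArities t (i + 1) ∧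
        s.HasLengths c (i + 1) ∧ s.HasWeights (fun k : Fin n => p k) ∧ s.HasLevel t c p n i)
      (fun s => s.HasLevel t c p n (i + 1)) := by
  obtain ⟨K, hK⟩ := levelProg_runs
  refine ⟨K, ?_⟩
  rintro t c p n i ht hc hn hp s ⟨h0, h1, h2, h3, h4, h5⟩
  exact (hK t c p n i s ht hc hn hp h0 h1 h2 h3 h4 h5).mono le_rfl fun _ h => h.1

/-- Write the entries of level `0`. -/
def clearRow : Prog := .rput 2 (.lit 0) (.var 1) (.var 2) (.sub (.lit 0) (.lit 1))

def clearProg : Prog :=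
  .seq (.nset 2 (.lit 0)) (.upto 2 (.add (.var 0) (.lit 1)) clearRow)

def zeroLevel : Prog :=
  .seq (.nset 1 (.lit 0)) (.seq (.upto 1 (.add (.var 0) (.lit 1)) clearProg)
    (.rput 2 (.lit 0) (.lit 0) (.lit 1) (.lit 0)))

theorem zeroLevel_runs {n : ℕ} {s : Store} (h0 : s.nvar 0 = n) :
    zeroLevel.Runs s (2 + ((n + 2) * (2 + (n + 2) * (clearRow.cost + 10) + 10) + 5)) fun s₁ =>
      ∀ m b, m ≤ n → b ≤ n → s₁.rarr 2 0 m b = if m = 0 ∧ b = 1 then 0 else -1 := by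
  refine Prog.Runs.seq (Prog.Runs.block (P := .nset 1 (.lit 0)) rfl (Q := fun s₁ =>
    Frame (.nset 1 (.lit 0)) s s₁ ∧ s₁.nvar 1 = 0) fun hF => ⟨hF, by simp⟩) ?_
  rintro s₀ ⟨hF₀, h1⟩
  refine Prog.Runs.seq (Prog.Runs.upto (B := 2 + (n + 2) * (clearRow.cost + 10)) (fun k s₁ =>
    ∀ m b, m < k → b ≤ n → s₁.rarr 2 0 m b = -1) 0 (n + 1) h1 (by omega) rfl (by simp) ?_ ?_) ?_
  · intro k s₁ hF _
    rw [NExp.eval, NExp.eval, NExp.eval, hF.n 0 rfl, hF₀.n 0 rfl, h0]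
  · intro k s₁ _ hk hF hk1 hI
    refine Prog.Runs.seq (Prog.Runs.block (P := .nset 2 (.lit 0)) rfl (Q := fun s₂ =>
      Frame (.nset 2 (.lit 0)) s₁ s₂ ∧ s₂.nvar 2 = 0) fun hF => ⟨hF, by simp⟩) ?_
    rintro s₂ ⟨hF₂, h2⟩
    refine (Prog.Runs.upto (B := clearRow.cost) (fun l s₃ =>
      ∀ m b, (m < k ∧ b ≤ n) ∨ (m = k ∧ b < l) → s₃.rarr 2 0 m b = -1) 0 (n + 1) h2 (by omega) rfl
      ?_ ?_ ?_).mono le_rfl ?_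
    · intro m b h
      rw [hF₂.ra 2 rfl]
      exact hI m b (by omega) (by omega)
    · intro l s₃ hF₃ _
      rw [NExp.eval, NExp.eval, NExp.eval, hF₃.n 0 rfl, hF₂.n 0 rfl, hF.n 0 rfl, hF₀.n 0 rfl, h0]
    · intro l s₃ _ hl hF₃ hl2 hI'
      have e1 : s₃.nvar 1 = k := by rw [hF₃.n 1 rfl, hF₂.n 1 rfl, hk1]
      refine Prog.Runs.block rfl fun _ m b h => ?_
      by_cases hmb : m = k ∧ b = l
      · simp [clearRow, putCell, e1, hl2, hmb]
      · simp [clearRow, putCell, e1, hl2, hmb]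
        exact hI' m b (by omega)
    · rintro s₃ ⟨-, -, hI'⟩ m b hm hb
      exact hI' m b (by omega)
  · rintro s₁ ⟨-, -, hI⟩
    refine Prog.Runs.block rfl fun _ m b hm hb => ?_
    simp [putCell]
    rw [hI m b (by omega) hb]

def tableProg : Prog := .seq zeroLevel (.seq (.nset 1 (.lit 0)) (.upto 1 (.var 0) levelProg))

theorem tableProg_runs : ∃ K : ℕ, ∀ (t : ℕ → ℕ) (c p : ℕ → ℝ) (n : ℕ) (s : Store),
    (∀ j, 2 ≤ t j) → (∀ j, 0 ≤ c j) → 1 ≤ n → SortedWeights n p →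
    s.nvar 0 = n → s.HasArities t n → s.HasLengths c n → s.HasWeights (fun k : Fin n => p k) →
    tableProg.Runs s (K * n ^ 3) fun s₁ => ∀ i ≤ n, s₁.HasLevel t c p n i := by
  obtain ⟨K, hK⟩ := levelProg_runs
  refine ⟨2 + (3 * (2 + 3 * (clearRow.cost + 10) + 10) + 5) + (2 + 2 * (K + 8)), ?_⟩
  intro t c p n s ht hc hn hp h0 har hlen hw
  refine Prog.Runs.mono (T := (2 + ((n + 2) * (2 + (n + 2) * (clearRow.cost + 10) + 10) + 5)) +
    (2 + (n - 0 + 1) * (K * n ^ 2 + 1 + 7))) ?_ ?_ fun _ h => h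
  swap
  · have e1 : 1 ≤ n ^ 3 := Nat.one_le_pow _ _ hn
    have e2 : n ^ 2 ≤ n ^ 3 := Nat.pow_le_pow_right hn (by norm_num)
    have e3 : n ≤ n ^ 2 := by nlinarith
    have e4 : n + 2 ≤ 3 * n := by omega
    have e5 : (n + 2) * (2 + (n + 2) * (clearRow.cost + 10) + 10) ≤
        3 * (2 + 3 * (clearRow.cost + 10) + 10) * n ^ 3 := by
      calc (n + 2) * (2 + (n + 2) * (clearRow.cost + 10) + 10)
          ≤ (3 * n) * (2 * n + (3 * n) * (clearRow.cost + 10) + 10 * n) := by gcongr <;> omega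
        _ = 3 * (2 + 3 * (clearRow.cost + 10) + 10) * n ^ 2 := by ring
        _ ≤ _ := by gcongr
    have e6 : (n + 1) * (K * n ^ 2 + 1 + 7) ≤ 2 * (K + 8) * n ^ 3 := by
      calc (n + 1) * (K * n ^ 2 + 1 + 7) ≤ (2 * n) * (K * n ^ 2 + 8 * n ^ 2) :=
            Nat.mul_le_mul (by omega) (by linarith)
        _ = _ := by ring
    rw [Nat.sub_zero]
    nlinarith
  refine Prog.Runs.seq (zeroLevel_runs h0).frame ?_
  rintro s₁ ⟨hF₁, hz⟩
  refine Prog.Runs.seq (Prog.Runs.block (P := .nset 1 (.lit 0)) rfl (Q := fun s₂ =>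
    Frame (.nset 1 (.lit 0)) s₁ s₂ ∧ s₂.nvar 1 = 0) fun hF => ⟨hF, by simp⟩) ?_
  rintro s₂ ⟨hF₂, h1⟩
  refine (Prog.Runs.upto (B := K * n ^ 2) (fun k s₃ => ∀ i ≤ k, s₃.HasLevel t c p n i) 0 n h1
    (by omega) rfl ?_ ?_ ?_).mono le_rfl fun s₃ h => h.2.2
  · intro i hi m b hv
    obtain rfl : i = 0 := by omega
    have : 0 < b ∧ m + b ≤ n := by
      rcases hv with h | h
      · exact h
      · omega
    rw [hF₂.ra 2 rfl, hz m b (by omega) (by omega), OPT_zero ht hc hp hn]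
    split_ifs <;> rfl
  · intro k s₃ hF _
    rw [NExp.eval, hF.n 0 rfl, hF₂.n 0 rfl, hF₁.n 0 rfl, h0]
  · intro k s₃ _ hk hF hk1 hI
    refine (hK t c p n k s₃ ht hc hn hp (by rw [hF.n 0 rfl, hF₂.n 0 rfl, hF₁.n 0 rfl, h0]) hk1
      (fun j hj => ?_) (fun j hj => ?_) (fun l => ?_) (hI k le_rfl)).mono le_rfl ?_
    · rw [hF.na 0 rfl, hF₂.na 0 rfl, hF₁.na 0 rfl]
      exact har j (by omega)
    · rw [hF.ra 1 rfl, hF₂.ra 1 rfl, hF₁.ra 1 rfl]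
      exact hlen j (by omega)
    · rw [hF.ra 0 rfl, hF₂.ra 0 rfl, hF₁.ra 0 rfl]
      exact hw l
    · rintro s₄ ⟨h1, h2⟩ i hi m b hv
      rw [Store.setN_rarr]
      by_cases hik : i = k + 1
      · subst hik
        exact h1 m b hv
      · rw [h2 _ _ _ hik]
        exact hI i (by omega) m b hv

/-! ### Sorting the weights -/

/-- `for x from e₀ while x < e do P`. -/
def Prog.forTo (x : ℕ) (e₀ e : NExp) (P : Prog) : Prog := .seq (.nset x e₀) (.upto x e P)

theorem Prog.Runs.forTo {x : ℕ} {e₀ e : NExp} {P : Prog} {B : ℕ} (I : ℕ → Store → Prop) (k₀ N : ℕ)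
    {s : Store} (hx : e₀.eval s = k₀) (hk₀ : k₀ ≤ N) (hkeep : P.keepsN x = true)
    (h0 : I k₀ (s.setN x k₀))
    (he : ∀ k s₁, Frame (.forTo x e₀ e P) s s₁ → I k s₁ → e.eval s₁ = N)
    (hstep : ∀ k s₁, k₀ ≤ k → k < N → Frame (.forTo x e₀ e P) s s₁ → s₁.nvar x = k → I k s₁ →
      P.Runs s₁ B (fun s₂ => I (k + 1) (s₂.setN x (k + 1)))) :
    (Prog.forTo x e₀ e P).Runs s (e₀.ops + 1 + (N - k₀ + 1) * (B + e.ops + 7))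
      (fun s₁ => Frame (.forTo x e₀ e P) s s₁ ∧ I N s₁) := by
  refine Prog.Runs.mono (Q := fun s₁ => Frame (.forTo x e₀ e P) s s₁ ∧
    Frame (.forTo x e₀ e P) s s₁ ∧ I N s₁) (Prog.Runs.frame ?_) le_rfl fun _ h => h.2
  refine Prog.Runs.seq (Prog.Runs.block (P := .nset x e₀) rfl (Q := fun s₁ =>
    Frame (.nset x e₀) s s₁ ∧ s₁ = s.setN x k₀) fun hF => ⟨hF, ?_⟩) ?_
  · simp [Store.setN, hx]
  rintro s₁ ⟨hF, rfl⟩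
  have hF' : ∀ s₂, Frame (.upto x e P) (s.setN x k₀) s₂ → Frame (.forTo x e₀ e P) s s₂ :=
    fun s₂ h => (hF.seq_left).trans h.seq_right
  refine (Prog.Runs.upto I k₀ N (by simp) hk₀ hkeep h0 (fun k s₂ h => he k s₂ (hF' _ h))
    fun k s₂ h1 h2 h3 => hstep k s₂ h1 h2 (hF' _ h3)).mono le_rfl ?_
  rintro s₂ ⟨h, -, hI⟩
  exact ⟨hF' _ h, hI⟩

/-- Weight `l` comes before weight `k` in non-increasing order. -/
def Beats {n : ℕ} (p : Fin n → ℝ) (l k : Fin n) : Prop := p k < p l ∨ (p k ≤ p l ∧ l < k)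

theorem Beats.trans {n : ℕ} {p : Fin n → ℝ} {a b c : Fin n} (h : Beats p a b) (h' : Beats p b c) :
    Beats p a c := by
  rcases h with h | ⟨h, h1⟩ <;> rcases h' with h' | ⟨h', h1'⟩
  · exact Or.inl (h'.trans h)
  · exact Or.inl (h'.trans_lt h)
  · exact Or.inl (h'.trans_le h)
  · exact Or.inr ⟨h'.trans h, h1.trans h1'⟩

theorem not_beats_self {n : ℕ} (p : Fin n → ℝ) (a : Fin n) : ¬ Beats p a a := by
  simp [Beats]

theorem beats_or_beats {n : ℕ} (p : Fin n → ℝ) {a b : Fin n} (h : a ≠ b) :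
    Beats p a b ∨ Beats p b a := by
  rcases lt_trichotomy (p a) (p b) with h1 | h1 | h1
  · exact Or.inr (Or.inl h1)
  · rcases lt_or_gt_of_ne h with h2 | h2
    · exact Or.inl (Or.inr ⟨h1.ge, h2⟩)
    · exact Or.inr (Or.inr ⟨h1.le, h2⟩)
  · exact Or.inl (Or.inl h1)

open Classical in
/-- The position of weight `k` in non-increasing order. -/
noncomputable def rank {n : ℕ} (p : Fin n → ℝ) (k : Fin n) : ℕ :=
  (Finset.univ.filter fun l => Beats p l k).card

theorem rank_lt {n : ℕ} (p : Fin n → ℝ) (k : Fin n) : rank p k < n := by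
  classical
  have : (Finset.univ.filter fun l => Beats p l k).card < (Finset.univ : Finset (Fin n)).card := by
    apply Finset.card_lt_card
    rw [Finset.filter_ssubset]
    exact ⟨k, Finset.mem_univ k, not_beats_self p k⟩
  simpa [rank] using this

theorem Beats.rank_lt_rank {n : ℕ} {p : Fin n → ℝ} {l k : Fin n} (h : Beats p l k) :
    rank p l < rank p k := by
  classical
  apply Finset.card_lt_card
  rw [Finset.ssubset_iff_of_subset]
  · exact ⟨l, by simpa using h, by simpa using not_beats_self p l⟩
  · intro a
    simp only [Finset.mem_filter, Finset.mem_univ, true_and]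
    exact fun ha => ha.trans h

/-- Breaking ties by index makes `Beats` a strict total order, so ranks are distinct. -/
theorem rank_injective {n : ℕ} (p : Fin n → ℝ) : Function.Injective (rank p) := by
  intro a b h
  by_contra hab
  rcases beats_or_beats p hab with h' | h'
  · exact h.not_lt h'.rank_lt_rank
  · exact h.symm.not_lt h'.rank_lt_rank

/-- The permutation that sorts the weights. -/
noncomputable def rankPerm {n : ℕ} (p : Fin n → ℝ) : Equiv.Perm (Fin n) :=
  Equiv.ofBijective (fun k => ⟨rank p k, rank_lt p k⟩)
    (Finite.injective_iff_bijective.1 fun _ _ h => rank_injective p (Fin.ext_iff.1 h))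

@[simp] theorem rankPerm_val {n : ℕ} (p : Fin n → ℝ) (k : Fin n) :
    ((rankPerm p k : Fin n) : ℕ) = rank p k := rfl

/-- The weights in non-increasing order, padded with zeros. -/
noncomputable def sortedWeights {n : ℕ} (p : Fin n → ℝ) (r : ℕ) : ℝ :=
  if h : r < n then p ((rankPerm p).symm ⟨r, h⟩) else 0

theorem sortedWeights_rank {n : ℕ} (p : Fin n → ℝ) (k : Fin n) :
    sortedWeights p (rank p k) = p k := by
  rw [sortedWeights, dif_pos (rank_lt p k)]
  congr 1
  rw [Equiv.symm_apply_eq]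
  rfl

theorem sortedWeights_spec {n : ℕ} {p : Fin n → ℝ} (hp : ∀ k, 0 ≤ p k) :
    SortedWeights n (sortedWeights p) := by
  refine ⟨fun a b hab => ?_, fun k => ?_, fun k hk => dif_neg (by omega)⟩
  · rw [sortedWeights, sortedWeights]
    split_ifs with h1 h2 h2
    · by_contra hlt
      have h3 : Beats p ((rankPerm p).symm ⟨b, h1⟩) ((rankPerm p).symm ⟨a, h2⟩) :=
        Or.inl (not_le.1 hlt)
      have h4 := h3.rank_lt_rank
      rw [← rankPerm_val, ← rankPerm_val, Equiv.apply_symm_apply, Equiv.apply_symm_apply] at h4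
      exact absurd h4 (by simpa using hab)
    · omega
    · exact hp _
    · exact le_rfl
  · rw [sortedWeights]
    split_ifs
    · exact hp _
    · exact le_rfl

def rankCell : Prog :=
  .cond (.conj (.rle (.get 0 (.var 9) (.lit 0) (.lit 0)) (.get 0 (.var 8) (.lit 0) (.lit 0)))
      (.neg (.conj (.rle (.get 0 (.var 8) (.lit 0) (.lit 0)) (.get 0 (.var 9) (.lit 0) (.lit 0)))
        (.nle (.add (.var 9) (.lit 1)) (.var 8)))))
    .skip (.nset 10 (.add (.var 10) (.lit 1)))

def rankStore : Prog :=
  .seq (.nput 3 (.var 8) (.lit 0) (.lit 0) (.var 10))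
    (.rput 4 (.var 10) (.lit 0) (.lit 0) (.get 0 (.var 8) (.lit 0) (.lit 0)))

def rankRow : Prog :=
  .seq (.nset 10 (.lit 0)) (.seq (.forTo 9 (.lit 0) (.var 0) rankCell) rankStore)

def copyCell : Prog :=
  .rput 0 (.var 8) (.lit 0) (.lit 0) (.get 4 (.var 8) (.lit 0) (.lit 0))

/-- The sorted weights are collected in real array 4 and copied back only afterwards, since
computing the ranks keeps reading array 0. Natural array 3 retains the ranks for the output. -/
def sortProg : Prog :=
  .seq (.forTo 8 (.lit 0) (.var 0) rankRow) (.forTo 8 (.lit 0) (.var 0) copyCell)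

theorem rankRow_runs {n : ℕ} (p : Fin n → ℝ) {s : Store} (h0 : s.nvar 0 = n)
    (hw : s.HasWeights p) (k : Fin n) (h8 : s.nvar 8 = k) :
    rankRow.Runs s (2 + ((1 + 1 + (n + 1) * (rankCell.cost + 8)) + rankStore.cost)) fun s₁ =>
      s₁.narr 3 = Function.update (s.narr 3) k (fun x y => if x = 0 ∧ y = 0 then rank p k else
        s.narr 3 k x y) ∧
      s₁.rarr 4 = Function.update (s.rarr 4) (rank p k) (fun x y => if x = 0 ∧ y = 0 then p k else
        s.rarr 4 (rank p k) x y) := by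
  classical
  refine Prog.Runs.seq (Prog.Runs.block (P := .nset 10 (.lit 0)) rfl (Q := fun s₁ =>
    Frame (.nset 10 (.lit 0)) s s₁ ∧ s₁.nvar 10 = 0) fun hF => ⟨hF, by simp⟩) ?_
  rintro s₁ ⟨hF₁, h10⟩
  refine Prog.Runs.seq (Prog.Runs.forTo (B := rankCell.cost) (fun l s₂ => s₂.nvar 10 =
    (Finset.univ.filter fun a : Fin n => (a : ℕ) < l ∧ Beats p a k).card) 0 n rfl (Nat.zero_le n)
    rfl (by simpa using h10) ?_ ?_) ?_
  · intro l s₂ hF _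
    rw [NExp.eval, hF.n 0 rfl, hF₁.n 0 rfl, h0]
  · intro l s₂ _ hl hF h9 hI
    have e8 : s₂.nvar 8 = k := by rw [hF.n 8 rfl, hF₁.n 8 rfl, h8]
    have ek : s₂.rarr 0 k 0 0 = p k := by rw [hF.ra 0 rfl, hF₁.ra 0 rfl, hw k]
    have el : s₂.rarr 0 l 0 0 = p ⟨l, hl⟩ := by
      rw [hF.ra 0 rfl, hF₁.ra 0 rfl]
      exact hw ⟨l, hl⟩
    refine Prog.Runs.block rfl fun _ => ?_
    by_cases hb : Beats p ⟨l, hl⟩ k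
    · have hset : (Finset.univ.filter fun a : Fin n => (a : ℕ) < l + 1 ∧ Beats p a k) =
          insert ⟨l, hl⟩ (Finset.univ.filter fun a : Fin n => (a : ℕ) < l ∧ Beats p a k) := by
        ext a
        simp only [Finset.mem_filter, Finset.mem_univ, true_and, Finset.mem_insert, Fin.ext_iff]
        constructor
        · rintro ⟨h1, h2⟩
          rcases Nat.lt_succ_iff_lt_or_eq.1 h1 with h1 | h1
          · exact Or.inr ⟨h1, h2⟩
          · exact Or.inl h1
        · rintro (h1 | ⟨h1, h2⟩)
          · obtain rfl : a = ⟨l, hl⟩ := Fin.ext h1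
            exact ⟨Nat.lt_succ_self _, hb⟩
          · exact ⟨by omega, h2⟩
      rw [hset, Finset.card_insert_of_notMem (by simp), ← hI]
      have hc : ¬ (p ⟨l, hl⟩ ≤ p k ∧ (p k ≤ p ⟨l, hl⟩ → (k : ℕ) ≤ l)) := by
        rintro ⟨h1, h2⟩
        rcases hb with hb | ⟨hb, hb'⟩
        · exact absurd h1 (not_le.2 hb)
        · exact absurd (h2 hb) (not_le.2 hb')
      simp [rankCell, e8, h9, ek, el, hc]
    · have hset : (Finset.univ.filter fun a : Fin n => (a : ℕ) < l + 1 ∧ Beats p a k) =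
          (Finset.univ.filter fun a : Fin n => (a : ℕ) < l ∧ Beats p a k) := by
        ext a
        simp only [Finset.mem_filter, Finset.mem_univ, true_and]
        constructor
        · rintro ⟨h1, h2⟩
          rcases Nat.lt_succ_iff_lt_or_eq.1 h1 with h1 | h1
          · exact ⟨h1, h2⟩
          · obtain rfl : a = ⟨l, hl⟩ := Fin.ext h1
            exact absurd h2 hb
        · rintro ⟨h1, h2⟩
          exact ⟨by omega, h2⟩
      rw [hset, ← hI]
      have hc : p ⟨l, hl⟩ ≤ p k ∧ (p k ≤ p ⟨l, hl⟩ → (k : ℕ) ≤ l) := by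
        constructor
        · by_contra h
          exact hb (Or.inl (not_le.1 h))
        · intro h
          by_contra h'
          exact hb (Or.inr ⟨h, not_le.1 h'⟩)
      simp [rankCell, e8, h9, ek, el, hc.1]
      rw [if_pos hc.2]
  · rintro s₂ ⟨hF, hI⟩
    have e8 : s₂.nvar 8 = k := by rw [hF.n 8 rfl, hF₁.n 8 rfl, h8]
    have ek : s₂.rarr 0 k 0 0 = p k := by rw [hF.ra 0 rfl, hF₁.ra 0 rfl, hw k]
    have e3 : s₂.narr 3 = s.narr 3 := by rw [hF.na 3 rfl, hF₁.na 3 rfl]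
    have e4 : s₂.rarr 4 = s.rarr 4 := by rw [hF.ra 4 rfl, hF₁.ra 4 rfl]
    have e10 : s₂.nvar 10 = rank p k := by
      rw [hI, rank]
      congr 1
      ext a
      simp
    refine Prog.Runs.block rfl fun _ => ⟨?_, ?_⟩
    · funext a x y
      simp only [rankStore, Prog.run, putCell, NExp.eval, e8, e10, e3, true_and,
        Function.update_apply]
      by_cases ha : a = k <;> simp [ha]
    · funext a x y
      simp only [rankStore, Prog.run, putCell, NExp.eval, RExp.eval, e8, e10, e4, ek, true_and,
        Function.update_apply]
      by_cases ha : a = rank p k <;> simp [ha]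

theorem sortProg_runs : ∃ K : ℕ, ∀ (n : ℕ) (p : Fin n → ℝ) (s : Store), 1 ≤ n →
    s.nvar 0 = n → s.HasWeights p →
    sortProg.Runs s (K * n ^ 3) fun s₁ =>
      s₁.HasWeights (fun k : Fin n => sortedWeights p k) ∧
      ∀ k : Fin n, s₁.narr 3 k 0 0 = rankPerm p k := by
  refine ⟨2 + 2 * ((2 + ((2 + 2 * (rankCell.cost + 8)) + rankStore.cost)) + 8) +
    (2 + 2 * (copyCell.cost + 8)), ?_⟩
  intro n p s hn h0 hw
  refine Prog.Runs.mono (T := (1 + 1 + (n - 0 + 1) *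
    ((2 + ((1 + 1 + (n + 1) * (rankCell.cost + 8)) + rankStore.cost)) + 1 + 7)) +
    (1 + 1 + (n - 0 + 1) * (copyCell.cost + 1 + 7))) ?_ ?_ fun _ h => h
  swap
  · rw [Nat.sub_zero]
    have e1 : 1 ≤ n ^ 3 := Nat.one_le_pow _ _ hn
    have e2 : n ^ 2 ≤ n ^ 3 := Nat.pow_le_pow_right hn (by norm_num)
    have e3 : n ≤ n ^ 2 := by nlinarith
    have e4 : n + 1 ≤ 2 * n := by omega
    generalize rankCell.cost = A
    generalize rankStore.cost = B
    generalize copyCell.cost = C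
    have f1 : (2 + ((1 + 1 + (n + 1) * (A + 8)) + B)) + 1 + 7 ≤
        ((2 + ((2 + 2 * (A + 8)) + B)) + 8) * n := by
      have := Nat.mul_le_mul_right (A + 8) e4
      nlinarith [Nat.mul_le_mul_left B hn]
    have f2 : (n + 1) * ((2 + ((1 + 1 + (n + 1) * (A + 8)) + B)) + 1 + 7) ≤
        2 * ((2 + ((2 + 2 * (A + 8)) + B)) + 8) * n ^ 3 := by
      calc _ ≤ (2 * n) * (((2 + ((2 + 2 * (A + 8)) + B)) + 8) * n) := Nat.mul_le_mul e4 f1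
        _ = 2 * ((2 + ((2 + 2 * (A + 8)) + B)) + 8) * n ^ 2 := by ring
        _ ≤ _ := Nat.mul_le_mul_left _ e2
    have f3 : (n + 1) * (C + 1 + 7) ≤ 2 * (C + 8) * n ^ 3 := by
      calc _ ≤ (2 * n) * (C + 8) := Nat.mul_le_mul e4 le_rfl
        _ = 2 * (C + 8) * n := by ring
        _ ≤ _ := Nat.mul_le_mul_left _ (e3.trans e2)
    nlinarith
  refine Prog.Runs.seq (Prog.Runs.forTo
    (B := 2 + ((1 + 1 + (n + 1) * (rankCell.cost + 8)) + rankStore.cost))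
    (fun l s₁ => ∀ k : Fin n, (k : ℕ) < l → s₁.narr 3 k 0 0 = rank p k ∧
      s₁.rarr 4 (rank p k) 0 0 = p k) 0 n rfl (Nat.zero_le n) rfl (by simp) ?_ ?_) ?_
  · intro l s₁ hF _
    rw [NExp.eval, hF.n 0 rfl, h0]
  · intro l s₁ _ hl hF h8 hI
    refine (rankRow_runs p (by rw [hF.n 0 rfl, h0]) (fun k => by rw [hF.ra 0 rfl]; exact hw k)
      ⟨l, hl⟩ h8).mono le_rfl ?_
    rintro s₂ ⟨h1, h2⟩ k hk
    rw [Store.setN_narr, Store.setN_rarr, h1, h2]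
    rcases Nat.lt_succ_iff_lt_or_eq.1 hk with hk | hk
    · have hne : rank p k ≠ rank p ⟨l, hl⟩ := fun h => by
        have := Fin.ext_iff.1 (rank_injective p h)
        simp at this
        omega
      rw [Function.update_of_ne (by simp; omega), Function.update_of_ne hne]
      exact hI k hk
    · obtain rfl : k = ⟨l, hl⟩ := Fin.ext hk
      simp
  · rintro s₁ ⟨hF₁, hI⟩
    refine (Prog.Runs.forTo (B := copyCell.cost) (fun l s₂ => ∀ k < l,
      s₂.rarr 0 k 0 0 = sortedWeights p k) 0 n rfl (Nat.zero_le n) rfl (by simp) ?_ ?_).mono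
      le_rfl ?_
    · intro l s₂ hF _
      rw [NExp.eval, hF.n 0 rfl, hF₁.n 0 rfl, h0]
    · intro l s₂ _ hl hF h8 hI'
      refine Prog.Runs.block rfl fun _ k hk => ?_
      rcases Nat.lt_succ_iff_lt_or_eq.1 hk with hk | rfl
      · rw [← hI' k hk]
        simp [copyCell, putCell, h8]
        omega
      · have h1 := (hI ((rankPerm p).symm ⟨k, hl⟩) (Fin.is_lt _)).2
        rw [← sortedWeights_rank p, ← rankPerm_val, Equiv.apply_symm_apply] at h1
        simp only at h1
        rw [← h1]
        simp [copyCell, putCell, h8, hF.ra 4 rfl]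
    · rintro s₂ ⟨hF, hI'⟩
      refine ⟨fun k => hI' k k.2, fun k => ?_⟩
      rw [hF.na 3 rfl, (hI k k.2).1]
      rfl

/-! ### Finding the least entry with `b = 0` -/

/-- Among the cells `[i, m, 0]` with `S i m`, the cell given by variables `10` and `11` has the
least entry, which is the value of real variable `2`. -/
def IsBest (t : ℕ → ℕ) (c p : ℕ → ℝ) (n : ℕ) (S : ℕ → ℕ → Prop) (s : Store) : Prop :=
  (s.rvar 2 = -1 ∧ ∀ i m, S i m → OPT t c p n i m 0 = ⊤) ∨
    (0 ≤ s.rvar 2 ∧ S (s.nvar 10) (s.nvar 11) ∧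
      OPT t c p n (s.nvar 10) (s.nvar 11) 0 = (s.rvar 2 : ℝ) ∧
      ∀ i m, S i m → ((s.rvar 2 : ℝ) : WithTop ℝ) ≤ OPT t c p n i m 0)

def bestCell : Prog :=
  .cond (.conj (.rle (.lit 0) (.get 2 (.var 8) (.var 9) (.lit 0)))
      (.neg (.conj (.rle (.lit 0) (.var 2)) (.rle (.var 2) (.get 2 (.var 8) (.var 9) (.lit 0))))))
    (.seq (.rset 2 (.get 2 (.var 8) (.var 9) (.lit 0)))
      (.seq (.nset 10 (.var 8)) (.nset 11 (.var 9)))) .skip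

def bestRowInit : Prog :=
  .nset 3 (.get 0 (.sub (.var 8) (.lit 1)) (.lit 0) (.lit 0))

def bestRowStart : Prog :=
  .cond (.nle (.var 0) (.var 3)) (.nset 4 (.var 3)) (.nset 4 (.var 0))

def bestRow : Prog :=
  .seq (.seq bestRowInit bestRowStart) (.forTo 9 (.var 4) (.add (.var 0) (.var 3)) bestCell)

def bestProg : Prog :=
  .seq (.rset 2 (.sub (.lit 0) (.lit 1)))
    (.forTo 8 (.lit 1) (.add (.var 0) (.lit 1)) bestRow)

section

variable {t : ℕ → ℕ} {c p : ℕ → ℝ} {n : ℕ}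

theorem IsBest.congr {S S' : ℕ → ℕ → Prop} {s s' : Store} (h : IsBest t c p n S s)
    (hS : ∀ i m, S i m ↔ S' i m) (hr : s'.rvar 2 = s.rvar 2) (h10 : s'.nvar 10 = s.nvar 10)
    (h11 : s'.nvar 11 = s.nvar 11) : IsBest t c p n S' s' := by
  obtain rfl : S = S' := by
    funext i m
    exact propext (hS i m)
  simpa only [IsBest, hr, h10, h11] using h

theorem bestCell_run (ht : ∀ j, 2 ≤ t j) (hc : ∀ j, 0 ≤ c j) (hp : SortedWeights n p)
    {S : ℕ → ℕ → Prop} {s : Store} (h : IsBest t c p n S s) {i m : ℕ} (h8 : s.nvar 8 = i)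
    (h9 : s.nvar 9 = m) (he : s.rarr 2 i m 0 = enc (OPT t c p n i m 0)) :
    IsBest t c p n (fun i' m' => S i' m' ∨ (i' = i ∧ m' = m)) (bestCell.run s) := by
  have hO := OPT_nonneg (i := i) ht hc hp m 0
  induction hx : OPT t c p n i m 0 using WithTop.recTopCoe with
  | top =>
    rw [hx, enc_top] at he
    have : bestCell.run s = s := by
      simp [bestCell, h8, h9, he, show ¬ (1 : ℝ) ≤ 0 by norm_num]
    rw [this]
    rcases h with ⟨h1, h2⟩ | ⟨h1, h2, h3, h4⟩
    · refine Or.inl ⟨h1, ?_⟩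
      rintro i' m' (h | ⟨rfl, rfl⟩)
      · exact h2 _ _ h
      · exact hx
    · refine Or.inr ⟨h1, Or.inl h2, h3, ?_⟩
      rintro i' m' (h | ⟨rfl, rfl⟩)
      · exact h4 _ _ h
      · rw [hx]
        exact le_top
  | coe x =>
    rw [hx] at he hO
    rw [enc_coe] at he
    have hO : 0 ≤ x := by exact_mod_cast hO
    by_cases hlt : 0 ≤ s.rvar 2 ∧ s.rvar 2 ≤ x
    · have : bestCell.run s = s := by
        simp [bestCell, h8, h9, he, hlt]
      rw [this]
      rcases h with ⟨h1, h2⟩ | ⟨h1, h2, h3, h4⟩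
      · rw [h1] at hlt
        norm_num at hlt
      · refine Or.inr ⟨h1, Or.inl h2, h3, ?_⟩
        rintro i' m' (h | ⟨rfl, rfl⟩)
        · exact h4 _ _ h
        · rw [hx]
          exact_mod_cast hlt.2
    · have hrun : bestCell.run s = { s with
          rvar := Function.update s.rvar 2 x
          nvar := Function.update (Function.update s.nvar 10 i) 11 m } := by
        have hlt' : 0 ≤ s.rvar 2 → x < s.rvar 2 := fun h => not_le.1 fun h' => hlt ⟨h, h'⟩
        simp [bestCell, h8, h9, he, hO]
        exact fun h1 h2 => absurd h2 (not_le.2 (hlt' h1))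
      rw [hrun]
      refine Or.inr ⟨by simpa using hO, Or.inr (by simp), by simpa using hx, ?_⟩
      simp only [Function.update_self]
      rintro i' m' (hS | ⟨rfl, rfl⟩)
      · rcases h with ⟨h1, h2⟩ | ⟨h1, h2, h3, h4⟩
        · rw [h2 _ _ hS]
          exact le_top
        · refine le_trans ?_ (h4 _ _ hS)
          have : x < s.rvar 2 := not_le.1 fun h' => hlt ⟨h1, h'⟩
          exact_mod_cast this.le
      · exact hx.ge

theorem bestProg_runs : ∃ K : ℕ, ∀ (t : ℕ → ℕ) (c p : ℕ → ℝ) (n : ℕ) (s : Store),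
    (∀ j, 2 ≤ t j) → (∀ j, 0 ≤ c j) → 1 ≤ n → SortedWeights n p →
    s.nvar 0 = n → s.HasArities t n → (∀ i ≤ n, s.HasLevel t c p n i) →
    bestProg.Runs s (K * n ^ 3) fun s₁ =>
      IsBest t c p n (fun i m => 1 ≤ i ∧ i ≤ n ∧ max n (t (i - 1)) ≤ m ∧ m ≤ n + t (i - 1) - 1)
        s₁ := by
  let A := bestRowInit.cost + bestRowStart.cost
  refine ⟨4 + (2 + 2 * ((A + (2 + 2 * (bestCell.cost + 10))) + 10)), ?_⟩
  intro t c p n s ht hc hn hp h0 har hlev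
  refine Prog.Runs.mono (T := 4 + (1 + 1 + (n + 1 - 1 + 1) *
    ((A + (2 + (n + 1) * (bestCell.cost + 10))) + 3 + 7))) ?_ ?_ fun _ h => h
  swap
  · rw [Nat.add_sub_cancel]
    have e1 : 1 ≤ n ^ 3 := Nat.one_le_pow _ _ hn
    have e2 : n ^ 2 ≤ n ^ 3 := Nat.pow_le_pow_right hn (by norm_num)
    have e4 : n + 1 ≤ 2 * n := by omega
    generalize bestCell.cost = B
    clear_value A
    have f1 : (A + (2 + (n + 1) * (B + 10))) + 3 + 7 ≤ ((A + (2 + 2 * (B + 10))) + 10) * n := by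
      have := Nat.mul_le_mul_right (B + 10) e4
      nlinarith [Nat.mul_le_mul_left A hn]
    have f2 : (n + 1) * ((A + (2 + (n + 1) * (B + 10))) + 3 + 7) ≤
        2 * ((A + (2 + 2 * (B + 10))) + 10) * n ^ 3 := by
      calc _ ≤ (2 * n) * (((A + (2 + 2 * (B + 10))) + 10) * n) := Nat.mul_le_mul e4 f1
        _ = 2 * ((A + (2 + 2 * (B + 10))) + 10) * n ^ 2 := by ring
        _ ≤ _ := Nat.mul_le_mul_left _ e2
    nlinarith
  refine Prog.Runs.seq (Prog.Runs.block (P := .rset 2 (.sub (.lit 0) (.lit 1))) rfl (Q := fun s₁ =>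
    Frame (.rset 2 (.sub (.lit 0) (.lit 1))) s s₁ ∧ s₁.rvar 2 = -1) fun hF => ⟨hF, by simp⟩) ?_
  rintro s₁ ⟨hF₁, h2⟩
  refine (Prog.Runs.forTo (B := A + (2 + (n + 1) * (bestCell.cost + 10))) (fun k s₂ => IsBest t c p n
    (fun i m => 1 ≤ i ∧ i < k ∧ max n (t (i - 1)) ≤ m ∧ m ≤ n + t (i - 1) - 1) s₂) 1 (n + 1) rfl
    (by omega) rfl ?_ ?_ ?_).mono le_rfl ?_
  · exact Or.inl ⟨h2, fun i m h => by omega⟩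
  · intro k s₂ hF _
    rw [NExp.eval, NExp.eval, NExp.eval, hF.n 0 rfl, hF₁.n 0 rfl, h0]
  · intro k s₂ h1k hk hF h8 hI
    have e0 : s₂.nvar 0 = n := by rw [hF.n 0 rfl, hF₁.n 0 rfl, h0]
    have ear : s₂.narr 0 (k - 1) 0 0 = t (k - 1) := by
      rw [hF.na 0 rfl, hF₁.na 0 rfl]
      exact har _ (by omega)
    have htk := ht (k - 1)
    refine Prog.Runs.seq (Prog.Runs.block (P := .seq bestRowInit bestRowStart) rfl (Q := fun s₃ =>
      Frame (.seq bestRowInit bestRowStart) s₂ s₃ ∧ s₃.nvar 3 = t (k - 1) ∧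
      s₃.nvar 4 = max n (t (k - 1))) fun hF => ⟨hF, ?_⟩) ?_
    · by_cases hnt : n ≤ t (k - 1)
      · simp [bestRowInit, bestRowStart, h8, e0, ear, hnt]
      · simp [bestRowInit, bestRowStart, h8, e0, ear, hnt]
        omega
    rintro s₃ ⟨hF₃, h3, h4⟩
    refine (Prog.Runs.forTo (B := bestCell.cost) (fun l s₄ => IsBest t c p n
      (fun i m => (1 ≤ i ∧ i < k ∧ max n (t (i - 1)) ≤ m ∧ m ≤ n + t (i - 1) - 1) ∨
        (i = k ∧ max n (t (k - 1)) ≤ m ∧ m < l)) s₄) (max n (t (k - 1))) (n + t (k - 1))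
      (show (NExp.var 4).eval s₃ = _ from h4) (by omega) rfl ?_ ?_ ?_).mono ?_ ?_
    · refine hI.congr (fun i m => ?_) (hF₃.r 2 rfl) (by simpa using hF₃.n 10 rfl)
        (by simpa using hF₃.n 11 rfl)
      refine ⟨Or.inl, ?_⟩
      rintro (h | h)
      · exact h
      · omega
    · intro l s₄ hF₄ _
      rw [NExp.eval, NExp.eval, NExp.eval, hF₄.n 0 rfl, hF₃.n 0 rfl, e0, hF₄.n 3 rfl, h3]
    · intro l s₄ hl1 hl2 hF₄ h9 hI'
      refine Prog.Runs.block rfl fun _ => ?_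
      have hv : Valid t n k l 0 := Or.inr ⟨rfl, h1k, hl1, by omega⟩
      have := bestCell_run ht hc hp hI' (i := k) (m := l)
        (by rw [hF₄.n 8 rfl, hF₃.n 8 rfl, h8]) h9 (by
          rw [hF₄.ra 2 rfl, hF₃.ra 2 rfl, hF.ra 2 rfl, hF₁.ra 2 rfl]
          exact hlev k (by omega) l 0 hv)
      refine this.congr (fun i m => ?_) rfl (by simp) (by simp)
      constructor
      · rintro ((h | h) | h)
        · exact Or.inl h
        · exact Or.inr ⟨h.1, h.2.1, by omega⟩
        · exact Or.inr ⟨h.1, by omega, by omega⟩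
      · rintro (h | ⟨rfl, h1, h2⟩)
        · exact Or.inl (Or.inl h)
        · rcases Nat.lt_succ_iff_lt_or_eq.1 h2 with h2 | h2
          · exact Or.inl (Or.inr ⟨rfl, h1, h2⟩)
          · exact Or.inr ⟨rfl, h2⟩
    -- The row has `min n (t (k - 1))` cells, hence at most n.
    · have : (n + t (k - 1) - max n (t (k - 1)) + 1) * (bestCell.cost + (1 + 1 + 1) + 7) ≤
        (n + 1) * (bestCell.cost + 10) := Nat.mul_le_mul (by omega) (by omega)
      simp only [NExp.ops]
      omega
    · rintro s₄ ⟨-, hI'⟩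
      refine hI'.congr (fun i m => ?_) rfl (by simp) (by simp)
      constructor
      · rintro (h | ⟨rfl, h1, h2⟩)
        · exact ⟨h.1, by omega, h.2.2⟩
        · exact ⟨h1k, by omega, h1, by omega⟩
      · rintro ⟨h1, h2, h5, h6⟩
        rcases Nat.lt_succ_iff_lt_or_eq.1 h2 with h2 | rfl
        · exact Or.inl ⟨h1, h2, h5, h6⟩
        · exact Or.inr ⟨rfl, h5, by omega⟩
  · rintro s₂ ⟨-, hI⟩
    exact hI.congr (fun i m => by rw [Nat.lt_succ_iff]) rfl rfl rfl

end

/-! ### Tracing back an optimal sequence of signatures -/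

/-- Nonnegative values never collide with the code -1 of `⊤`, so equality of machine values proves
equality of entries during the traceback. -/
theorem enc_inj {y z : WithTop ℝ} (hy : 0 ≤ y) (hz : 0 ≤ z) (h : enc y = enc z) : y = z := by
  induction y using WithTop.recTopCoe with
  | top =>
    induction z using WithTop.recTopCoe with
    | top => rfl
    | coe z =>
      have hz : 0 ≤ z := by exact_mod_cast hz
      rw [enc_top, enc_coe] at h
      linarith
  | coe y =>
    have hy : 0 ≤ y := by exact_mod_cast hy
    induction z using WithTop.recTopCoe with
    | top =>
      rw [enc_top, enc_coe] at h
      linarith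
    | coe z =>
      rw [enc_coe, enc_coe] at h
      rw [h]

/-- A sequence of signatures for the levels `i, …, I` that extends an optimal one for the levels
`0, …, i` to one of cost `v`. -/
structure BackPath (t : ℕ → ℕ) (c p : ℕ → ℝ) (n I i : ℕ) (m b : ℕ → ℕ) (v : ℝ) : Prop where
  le : i ≤ I
  b_last : b I = 0
  step : ∀ j, i ≤ j → j < I → m (j + 1) + b (j + 1) = m j + b j * t j
  mono : ∀ j, i ≤ j → j < I → m j ≤ m (j + 1)
  valid : ∀ j, i ≤ j → j ≤ I → Valid t n j (m j) (b j)
  cost : OPT t c p n i (m i) (b i) +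
    ((∑ j ∈ Finset.Ico i I, c j * tailSum p n (m j) : ℝ) : WithTop ℝ) = v

section

variable {t : ℕ → ℕ} {c p : ℕ → ℝ} {n I i : ℕ} {m b : ℕ → ℕ} {v : ℝ}

theorem BackPath.ne_top (h : BackPath t c p n I i m b v) : OPT t c p n i (m i) (b i) ≠ ⊤ := by
  intro htop
  have := h.cost
  rw [htop, WithTop.top_add] at this
  exact WithTop.top_ne_coe this

/-- On level 0 the only finite entry is that of the signature (0, 1), so reaching level 0 with
finite cost gives the correct start. -/
theorem BackPath.isPath (ht : ∀ j, 2 ≤ t j) (hc : ∀ j, 0 ≤ c j) (hp : SortedWeights n p)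
    (hn : 1 ≤ n) (h : BackPath t c p n I 0 m b v) :
    IsPath t n I m b ∧ pathCost c p n I m = v := by
  have h0 := h.ne_top
  have hcost := h.cost
  rw [OPT_zero ht hc hp hn] at h0 hcost
  split_ifs at h0 hcost with hmb
  · refine ⟨⟨hmb.1, hmb.2, fun j => h.step j (Nat.zero_le j), fun j => h.mono j (Nat.zero_le j),
      fun j => h.valid j (Nat.zero_le j)⟩, ?_⟩
    rw [zero_add] at hcost
    rw [pathCost, Finset.range_eq_Ico]
    exact_mod_cast hcost
  · exact absurd rfl h0

/-- A `b₁` that attains the minimum yields the previous signature at unchanged total cost. Its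
validity comes for free: otherwise γ would be `⊤`, whereas the current entry is finite. -/
theorem BackPath.extend (h : BackPath t c p n I (i + 1) m b v) {b₁ : ℕ}
    (h1 : b (i + 1) ≤ b₁ * t i) (h2 : b₁ * t i ≤ m (i + 1) + b (i + 1))
    (hg : gam t c p n i (m (i + 1) + b (i + 1)) b₁ = OPT t c p n (i + 1) (m (i + 1)) (b (i + 1))) :
    BackPath t c p n I i (Function.update m i (m (i + 1) + b (i + 1) - b₁ * t i))
      (Function.update b i b₁) v := by
  have hle := h.le
  have hv : Valid t n i (m (i + 1) + b (i + 1) - b₁ * t i) b₁ := by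
    by_contra hv
    rw [gam, OPT_of_not_valid hv, WithTop.top_add] at hg
    exact h.ne_top hg.symm
  have hne : ∀ {j}, i < j → j ≠ i := fun hj => by omega
  refine ⟨by omega, ?_, ?_, ?_, ?_, ?_⟩
  · rw [Function.update_of_ne (hne (by omega)), h.b_last]
  · intro j hj hjI
    rcases hj.lt_or_eq with hj | rfl
    · rw [Function.update_of_ne (hne (by omega)), Function.update_of_ne (hne (by omega)),
        Function.update_of_ne (hne hj), Function.update_of_ne (hne hj)]
      exact h.step j hj hjI
    · simp
      omega
  · intro j hj hjI
    rcases hj.lt_or_eq with hj | rfl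
    · rw [Function.update_of_ne (hne hj), Function.update_of_ne (hne (by omega))]
      exact h.mono j hj hjI
    · simp
      omega
  · intro j hj hjI
    rcases hj.lt_or_eq with hj | rfl
    · rw [Function.update_of_ne (hne hj), Function.update_of_ne (hne hj)]
      exact h.valid j hj hjI
    · simpa using hv
  · rw [Finset.sum_eq_sum_Ico_succ_bot (by omega : i < I), WithTop.coe_add, ← add_assoc,
      Function.update_self, Function.update_self, ← h.cost, ← hg, gam]
    congr 2
    refine Finset.sum_congr rfl fun j hj => ?_
    rw [Finset.mem_Ico] at hj
    rw [Function.update_of_ne (hne (by omega))]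

theorem exists_gam_eq (ht : ∀ j, 2 ≤ t j) (hc : ∀ j, 0 ≤ c j) (hp : SortedWeights n p) {M B : ℕ}
    (hv : Valid t n (i + 1) M B) (hne : OPT t c p n (i + 1) M B ≠ ⊤) :
    ∃ b₁, B ≤ b₁ * t i ∧ b₁ ≤ (M + B) / t i ∧
      gam t c p n i (M + B) b₁ = OPT t c p n (i + 1) M B := by
  rw [OPT_succ ht hc hp hv, batchMin] at hne ⊢
  have hS : ((Finset.range ((M + B) / t i + 1)).filter fun b₁ => B ≤ b₁ * t i).Nonempty := by
    rw [Finset.nonempty_iff_ne_empty]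
    intro h
    rw [h, Finset.inf_empty] at hne
    exact hne rfl
  obtain ⟨b₁, hb₁, h⟩ := Finset.exists_mem_eq_inf _ hS (gam t c p n i (M + B))
  rw [Finset.mem_filter, Finset.mem_range, Nat.lt_succ_iff] at hb₁
  exact ⟨b₁, hb₁.2, hb₁.1, h.symm⟩

def markCell : Prog :=
  .cond (.nle (.add (.var 8) (.lit 1)) (.var 12)) (.nput 4 (.var 8) (.lit 0) (.lit 0) (.var 1)) .skip

/-- Record level `i` for all leaves whose number is less than the current `m`. -/
def markProg : Prog := .forTo 8 (.lit 0) (.var 0) markCell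

/-- Levels are visited from the bottom up, so repeated overwriting leaves for leaf k the topmost
level j with `k < m j`. -/
theorem markProg_runs {s : Store} (h0 : s.nvar 0 = n) :
    markProg.Runs s (2 + (n + 1) * (markCell.cost + 8)) fun s₁ => ∀ k < n,
      s₁.narr 4 k 0 0 = if k < s.nvar 12 then s.nvar 1 else s.narr 4 k 0 0 := by
  refine (Prog.Runs.forTo (B := markCell.cost) (fun l s₁ => ∀ k,
    s₁.narr 4 k 0 0 = if k < l ∧ k < s.nvar 12 then s.nvar 1 else s.narr 4 k 0 0) 0 n rfl
    (Nat.zero_le n) rfl (by simp) ?_ ?_).mono le_rfl ?_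
  · intro l s₁ hF _
    rw [NExp.eval, hF.n 0 rfl, h0]
  · intro l s₁ _ hl hF h8 hI
    have e12 := hF.n 12 rfl
    have e1 := hF.n 1 rfl
    refine Prog.Runs.block rfl fun _ k => ?_
    by_cases hlm : l < s.nvar 12
    · by_cases hk : k = l
      · subst hk
        simp [markCell, putCell, h8, e12, e1, hlm]
      · have : k < l + 1 ↔ k < l := by omega
        simp only [this, ← hI k]
        simp [markCell, putCell, h8, e12, e1, hlm, hk]
    · have : (k < l + 1 ∧ k < s.nvar 12) ↔ (k < l ∧ k < s.nvar 12) := by omega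
      simp only [this, ← hI k]
      simp [markCell, h8, e12, hlm]
  · rintro s₁ ⟨-, hI⟩ k hk
    rw [hI k]
    simp [hk]

def traceInit : Prog :=
  .seq (.rset 2 (.get 2 (.var 1) (.var 12) (.var 13)))
    (.seq (.nset 2 (.add (.var 12) (.var 13)))
      (.seq (.nset 1 (.sub (.var 1) (.lit 1)))
        (.seq (.nset 3 (.get 0 (.var 1) (.lit 0) (.lit 0)))
          (.seq (.nset 4 (.lit 0)) (.nset 5 (.lit 0))))))

def traceTest : Test :=
  .neg (.conj (.nle (.var 13) (.var 5)) (.conj (.rle (.var 1) (.var 2)) (.rle (.var 2) (.var 1))))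

def traceBody : Prog := .seq countBody gamVal

def traceEnd : Prog := .seq (.nset 12 (.sub (.var 2) (.var 5))) (.nset 13 (.var 4))

/-- One step back: record the current level and find a matching `b₁`. -/
def traceStep : Prog :=
  .seq markProg (.seq traceInit (.seq gamVal (.seq (.loop traceTest traceBody) traceEnd)))

/-- Linear search for the least `b₁` with `B ≤ b₁ * t i` whose γ equals the entry. One exists
because the minimum of a finite nonempty set is attained. -/
theorem traceStep_runs : ∃ K : ℕ, ∀ (t : ℕ → ℕ) (c p : ℕ → ℝ) (n i M B : ℕ) (s : Store),
    (∀ j, 2 ≤ t j) → (∀ j, 0 ≤ c j) → 1 ≤ n → SortedWeights n p →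
    s.nvar 0 = n → s.HasArities t n → s.HasLengths c n → s.HasTails p n →
    (∀ j ≤ n, s.HasLevel t c p n j) → i < n → s.nvar 1 = i + 1 → s.nvar 12 = M → s.nvar 13 = B →
    Valid t n (i + 1) M B → OPT t c p n (i + 1) M B ≠ ⊤ →
    traceStep.Runs s (K * n) fun s₁ => s₁.nvar 1 = i ∧
      (∃ b₁, B ≤ b₁ * t i ∧ b₁ * t i ≤ M + B ∧
        gam t c p n i (M + B) b₁ = OPT t c p n (i + 1) M B ∧
        s₁.nvar 12 = M + B - b₁ * t i ∧ s₁.nvar 13 = b₁) ∧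
      ∀ k < n, s₁.narr 4 k 0 0 = if k < M then i + 1 else s.narr 4 k 0 0 := by
  classical
  refine ⟨(2 + 2 * (markCell.cost + 8)) + (traceInit.cost + (gamVal.cost +
    (2 * (traceBody.cost + traceTest.ops) + traceEnd.cost))), ?_⟩
  intro t c p n i M B s ht hc hn hp h0 har hlen htl hlev hin h1 h12 h13 hv hne
  have ht0 : 0 < t i := by have := ht i; omega
  obtain ⟨b', hb'1, hb'2, hb'3⟩ := exists_gam_eq ht hc hp hv hne
  have hex : ∃ b₁, B ≤ b₁ * t i ∧
      enc (gam t c p n i (M + B) b₁) = enc (OPT t c p n (i + 1) M B) := ⟨b', hb'1, by rw [hb'3]⟩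
  -- The program does not test `b₁ ≤ (M + B) / t i`: the least match cannot exceed the attaining
  -- `b'`, which satisfies this bound.
  obtain ⟨N, ⟨hN1, hN2⟩, hNmin, hNle⟩ : ∃ N, (B ≤ N * t i ∧
      enc (gam t c p n i (M + B) N) = enc (OPT t c p n (i + 1) M B)) ∧
      (∀ k < N, ¬ (B ≤ k * t i ∧
        enc (gam t c p n i (M + B) k) = enc (OPT t c p n (i + 1) M B))) ∧ N ≤ (M + B) / t i :=
    ⟨Nat.find hex, Nat.find_spec hex, fun k hk => Nat.find_min hex hk,
      (Nat.find_min' hex ⟨hb'1, by rw [hb'3]⟩).trans hb'2⟩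
  -- Validity gives `M + B < n + t i`, so the search makes at most n rounds whatever the arity.
  have hNn : N ≤ n := by
    refine hNle.trans (Nat.lt_succ_iff.1 ?_)
    rw [Nat.div_lt_iff_lt_mul ht0]
    have : M + B < n + t i := by
      rcases hv with hv | ⟨rfl, -, -, hv⟩
      · omega
      · rw [Nat.add_sub_cancel] at hv
        omega
    nlinarith
  refine Prog.Runs.mono (T := (2 + (n + 1) * (markCell.cost + 8)) + (traceInit.cost +
    (gamVal.cost + ((N + 1) * (traceBody.cost + traceTest.ops) + traceEnd.cost)))) ?_ ?_
    fun _ h => h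
  swap
  · have e1 : n + 1 ≤ 2 * n := by omega
    have e2 : N + 1 ≤ 2 * n := by omega
    have key : ∀ A₁ A₂ A₃ A₄ A₅ : ℕ, (2 + (n + 1) * A₁) + (A₂ + (A₃ + ((N + 1) * A₄ + A₅))) ≤
        ((2 + 2 * A₁) + (A₂ + (A₃ + (2 * A₄ + A₅)))) * n := fun A₁ A₂ A₃ A₄ A₅ => by
      linarith [Nat.mul_le_mul_right A₁ e1, Nat.mul_le_mul_right A₄ e2, Nat.mul_le_mul_left A₂ hn,
        Nat.mul_le_mul_left A₃ hn, Nat.mul_le_mul_left A₅ hn]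
    exact key _ _ _ _ _
  refine Prog.Runs.seq (markProg_runs h0).frame ?_
  rintro s₁ ⟨hF₁, hmark⟩
  refine Prog.Runs.seq (Prog.Runs.block (P := traceInit) rfl (Q := fun s₂ =>
    Frame traceInit s₁ s₂ ∧ LevelData s₂ t c p n i ∧ s₂.nvar 2 = M + B ∧ s₂.nvar 3 = t i ∧
    s₂.nvar 4 = 0 ∧ s₂.nvar 5 = 0 ∧ s₂.rvar 2 = enc (OPT t c p n (i + 1) M B))
    fun hF => ⟨hF, ⟨?_, ?_, ?_, ?_, ?_, ?_⟩, ?_, ?_, ?_, ?_, ?_⟩) ?_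
  · rw [hF.n 0 rfl, hF₁.n 0 rfl, h0]
  · simp [traceInit, hF₁.n 1 rfl, h1]
  · intro j hj
    rw [hF.na 0 rfl, hF₁.na 0 rfl]
    exact har j (by omega)
  · intro j hj
    rw [hF.ra 1 rfl, hF₁.ra 1 rfl]
    exact hlen j (by omega)
  · intro j hj
    rw [hF.ra 3 rfl, hF₁.ra 3 rfl]
    exact htl j hj
  · intro m b hv
    rw [hF.ra 2 rfl, hF₁.ra 2 rfl]
    exact hlev i hin.le m b hv
  · simp [traceInit, hF₁.n 12 rfl, hF₁.n 13 rfl, h12, h13]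
  · simpa [traceInit, hF₁.n 1 rfl, h1, hF₁.na 0 rfl] using har i hin
  · simp [traceInit]
  · simp [traceInit]
  · simpa [traceInit, hF₁.n 1 rfl, hF₁.n 12 rfl, hF₁.n 13 rfl, hF₁.ra 2 rfl, h1, h12, h13] using
      hlev (i + 1) hin M B hv
  rintro s₂ ⟨hF₂, hs₂, h2, h3, h4, h5, hr2⟩
  refine Prog.Runs.seq (Prog.Runs.block (P := gamVal) rfl (Q := fun s₃ =>
    Frame gamVal s₂ s₃ ∧ s₃.rvar 1 = enc (gam t c p n i (M + B) 0))
    fun hF => ⟨hF, gamVal_run ht hc hp hs₂ h2 h4 (by simpa using h5)⟩) ?_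
  rintro s₃ ⟨hF₃, hr1⟩
  have e13 : s₃.nvar 13 = B := by rw [hF₃.n 13 rfl, hF₂.n 13 rfl, hF₁.n 13 rfl, h13]
  have htest : ∀ (s₄ : Store) (k : ℕ), Frame traceBody s₃ s₄ → s₄.nvar 5 = k * t i →
      s₄.rvar 1 = enc (gam t c p n i (M + B) k) →
      (traceTest.holds s₄ ↔ ¬ (B ≤ k * t i ∧
        enc (gam t c p n i (M + B) k) = enc (OPT t c p n (i + 1) M B))) := by
    intro s₄ k hF h5 h1
    have e2 : s₄.rvar 2 = enc (OPT t c p n (i + 1) M B) := by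
      rw [hF.r 2 rfl, hF₃.r 2 rfl, hr2]
    simp only [traceTest, Test.holds, NExp.eval, RExp.eval, h5, h1, e2, hF.n 13 rfl, e13,
      ← le_antisymm_iff]
  refine Prog.Runs.seq (Prog.Runs.loop_frame (P := traceBody) (B := traceBody.cost)
    (fun k s₄ => s₄.nvar 4 = k ∧ s₄.nvar 5 = k * t i ∧
      s₄.rvar 1 = enc (gam t c p n i (M + B) k)) N
    ⟨by rw [hF₃.n 4 rfl, h4], by rw [hF₃.n 5 rfl, h5, zero_mul], hr1⟩ ?_ ?_) ?_
  · rintro k s₄ hk hF ⟨h4, h5, hr1⟩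
    refine ⟨(htest s₄ k hF h5 hr1).2 (hNmin k hk), Prog.Runs.block rfl fun hF' => ?_⟩
    have e3 : s₄.nvar 3 = t i := by rw [hF.n 3 rfl, hF₃.n 3 rfl, h3]
    have e2 : s₄.nvar 2 = M + B := by rw [hF.n 2 rfl, hF₃.n 2 rfl, h2]
    have g4 : (countBody.run s₄).nvar 4 = k + 1 := by simp [countBody, h4]
    have g5 : (countBody.run s₄).nvar 5 = (k + 1) * t i := by
      simp [countBody, h5, e3]
      ring
    have hFg := Prog.run_frame (P := gamVal) rfl (countBody.run s₄)
    have hFc := Prog.run_frame (P := countBody) rfl s₄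
    have hs : LevelData (countBody.run s₄) t c p n i := hs₂.of_eq
      (by rw [hFc.n 0 rfl, hF.n 0 rfl, hF₃.n 0 rfl]) (by rw [hFc.n 1 rfl, hF.n 1 rfl, hF₃.n 1 rfl])
      (by rw [hFc.na 0 rfl, hF.na 0 rfl, hF₃.na 0 rfl])
      (by rw [hFc.ra 1 rfl, hF.ra 1 rfl, hF₃.ra 1 rfl])
      (by rw [hFc.ra 3 rfl, hF.ra 3 rfl, hF₃.ra 3 rfl])
      (by rw [hFc.ra 2 rfl, hF.ra 2 rfl, hF₃.ra 2 rfl]; simp)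
    exact ⟨(hFg.n 4 rfl).trans g4, (hFg.n 5 rfl).trans g5,
      gamVal_run ht hc hp hs (by rw [hFc.n 2 rfl, e2]) g4 g5⟩
  · rintro s₄ hF ⟨h4, h5, hr1⟩
    rw [htest s₄ N hF h5 hr1, not_not]
    exact ⟨hN1, hN2⟩
  · rintro s₄ ⟨hF, h4, h5, -⟩
    have e2 : s₄.nvar 2 = M + B := by rw [hF.n 2 rfl, hF₃.n 2 rfl, h2]
    refine Prog.Runs.block rfl fun hF' => ⟨?_, ⟨N, hN1, ?_, ?_, ?_, ?_⟩, fun k hk => ?_⟩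
    · rw [hF'.n 1 rfl, hF.n 1 rfl, hF₃.n 1 rfl, hs₂.i_eq]
    · exact (Nat.le_div_iff_mul_le ht0).1 hNle
    · exact enc_inj (gam_nonneg ht hc hp _ _) (OPT_nonneg ht hc hp _ _) hN2
    · simp [traceEnd, e2, h5]
    · simp [traceEnd, h4]
    · rw [hF'.na 4 rfl, hF.na 4 rfl, hF₃.na 4 rfl, hF₂.na 4 rfl, hmark k hk, h12, h1]

def traceStart : Prog :=
  .seq (.nset 1 (.var 10)) (.seq (.nset 12 (.var 11)) (.nset 13 (.lit 0)))

def traceProg : Prog := .seq traceStart (.loop (.nle (.lit 1) (.var 1)) traceStep)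

theorem traceProg_runs : ∃ K : ℕ, ∀ (t : ℕ → ℕ) (c p : ℕ → ℝ) (n I M : ℕ) (v : ℝ) (s : Store),
    (∀ j, 2 ≤ t j) → (∀ j, 0 ≤ c j) → 1 ≤ n → SortedWeights n p →
    s.nvar 0 = n → s.HasArities t n → s.HasLengths c n → s.HasTails p n →
    (∀ j ≤ n, s.HasLevel t c p n j) → 1 ≤ I → I ≤ n → s.nvar 10 = I → s.nvar 11 = M →
    Valid t n I M 0 → OPT t c p n I M 0 = v →
    traceProg.Runs s (K * n ^ 3) fun s₁ => ∃ m b, IsPath t n I m b ∧ b I = 0 ∧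
      pathCost c p n I m = v ∧ IsLevels m n I fun k => s₁.narr 4 k 0 0 := by
  obtain ⟨K, hK⟩ := traceStep_runs
  refine ⟨traceStart.cost + 2 * (K + 3), ?_⟩
  intro t c p n I M v s ht hc hn hp h0 har hlen htl hlev hI1 hIn h10 h11 hv hopt
  refine Prog.Runs.mono (T := traceStart.cost + (I + 1) * (K * n + 3)) ?_ ?_ fun _ h => h
  swap
  · have e1 : 1 ≤ n ^ 3 := Nat.one_le_pow _ _ hn
    have e2 : n ^ 2 ≤ n ^ 3 := Nat.pow_le_pow_right hn (by norm_num)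
    have f1 : (I + 1) * (K * n + 3) ≤ 2 * (K + 3) * n ^ 3 := by
      calc _ ≤ (2 * n) * (K * n + 3 * n) := Nat.mul_le_mul (by omega) (by omega)
        _ = 2 * (K + 3) * n ^ 2 := by ring
        _ ≤ _ := Nat.mul_le_mul_left _ e2
    nlinarith [Nat.mul_le_mul_left traceStart.cost e1]
  refine Prog.Runs.seq (Prog.Runs.block (P := traceStart) rfl (Q := fun s₁ =>
    Frame traceStart s s₁ ∧ s₁.nvar 1 = I ∧ s₁.nvar 12 = M ∧ s₁.nvar 13 = 0)
    fun hF => ⟨hF, ?_⟩) ?_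
  · simp [traceStart, h10, h11]
  rintro s₁ ⟨hF₁, h1, h12, h13⟩
  -- After k rounds the signatures of the levels from `I - k` to I are fixed. Level `I - k` is
  -- marked only by the next round, so array 4 describes the levels strictly below it: there it
  -- holds, for each leaf number `a` less than some `m j`, the first such j.
  refine (Prog.Runs.loop_frame (P := traceStep) (B := K * n) (fun k s₂ => ∃ m b,
    BackPath t c p n I (I - k) m b v ∧ s₂.nvar 1 = I - k ∧ s₂.nvar 12 = m (I - k) ∧
    s₂.nvar 13 = b (I - k) ∧ ∀ a < n, ∀ j, I - k < j → j ≤ I → a < m j →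
      I - k < s₂.narr 4 a 0 0 ∧ s₂.narr 4 a 0 0 ≤ I ∧ a < m (s₂.narr 4 a 0 0) ∧
      ∀ j, I - k < j → j < s₂.narr 4 a 0 0 → m j ≤ a) I ?_ ?_ ?_).mono le_rfl ?_
  · refine ⟨fun _ => M, fun _ => 0, ⟨by simp, rfl, fun j h1 h2 => by omega,
      fun j h1 h2 => by omega, fun j h1 h2 => ?_, ?_⟩, by simpa using h1, h12, h13,
      fun a _ j h1 h2 => by omega⟩
    · obtain rfl : j = I := by omega
      exact hv
    · simpa using hopt
  · rintro k s₂ hk hF ⟨m, b, hB, h1, h12, h13, hmark⟩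
    obtain ⟨i, hi⟩ : ∃ i, I - k = i + 1 := ⟨I - k - 1, by omega⟩
    have hi' : I - (k + 1) = i := by omega
    rw [hi] at hB h1 h12 h13
    simp only [hi] at hmark
    simp only [hi']
    refine ⟨by simp [h1], ?_⟩
    refine (hK t c p n i _ _ s₂ ht hc hn hp (by rw [hF.n 0 rfl, hF₁.n 0 rfl, h0]) ?_ ?_ ?_ ?_
      (by omega) h1 h12 h13 (hB.valid (i + 1) le_rfl hB.le) hB.ne_top).mono le_rfl ?_
    · intro j hj
      rw [hF.na 0 rfl, hF₁.na 0 rfl]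
      exact har j hj
    · intro j hj
      rw [hF.ra 1 rfl, hF₁.ra 1 rfl]
      exact hlen j hj
    · intro j hj
      rw [hF.ra 3 rfl, hF₁.ra 3 rfl]
      exact htl j hj
    · intro j hj m b hv
      rw [hF.ra 2 rfl, hF₁.ra 2 rfl]
      exact hlev j hj m b hv
    · rintro s₃ ⟨h1', ⟨b₁, hb1, hb2, hg, h12', h13'⟩, hmark'⟩
      refine ⟨_, _, hB.extend hb1 hb2 hg, h1', by simpa using h12', by simpa using h13', ?_⟩
      intro a ha j hj hjI haj
      have hne : ∀ {j}, i < j → Function.update m i (m (i + 1) + b (i + 1) - b₁ * t i) j = m j :=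
        fun hj => Function.update_of_ne (by omega) _ _
      rw [hne hj] at haj
      rw [hmark' a ha]
      split_ifs with ham
      · have := hB.le
        refine ⟨by omega, by omega, by rw [hne (by omega)]; exact ham, fun j h1 h2 => by omega⟩
      · have hj1 : i + 1 < j := by
          rcases (Nat.succ_le_iff.2 hj).lt_or_eq with h | h
          · exact h
          · rw [Nat.succ_eq_add_one] at h
            rw [← h] at haj
            exact absurd haj ham
        obtain ⟨g1, g2, g3, g4⟩ := hmark a ha j hj1 hjI haj
        refine ⟨by omega, g2, by rw [hne (by omega)]; exact g3, fun j' h1 h2 => ?_⟩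
        rw [hne h1]
        rcases (Nat.succ_le_iff.2 h1).lt_or_eq with h | h
        · exact g4 j' h h2
        · rw [← h]
          exact not_lt.1 ham
  · rintro s₂ hF ⟨m, b, hB, h1, -⟩
    simp [h1]
  · rintro s₂ ⟨-, m, b, hB, -, -, -, hmark⟩
    simp only [Nat.sub_self] at hB hmark
    obtain ⟨hP, hcost⟩ := hB.isPath ht hc hp hn
    refine ⟨m, b, hP, hB.b_last, hcost, fun a ha => ?_⟩
    have hmI := hP.le_of_b_eq_zero le_rfl hB.b_last
    obtain ⟨g1, g2, g3, g4⟩ := hmark a ha I (by omega) le_rfl (by omega)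
    refine ⟨g2, g3, fun j hj => ?_⟩
    rcases Nat.eq_zero_or_pos j with rfl | h
    · rw [hP.m_zero]
      exact Nat.zero_le a
    · exact g4 j h hj

end

/-! ### Writing the words -/

def firstWord : Prog :=
  .forTo 8 (.lit 0) (.get 4 (.lit 0) (.lit 0) (.lit 0))
    (.nput 5 (.lit 0) (.var 8) (.lit 0) (.lit 0))

def carryInit : Prog :=
  .nset 10 (.sub (.get 4 (.sub (.var 9) (.lit 1)) (.lit 0) (.lit 0)) (.lit 1))

def carryTest : Test :=
  .nle (.get 0 (.var 10) (.lit 0) (.lit 0))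
    (.add (.get 5 (.sub (.var 9) (.lit 1)) (.var 10) (.lit 0)) (.lit 1))

def carryBody : Prog := .nset 10 (.sub (.var 10) (.lit 1))

def digitCell : Prog :=
  .cond (.nle (.add (.var 8) (.lit 1)) (.var 10))
    (.nput 5 (.var 9) (.var 8) (.lit 0) (.get 5 (.sub (.var 9) (.lit 1)) (.var 8) (.lit 0)))
    (.cond (.nle (.var 8) (.var 10))
      (.nput 5 (.var 9) (.var 8) (.lit 0)
        (.add (.get 5 (.sub (.var 9) (.lit 1)) (.var 8) (.lit 0)) (.lit 1)))
      (.nput 5 (.var 9) (.var 8) (.lit 0) (.lit 0)))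

/-- Compute a word from its predecessor. -/
def wordStep : Prog :=
  .seq carryInit (.seq (.loop carryTest carryBody)
    (.forTo 8 (.lit 0) (.get 4 (.var 9) (.lit 0) (.lit 0)) digitCell))

def wordsProg : Prog := .seq firstWord (.forTo 9 (.lit 1) (.var 0) wordStep)

theorem wordStep_runs : ∃ K : ℕ, ∀ (t : ℕ → ℕ) (n k q : ℕ) (s : Store), 1 ≤ n →
    s.HasArities t n → s.nvar 9 = k + 1 → s.narr 4 k 0 0 ≤ n → s.narr 4 (k + 1) 0 0 ≤ n →
    IsCarry t (fun j => s.narr 5 k j 0) (s.narr 4 k 0 0) q →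
    wordStep.Runs s (K * n) fun s₁ =>
      (∀ j < s.narr 4 (k + 1) 0 0,
        s₁.narr 5 (k + 1) j 0 = bump (fun j => s.narr 5 k j 0) q j) ∧
      ∀ l j, l ≠ k + 1 → s₁.narr 5 l j 0 = s.narr 5 l j 0 := by
  refine ⟨carryInit.cost + (carryBody.cost + carryTest.ops + (2 + 2 * (digitCell.cost + 11))), ?_⟩
  intro t n k q s hn har h9 hx hx' hq
  obtain ⟨hq1, hq2, hq3⟩ := hq
  set x := s.narr 4 k 0 0 with hxdef
  set x' := s.narr 4 (k + 1) 0 0 with hxdef'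
  refine Prog.Runs.mono (T := carryInit.cost + ((x - 1 - q + 1) * (carryBody.cost + carryTest.ops) +
    (1 + 1 + (x' - 0 + 1) * (digitCell.cost + 4 + 7)))) ?_ ?_ fun _ h => h
  swap
  · have e1 : x - 1 - q + 1 ≤ n := by omega
    have e2 : x' - 0 + 1 ≤ 2 * n := by omega
    have key : ∀ A₁ A₂ A₃ : ℕ, A₁ + ((x - 1 - q + 1) * A₂ + (1 + 1 + (x' - 0 + 1) * A₃)) ≤
        (A₁ + (A₂ + (2 + 2 * A₃))) * n := fun A₁ A₂ A₃ => by
      linarith [Nat.mul_le_mul_left A₁ hn, Nat.mul_le_mul_right A₂ e1, Nat.mul_le_mul_right A₃ e2]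
    exact key _ _ _
  refine Prog.Runs.seq (Prog.Runs.block (P := carryInit) rfl (Q := fun s₁ =>
    Frame carryInit s s₁ ∧ s₁.nvar 10 = x - 1) fun hF => ⟨hF, ?_⟩) ?_
  · simp [carryInit, h9, hxdef]
  rintro s₁ ⟨hF₁, h10⟩
  have htest : ∀ (s₂ : Store) (r : ℕ), Frame carryBody s₁ s₂ → r < x → s₂.nvar 10 = r →
      (carryTest.holds s₂ ↔ t r ≤ s.narr 5 k r 0 + 1) := by
    intro s₂ r hF hr h10
    have := har r (by omega)
    simp [carryTest, h10, hF.n 9 rfl, hF₁.n 9 rfl, h9, hF.na 0 rfl, hF₁.na 0 rfl, hF.na 5 rfl,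
      hF₁.na 5 rfl, this]
  refine Prog.Runs.seq (Prog.Runs.loop_frame (P := carryBody) (B := carryBody.cost)
    -- The search runs from the last digit down to q; the digits passed are maximal, and the test
    -- fails at q.
    (fun l s₂ => s₂.nvar 10 = x - 1 - l) (x - 1 - q) h10 ?_ ?_) ?_
  · intro l s₂ hl hF h10
    refine ⟨(htest s₂ _ hF (by omega) h10).2 (hq3 _ (by omega) (by omega)),
      Prog.Runs.block rfl fun _ => ?_⟩
    simp [carryBody, h10]
    omega
  · intro s₂ hF h10
    rw [show x - 1 - (x - 1 - q) = q by omega] at h10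
    rw [htest s₂ q hF hq1 h10]
    simpa using hq2
  rintro s₂ ⟨hF₂, h10⟩
  rw [show x - 1 - (x - 1 - q) = q by omega] at h10
  have e9 : s₂.nvar 9 = k + 1 := by rw [hF₂.n 9 rfl, hF₁.n 9 rfl, h9]
  have e5 : s₂.narr 5 = s.narr 5 := by rw [hF₂.na 5 rfl, hF₁.na 5 rfl]
  refine (Prog.Runs.forTo (B := digitCell.cost) (fun l s₃ =>
    (∀ j < l, s₃.narr 5 (k + 1) j 0 = bump (fun j => s.narr 5 k j 0) q j) ∧
    ∀ l j, l ≠ k + 1 → s₃.narr 5 l j 0 = s.narr 5 l j 0) 0 x' rfl (Nat.zero_le _) rfl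
    ⟨by simp, fun l j _ => by simp [e5]⟩ ?_ ?_).mono le_rfl fun s₃ h => h.2
  · intro l s₃ hF _
    simp [hF.n 9 rfl, e9, hF.na 4 rfl, hF₂.na 4 rfl, hF₁.na 4 rfl, hxdef']
  · rintro l s₃ - hl hF h8 ⟨hI, hJ⟩
    have e9 : s₃.nvar 9 = k + 1 := by rw [hF.n 9 rfl, e9]
    have e10 : s₃.nvar 10 = q := by rw [hF.n 10 rfl, h10]
    have ek := hJ k l (by omega)
    have hrun : digitCell.run s₃ = { s₃ with
        narr := putCell s₃.narr 5 (k + 1) l 0 (bump (fun j => s.narr 5 k j 0) q l) } := by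
      rcases lt_trichotomy l q with h | h | h
      · simp [digitCell, h8, e9, e10, bump, h, ek]
      · subst h
        simp [digitCell, h8, e9, e10, bump, ek]
      · simp [digitCell, h8, e9, e10, bump, h.not_gt, h.not_ge, h.ne']
    refine Prog.Runs.block rfl fun _ => ?_
    rw [hrun]
    refine ⟨fun j hj => ?_, fun l' j hl' => ?_⟩
    · by_cases hjl : j = l
      · simp [putCell, hjl]
      · simp [putCell, hjl]
        exact hI j (by omega)
    · simp [putCell, hl']
      exact hJ l' j hl'

theorem wordsProg_runs : ∃ K : ℕ, ∀ (t : ℕ → ℕ) (n I : ℕ) (m b : ℕ → ℕ) (s : Store),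
    (∀ j, 2 ≤ t j) → 1 ≤ n → I ≤ n → s.nvar 0 = n → s.HasArities t n →
    IsPath t n I m b → IsLevels m n I (fun k => s.narr 4 k 0 0) →
    wordsProg.Runs s (K * n ^ 3) fun s₁ =>
      (∀ k < n, GoodWord t m b k (s.narr 4 k 0 0) fun j => s₁.narr 5 k j 0) ∧
      ∀ k, k + 1 < n → LexLt (s.narr 4 k 0 0) (fun j => s₁.narr 5 k j 0)
        fun j => s₁.narr 5 (k + 1) j 0 := by
  obtain ⟨K, hK⟩ := wordStep_runs
  refine ⟨(2 + 2 * 16) + (2 + 2 * (K + 8)), ?_⟩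
  intro t n I m b s ht hn hIn h0 har hP hx
  have hxn : ∀ k < n, s.narr 4 k 0 0 ≤ n := fun k hk => (hx k hk).1.trans hIn
  refine Prog.Runs.mono (T := (1 + 1 + (s.narr 4 0 0 0 - 0 + 1) * (5 + 4 + 7)) +
    (1 + 1 + (n - 1 + 1) * (K * n + 1 + 7))) ?_ ?_ fun _ h => h
  swap
  · have e0 := hxn 0 hn
    have e1 : 1 ≤ n ^ 3 := Nat.one_le_pow _ _ hn
    have e2 : n ^ 2 ≤ n ^ 3 := Nat.pow_le_pow_right hn (by norm_num)
    have e3 : n ≤ n ^ 2 := by nlinarith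
    have f1 : (n - 1 + 1) * (K * n + 1 + 7) ≤ 2 * (K + 8) * n ^ 3 := by
      calc _ ≤ (2 * n) * (K * n + 8 * n) := Nat.mul_le_mul (by omega) (by omega)
        _ = 2 * (K + 8) * n ^ 2 := by ring
        _ ≤ _ := Nat.mul_le_mul_left _ e2
    have f2 : (s.narr 4 0 0 0 - 0 + 1) * (5 + 4 + 7) ≤ 2 * 16 * n ^ 3 := by omega
    linarith
  refine Prog.Runs.seq (Prog.Runs.forTo (B := 5) (fun l s₁ => ∀ j < l, s₁.narr 5 0 j 0 = 0)
    0 (s.narr 4 0 0 0) rfl (Nat.zero_le _) rfl (by simp) ?_ ?_) ?_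
  · intro l s₁ hF _
    simp [hF.na 4 rfl]
  · intro l s₁ _ hl hF h8 hI
    refine Prog.Runs.block (P := .nput 5 (.lit 0) (.var 8) (.lit 0) (.lit 0)) rfl fun _ j hj => ?_
    simp only [Store.setN_narr, Prog.run, putCell, NExp.eval, h8, true_and, and_true]
    split_ifs with h
    · rfl
    · exact hI j (by omega)
  rintro s₁ ⟨hF₁, hz⟩
  refine (Prog.Runs.forTo (B := K * n) (fun l s₂ =>
    (∀ k < l, GoodWord t m b k (s.narr 4 k 0 0) fun j => s₂.narr 5 k j 0) ∧
    ∀ k, k + 1 < l → LexLt (s.narr 4 k 0 0) (fun j => s₂.narr 5 k j 0)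
      fun j => s₂.narr 5 (k + 1) j 0) 1 n rfl hn rfl ?_ ?_ ?_).mono le_rfl fun s₂ h => h.2
  · refine ⟨fun k hk => ?_, fun k hk => by omega⟩
    obtain rfl : k = 0 := by omega
    exact (goodWord_zero ht hP hx hn).congr fun j hj => (hz j hj).symm
  · intro l s₂ hF _
    rw [NExp.eval, hF.n 0 rfl, hF₁.n 0 rfl, h0]
  · rintro l s₂ hl1 hl hF h9 ⟨hG, hL⟩
    obtain ⟨k, rfl⟩ : ∃ k, l = k + 1 := ⟨l - 1, by omega⟩
    have hg := hG k (Nat.lt_succ_self k)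
    obtain ⟨q, hq⟩ := hg.exists_isCarry hP hx hl
    have e4 : s₂.narr 4 = s.narr 4 := by rw [hF.na 4 rfl, hF₁.na 4 rfl]
    refine (hK t n k q s₂ hn (fun j hj => by rw [hF.na 0 rfl, hF₁.na 0 rfl]; exact har j hj) h9
      (by rw [e4]; exact hxn k (by omega)) (by rw [e4]; exact hxn _ hl)
      (by rw [e4]; exact hq)).mono le_rfl ?_
    rintro s₃ ⟨h1, h2⟩
    rw [e4] at h1
    simp only [Store.setN_narr]
    have hold : ∀ k' ≠ k + 1, (fun j => s₃.narr 5 k' j 0) = fun j => s₂.narr 5 k' j 0 :=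
      fun k' hk' => funext fun j => h2 k' j hk'
    refine ⟨fun k' hk' => ?_, fun k' hk' => ?_⟩
    · by_cases hkk : k' = k + 1
      · subst hkk
        exact (hg.bump ht hP hx hl hq).congr fun j hj => (h1 j hj).symm
      · rw [hold k' hkk]
        exact hG k' (by omega)
    · by_cases hkk : k' = k
      · subst hkk
        rw [hold k' (by omega)]
        have := hx.le_succ hl
        have hq1 := hq.1
        refine ⟨q, hq1, fun j hj => ?_, ?_⟩
        · beta_reduce
          rw [h1 j (by omega), bump, if_pos hj]
        · beta_reduce
          rw [h1 q (by omega)]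
          simp [bump]
      · rw [hold k' (by omega), hold (k' + 1) (by omega)]
        exact hL k' (by omega)

def outInit : Prog :=
  .seq (.nset 9 (.get 3 (.var 8) (.lit 0) (.lit 0)))
    (.nput 2 (.var 8) (.lit 0) (.lit 0) (.get 4 (.var 9) (.lit 0) (.lit 0)))

def outCell : Prog :=
  .nput 1 (.var 8) (.var 10) (.lit 0) (.get 5 (.var 9) (.var 10) (.lit 0))

def outRow : Prog :=
  .seq outInit (.forTo 10 (.lit 0) (.get 4 (.var 9) (.lit 0) (.lit 0)) outCell)

/-- Write the words in the order of the given weights. -/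
def outProg : Prog := .forTo 8 (.lit 0) (.var 0) outRow

theorem outProg_runs : ∃ K : ℕ, ∀ (n : ℕ) (s : Store), 1 ≤ n → s.nvar 0 = n →
    (∀ k < n, s.narr 4 (s.narr 3 k 0 0) 0 0 ≤ n) →
    outProg.Runs s (K * n ^ 3) fun s₁ => ∀ k < n,
      s₁.narr 2 k 0 0 = s.narr 4 (s.narr 3 k 0 0) 0 0 ∧
      ∀ j < s.narr 4 (s.narr 3 k 0 0) 0 0, s₁.narr 1 k j 0 = s.narr 5 (s.narr 3 k 0 0) j 0 := by
  refine ⟨2 + 2 * (outInit.cost + (2 + 2 * (outCell.cost + 11)) + 8), ?_⟩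
  intro n s hn h0 hx
  refine Prog.Runs.mono (T := 1 + 1 + (n - 0 + 1) * ((outInit.cost + (2 + (n + 1) *
    (outCell.cost + 11))) + 1 + 7)) ?_ ?_ fun _ h => h
  swap
  · have e1 : 1 ≤ n ^ 3 := Nat.one_le_pow _ _ hn
    have e2 : n ^ 2 ≤ n ^ 3 := Nat.pow_le_pow_right hn (by norm_num)
    have key : ∀ A B : ℕ, 1 + 1 + (n - 0 + 1) * ((A + (2 + (n + 1) * B)) + 1 + 7) ≤
        (2 + 2 * (A + (2 + 2 * B) + 8)) * n ^ 3 := fun A B => by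
      have f0 : (n + 1) * B ≤ (2 * n) * B := Nat.mul_le_mul_right _ (by omega)
      have f1 : (A + (2 + (n + 1) * B)) + 1 + 7 ≤ (A + (2 + 2 * B) + 8) * n := by
        nlinarith [Nat.mul_le_mul_left A hn]
      have f2 : (n - 0 + 1) * ((A + (2 + (n + 1) * B)) + 1 + 7) ≤
          2 * (A + (2 + 2 * B) + 8) * n ^ 3 := by
        calc _ ≤ (2 * n) * ((A + (2 + 2 * B) + 8) * n) := Nat.mul_le_mul (by omega) f1
          _ = 2 * (A + (2 + 2 * B) + 8) * n ^ 2 := by ring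
          _ ≤ _ := Nat.mul_le_mul_left _ e2
      linarith
    exact key _ _
  refine (Prog.Runs.forTo (B := outInit.cost + (2 + (n + 1) * (outCell.cost + 11)))
    (fun l s₁ => ∀ k < l,
      s₁.narr 2 k 0 0 = s.narr 4 (s.narr 3 k 0 0) 0 0 ∧
      ∀ j < s.narr 4 (s.narr 3 k 0 0) 0 0, s₁.narr 1 k j 0 = s.narr 5 (s.narr 3 k 0 0) j 0)
    0 n rfl (Nat.zero_le n) rfl (by simp) ?_ ?_).mono le_rfl fun s₁ h => h.2
  · intro l s₁ hF _
    rw [NExp.eval, hF.n 0 rfl, h0]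
  · intro l s₁ _ hl hF h8 hI
    have e3 : s₁.narr 3 = s.narr 3 := hF.na 3 rfl
    have e4 : s₁.narr 4 = s.narr 4 := hF.na 4 rfl
    set x := s.narr 4 (s.narr 3 l 0 0) 0 0 with hxdef
    refine Prog.Runs.seq (Prog.Runs.block (P := outInit) rfl (Q := fun s₂ =>
      Frame outInit s₁ s₂ ∧ s₂.nvar 9 = s.narr 3 l 0 0 ∧ s₂.narr 2 l 0 0 = x ∧
      ∀ k ≠ l, s₂.narr 2 k 0 0 = s₁.narr 2 k 0 0) fun hF => ⟨hF, ?_, ?_, ?_⟩) ?_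
    · simp [outInit, h8, e3]
    · simp [outInit, h8, e3, e4, putCell, hxdef]
    · intro k hk
      simp [outInit, h8, putCell, hk]
    rintro s₂ ⟨hF₂, h9, h2, h2'⟩
    have e8 : s₂.nvar 8 = l := by rw [hF₂.n 8 rfl, h8]
    refine (Prog.Runs.forTo (B := outCell.cost) (fun a s₃ =>
      (∀ j < a, s₃.narr 1 l j 0 = s.narr 5 (s.narr 3 l 0 0) j 0) ∧
      ∀ k j, k ≠ l → s₃.narr 1 k j 0 = s₁.narr 1 k j 0) 0 x rfl (Nat.zero_le _) rfl
      ⟨by simp, fun k j _ => by simp [hF₂.na 1 rfl]⟩ ?_ ?_).mono ?_ ?_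
    · intro a s₃ hF₃ _
      simp [hF₃.n 9 rfl, h9, hF₃.na 4 rfl, hF₂.na 4 rfl, e4, hxdef]
    · rintro a s₃ - ha hF₃ h10 ⟨hI₁, hI₂⟩
      have g8 : s₃.nvar 8 = l := by rw [hF₃.n 8 rfl, e8]
      have g9 : s₃.nvar 9 = s.narr 3 l 0 0 := by rw [hF₃.n 9 rfl, h9]
      have g5 : s₃.narr 5 = s.narr 5 := by rw [hF₃.na 5 rfl, hF₂.na 5 rfl, hF.na 5 rfl]
      refine Prog.Runs.block rfl fun _ => ⟨fun j hj => ?_, fun k j hk => ?_⟩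
      · by_cases hja : j = a
        · simp [outCell, putCell, g8, g9, h10, g5, hja]
        · simp [outCell, putCell, g8, g9, h10, hja]
          exact hI₁ j (by omega)
      · simp [outCell, putCell, g8, g9, h10, hk]
        exact hI₂ k j hk
    · have hxn := hx l hl
      have : (x - 0 + 1) * (outCell.cost + (1 + 1 + 1 + 1) + 7) ≤ (n + 1) * (outCell.cost + 11) :=
        Nat.mul_le_mul (by omega) (by omega)
      simp only [NExp.ops]
      omega
    · rintro s₃ ⟨hF₃, hI₁, hI₂⟩ k hk
      simp only [Store.setN_narr, hF₃.na 2 rfl]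
      by_cases hkl : k = l
      · subst hkl
        exact ⟨h2, hI₁⟩
      · have := hI k (by omega)
        rw [h2' k hkl]
        exact ⟨this.1, fun j hj => by rw [hI₂ k j hkl, this.2 j hj]⟩

/-! ### Optimal trees and codes -/

section

variable {t : ℕ → ℕ} {n : ℕ}

/-- The unary code with words 1^k 0 exists for all arities at least 2, so the search for the best
entry cannot end with `⊤`. -/
theorem bestEntry_ne_top {c p : ℕ → ℝ} (ht : ∀ j, 2 ≤ t j) (hc : ∀ j, 0 ≤ c j) (hn : 2 ≤ n)
    (hp : SortedWeights n p) : bestEntry t c p n ≠ ⊤ := by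
  have hcode : IsMixedRadixCode t fun k : Fin n =>
      List.ofFn fun j : Fin (k + 1) => if (j : ℕ) < k then 1 else 0 := by
    refine isMixedRadixCode_of_lexLt (x := fun k => k + 1) (d := fun k j => if j < k then 1 else 0)
      (fun k _ j _ => ?_) (fun k _ => by omega) fun k _ => ⟨k, by omega, fun j hj => ?_, by simp⟩
    · have := ht j
      split_ifs <;> omega
    · beta_reduce
      rw [if_pos hj, if_pos (by omega)]
  intro h
  have := bestEntry_le_treeCost ht hc hn hp hcode
  rw [h] at this
  exact WithTop.coe_ne_top (top_le_iff.1 this)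

theorem IsMixedRadixCode.comp {w : Fin n → List ℕ} (h : IsMixedRadixCode t w)
    (ρ : Equiv.Perm (Fin n)) : IsMixedRadixCode t (w ∘ ρ) :=
  ⟨fun k => h.1 (ρ k), fun _ _ hkl => h.2 _ _ fun he => hkl (ρ.injective he)⟩

theorem treeCost_comp (c : ℕ → ℝ) (p : Fin n → ℝ) (w : Fin n → List ℕ) (ρ : Equiv.Perm (Fin n)) :
    treeCost c (p ∘ ρ) (w ∘ ρ) = treeCost c p w :=
  Equiv.sum_comp ρ fun k => depth c (w k).length * p k

/-- A code that attains the least table entry for the sorted weights yields an optimal tree. -/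
theorem isOptimalTree_of_sorted {c : ℕ → ℝ} (ht : ∀ j, 2 ≤ t j) (hc : ∀ j, 0 ≤ c j) (hn : 2 ≤ n)
    {p : Fin n → ℝ} (hp : ∀ k, 0 ≤ p k) {w : Fin n → List ℕ} (hw : IsMixedRadixCode t w)
    (hcost : ((treeCost c (fun k : Fin n => sortedWeights p k) w : ℝ) : WithTop ℝ) =
      bestEntry t c (sortedWeights p) n) :
    IsOptimalTree t c p (w ∘ rankPerm p) := by
  rw [isOptimalTree_iff c (by omega)]
  refine ⟨hw.comp _, fun u hu => ?_⟩
  have hpp : p = (fun k : Fin n => sortedWeights p k) ∘ rankPerm p := by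
    funext k
    simp [sortedWeights_rank]
  have h1 : treeCost c p (w ∘ rankPerm p) = treeCost c (fun k : Fin n => sortedWeights p k) w := by
    rw [← treeCost_comp c _ w (rankPerm p), ← hpp]
  have h2 : treeCost c p u =
      treeCost c (fun k : Fin n => sortedWeights p k) (u ∘ (rankPerm p).symm) := by
    rw [← treeCost_comp c _ (u ∘ (rankPerm p).symm) (rankPerm p), ← hpp]
    congr 1
    funext k
    simp
  rw [h1, h2]
  have := bestEntry_le_treeCost ht hc hn (sortedWeights_spec hp) (hu.comp (rankPerm p).symm)
  rw [← hcost] at this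
  exact_mod_cast this

/-- For n = 1 the root itself is the leaf and costs nothing. The table requires an internal root, so
this case is treated apart. -/
theorem isOptimalTree_of_eq_one {c : ℕ → ℝ} {p : Fin n → ℝ} (hn : n = 1) (hp : ∀ k, 0 ≤ p k)
    (hc : ∀ j, 0 ≤ c j) {w : Fin n → List ℕ} (hw : ∀ k, w k = []) : IsOptimalTree t c p w := by
  subst hn
  rw [isOptimalTree_iff c le_rfl]
  refine ⟨⟨fun k j hj => by simp [hw] at hj, fun k l hkl => absurd (Subsingleton.elim k l) hkl⟩,
    fun u _ => ?_⟩
  have h0 : treeCost c p w = 0 := by simp [treeCost, hw, depth]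
  rw [h0]
  exact Finset.sum_nonneg fun k _ => mul_nonneg (Finset.sum_nonneg fun j _ => hc j) (hp k)

end

/-- The separate call of `tailsProg` provides the tails that the traceback reads and that the
postcondition of `tableProg_runs` does not mention. -/
def treeProg : Prog :=
  .cond (.nle (.var 0) (.lit 1)) (.nput 2 (.lit 0) (.lit 0) (.lit 0) (.lit 0))
    (.seq sortProg (.seq tableProg (.seq tailsProg (.seq bestProg (.seq traceProg
      (.seq wordsProg outProg))))))

theorem treeProg_runs : ∃ K : ℕ, ∀ (t : ℕ → ℕ) (c : ℕ → ℝ) (n : ℕ) (p : Fin n → ℝ) (s : Store),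
    (∀ j, 2 ≤ t j) → (∀ j, 0 ≤ c j) → 1 ≤ n → (∀ k, 0 ≤ p k) →
    s.nvar 0 = n → s.HasArities t n → s.HasLengths c n → s.HasWeights p →
    treeProg.Runs s (K * n ^ 3) fun s₁ => IsOptimalTree t c p (s₁.words n) := by
  obtain ⟨K₁, hK₁⟩ := sortProg_runs
  obtain ⟨K₂, hK₂⟩ := tableProg_runs
  obtain ⟨K₃, hK₃⟩ := bestProg_runs
  obtain ⟨K₄, hK₄⟩ := traceProg_runs
  obtain ⟨K₅, hK₅⟩ := wordsProg_runs
  obtain ⟨K₆, hK₆⟩ := outProg_runs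
  refine ⟨3 + (5 + (K₁ + (K₂ + ((tailsInit.cost + 2 * (tailsBody.cost + 8)) + (K₃ + (K₄ +
    (K₅ + K₆))))))), ?_⟩
  intro t c n p s ht hc hn hp h0 har hlen hw
  have e1 : 1 ≤ n ^ 3 := Nat.one_le_pow _ _ hn
  have e2 : n + 1 ≤ 2 * n ^ 3 := by
    have : n ≤ n ^ 3 := Nat.le_self_pow (by norm_num) n
    omega
  have hT : 3 + (5 + (K₁ * n ^ 3 + (K₂ * n ^ 3 + ((tailsInit.cost + (n + 1) *
      (tailsBody.cost + 8)) + (K₃ * n ^ 3 + (K₄ * n ^ 3 + (K₅ * n ^ 3 + K₆ * n ^ 3))))))) ≤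
      (3 + (5 + (K₁ + (K₂ + ((tailsInit.cost + 2 * (tailsBody.cost + 8)) + (K₃ + (K₄ +
        (K₅ + K₆)))))))) * n ^ 3 := by
    have key : ∀ A B : ℕ, 3 + (5 + (K₁ * n ^ 3 + (K₂ * n ^ 3 + ((A + (n + 1) * B) +
        (K₃ * n ^ 3 + (K₄ * n ^ 3 + (K₅ * n ^ 3 + K₆ * n ^ 3))))))) ≤
        (3 + (5 + (K₁ + (K₂ + ((A + 2 * B) + (K₃ + (K₄ + (K₅ + K₆)))))))) * n ^ 3 := fun A B => by
      linarith [Nat.mul_le_mul_left A e1, Nat.mul_le_mul_right B e2]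
    exact key _ _
  refine Prog.Runs.mono ?_ hT fun _ h => h
  refine Prog.Runs.cond (b := .nle (.var 0) (.lit 1)) ?_ ?_
  · intro hb
    have hn1 : n = 1 := by
      simp [h0] at hb
      omega
    refine (Prog.Runs.block (P := .nput 2 (.lit 0) (.lit 0) (.lit 0) (.lit 0)) rfl fun _ => ?_).mono
      (Nat.le_add_right _ _) fun _ h => h
    refine isOptimalTree_of_eq_one hn1 hp hc fun k => ?_
    have hk : (k : ℕ) = 0 := by omega
    rw [← List.length_eq_zero_iff]
    simp [Store.words, putCell, hk]
  · intro hb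
    have hn2 : 2 ≤ n := by
      simp [h0] at hb
      omega
    have hsw := sortedWeights_spec hp
    refine Prog.Runs.mono (T := K₁ * n ^ 3 + (K₂ * n ^ 3 + ((tailsInit.cost + (n + 1) *
      (tailsBody.cost + 8)) + (K₃ * n ^ 3 + (K₄ * n ^ 3 + (K₅ * n ^ 3 + K₆ * n ^ 3)))))) ?_
      (Nat.le_add_left _ _) fun _ h => h
    refine Prog.Runs.seq (hK₁ n p s hn h0 hw).frame ?_
    rintro s₁ ⟨hF₁, hw₁, hrank⟩
    have har₁ : s₁.HasArities t n := fun j hj => by rw [hF₁.na 0 rfl]; exact har j hj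
    have hlen₁ : s₁.HasLengths c n := fun j hj => by rw [hF₁.ra 1 rfl]; exact hlen j hj
    have h0₁ : s₁.nvar 0 = n := by rw [hF₁.n 0 rfl, h0]
    refine Prog.Runs.seq (hK₂ t c _ n s₁ ht hc hn hsw h0₁ har₁ hlen₁ hw₁).frame ?_
    rintro s₂ ⟨hF₂, hlev⟩
    have h0₂ : s₂.nvar 0 = n := by rw [hF₂.n 0 rfl, h0₁]
    refine Prog.Runs.seq (tailsProg_runs (sortedWeights p) h0₂
      (fun k => by rw [hF₂.ra 0 rfl]; exact hw₁ k)).frame ?_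
    rintro s₃ ⟨hF₃, htl⟩
    have h0₃ : s₃.nvar 0 = n := by rw [hF₃.n 0 rfl, h0₂]
    have har₃ : s₃.HasArities t n := fun j hj => by
      rw [hF₃.na 0 rfl, hF₂.na 0 rfl]
      exact har₁ j hj
    have hlen₃ : s₃.HasLengths c n := fun j hj => by
      rw [hF₃.ra 1 rfl, hF₂.ra 1 rfl]
      exact hlen₁ j hj
    have hlev₃ : ∀ i ≤ n, s₃.HasLevel t c (sortedWeights p) n i := fun i hi m b hv => by
      rw [hF₃.ra 2 rfl]
      exact hlev i hi m b hv
    refine Prog.Runs.seq (hK₃ t c _ n s₃ ht hc hn hsw h0₃ har₃ hlev₃).frame ?_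
    rintro s₄ ⟨hF₄, hbest⟩
    have hbe : ∀ y : WithTop ℝ, y ≤ bestEntry t c (sortedWeights p) n ↔
        ∀ i m, (1 ≤ i ∧ i ≤ n ∧ max n (t (i - 1)) ≤ m ∧ m ≤ n + t (i - 1) - 1) →
          y ≤ OPT t c (sortedWeights p) n i m 0 := by
      intro y
      simp only [bestEntry, Finset.le_inf_iff, Finset.mem_Icc]
      constructor
      · exact fun h i m hm => h i ⟨hm.1, hm.2.1⟩ m hm.2.2
      · exact fun h i hi m hm => h i m ⟨hi.1, hi.2, hm⟩
    rcases hbest with ⟨-, htop⟩ | ⟨-, hS, hopt, hmin⟩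
    · refine absurd (top_le_iff.1 ((hbe ⊤).2 fun i m him => ?_)) (bestEntry_ne_top ht hc hn2 hsw)
      rw [htop i m him]
    -- The best cell attains the minimum over all entries with b = 0, which is the optimal cost for
    -- the sorted weights.
    have hval : ((s₄.rvar 2 : ℝ) : WithTop ℝ) = bestEntry t c (sortedWeights p) n := by
      refine le_antisymm ((hbe _).2 hmin) ?_
      rw [← hopt]
      exact (hbe _).1 le_rfl _ _ hS
    refine Prog.Runs.seq (hK₄ t c _ n _ _ _ s₄ ht hc hn hsw (by rw [hF₄.n 0 rfl, h0₃])
      (fun j hj => by rw [hF₄.na 0 rfl]; exact har₃ j hj)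
      (fun j hj => by rw [hF₄.ra 1 rfl]; exact hlen₃ j hj)
      (fun j hj => by rw [hF₄.ra 3 rfl]; exact htl j hj)
      (fun i hi m b hv => by rw [hF₄.ra 2 rfl]; exact hlev₃ i hi m b hv)
      hS.1 hS.2.1 rfl rfl (Or.inr ⟨rfl, hS.1, hS.2.2.1, hS.2.2.2⟩) hopt).frame ?_
    rintro s₅ ⟨hF₅, m, b, hP, hbI, hcost, hx⟩
    have h0₅ : s₅.nvar 0 = n := by rw [hF₅.n 0 rfl, hF₄.n 0 rfl, h0₃]
    refine Prog.Runs.seq (hK₅ t n _ m b s₅ ht hn hS.2.1 h0₅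
      (fun j hj => by rw [hF₅.na 0 rfl, hF₄.na 0 rfl]; exact har₃ j hj) hP hx).frame ?_
    rintro s₆ ⟨hF₆, hgood, hlex⟩
    have e3 : ∀ k : Fin n, s₆.narr 3 k 0 0 = rankPerm p k := fun k => by
      rw [hF₆.na 3 rfl, hF₅.na 3 rfl, hF₄.na 3 rfl, hF₃.na 3 rfl, hF₂.na 3 rfl, hrank k]
    have e4 : s₆.narr 4 = s₅.narr 4 := hF₆.na 4 rfl
    refine (hK₆ n s₆ hn (by rw [hF₆.n 0 rfl, h0₅]) fun k hk => ?_).mono le_rfl ?_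
    · rw [e3 ⟨k, hk⟩, e4]
      exact (hx _ (Fin.is_lt _)).1.trans hS.2.1
    intro s₇ hout
    have hcode := isMixedRadixCode_of_lexLt (t := t) (n := n) (x := fun k => s₅.narr 4 k 0 0)
      (d := fun k j => s₆.narr 5 k j 0) (fun k hk => (hgood k hk).1) (fun k hk => hx.le_succ hk) hlex
    have hwords : s₇.words n = (fun k : Fin n => List.ofFn fun j : Fin (s₅.narr 4 k 0 0) =>
        s₆.narr 5 k j 0) ∘ rankPerm p := by
      funext k
      obtain ⟨g1, g2⟩ := hout k k.2
      rw [e3 k, e4] at g1 g2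
      apply List.ext_getElem
      · simp [Store.words, g1]
      · intro j hj1 hj2
        simp only [Function.comp_apply, List.length_ofFn] at hj2
        simpa [Store.words] using g2 j hj2
    rw [hwords]
    refine isOptimalTree_of_sorted ht hc hn2 hp hcode ?_
    have hcost' := treeCost_ofFn (c := c) (p := sortedWeights p) (x := fun k => s₅.narr 4 k 0 0)
      (d := fun k j => s₆.narr 5 k j 0) hP hx
    rw [← hval, ← hcost, ← hcost']

def unitCell : Prog := .rput 1 (.var 8) (.lit 0) (.lit 0) (.lit 1)

def codeProg : Prog := .seq (.forTo 8 (.lit 0) (.var 0) unitCell) treeProg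

/-- With unit edge lengths depth is word length, and trees and codes have already been identified.
-/
theorem isOptimalCode_of_isOptimalTree {t : ℕ → ℕ} {n : ℕ} (hn : 1 ≤ n) {p : Fin n → ℝ}
    {w : Fin n → List ℕ} (h : IsOptimalTree t (fun _ => 1) p w) : IsOptimalCode t p w := by
  have hcost : ∀ u : Fin n → List ℕ, codeCost p u = treeCost (fun _ => 1) p u := fun u => by
    simp [codeCost, treeCost, depth, mul_comm]
  rw [isOptimalTree_iff _ hn] at h
  refine ⟨h.1, fun u hu => ?_⟩
  rw [hcost, hcost]
  exact h.2 u hu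

theorem codeProg_runs : ∃ K : ℕ, ∀ (t : ℕ → ℕ) (n : ℕ) (p : Fin n → ℝ) (s : Store),
    (∀ j, 2 ≤ t j) → 1 ≤ n → (∀ k, 0 ≤ p k) →
    s.nvar 0 = n → s.HasArities t n → s.HasWeights p →
    codeProg.Runs s (K * n ^ 3) fun s₁ => IsOptimalCode t p (s₁.words n) := by
  obtain ⟨K, hK⟩ := treeProg_runs
  refine ⟨2 + 2 * (unitCell.cost + 8) + K, ?_⟩
  intro t n p s ht hn hp h0 har hw
  refine Prog.Runs.mono (T := (1 + 1 + (n - 0 + 1) * (unitCell.cost + 1 + 7)) + K * n ^ 3) ?_ ?_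
    fun _ h => h
  swap
  · have e1 : 1 ≤ n ^ 3 := Nat.one_le_pow _ _ hn
    have e2 : n + 1 ≤ 2 * n ^ 3 := by
      have : n ≤ n ^ 3 := Nat.le_self_pow (by norm_num) n
      omega
    have key : ∀ A : ℕ, (1 + 1 + (n - 0 + 1) * (A + 1 + 7)) + K * n ^ 3 ≤
        (2 + 2 * (A + 8) + K) * n ^ 3 := fun A => by
      have := Nat.mul_le_mul_right (A + 8) e2
      rw [Nat.sub_zero]
      linarith
    exact key _
  refine Prog.Runs.seq (Prog.Runs.forTo (B := unitCell.cost) (fun l s₁ => ∀ j < l,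
    s₁.rarr 1 j 0 0 = 1) 0 n rfl (Nat.zero_le n) rfl (by simp) ?_ ?_) ?_
  · intro l s₁ hF _
    rw [NExp.eval, hF.n 0 rfl, h0]
  · intro l s₁ _ hl hF h8 hI
    refine Prog.Runs.block rfl fun _ j hj => ?_
    by_cases hjl : j = l
    · simp [unitCell, putCell, h8, hjl]
    · simp [unitCell, putCell, h8, hjl]
      exact hI j (by omega)
  · rintro s₁ ⟨hF, hI⟩
    exact (hK t (fun _ => 1) n p s₁ ht (fun _ => zero_le_one) hn hp (by rw [hF.n 0 rfl, h0])
      (fun j hj => by rw [hF.na 0 rfl]; exact har j hj) hI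
      (fun k => by rw [hF.ra 0 rfl]; exact hw k)).mono le_rfl
      fun s₂ h => isOptimalCode_of_isOptimalTree hn h

end MixedRadix

/-! ### The main theorem -/

theorem mainTheorem1 :
    -- batch identity: a minimum over γ values
    (∀ (t : ℕ → ℕ) (c p : ℕ → ℝ) (n i m b : ℕ), (∀ j, 2 ≤ t j) → (∀ j, 0 ≤ c j) → 1 ≤ n →
      SortedWeights n p → Valid t n (i + 1) m b →
      OPT t c p n (i + 1) m b =
        ((Finset.range ((m + b) / t i + 1)).filter fun b₁ => b ≤ b₁ * t i).inf
          (gam t c p n i (m + b))) ∧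
    -- the running minimum inside a batch
    (∀ (t : ℕ → ℕ) (c p : ℕ → ℝ) (n i d : ℕ), (∀ j, 2 ≤ t j) → (∀ j, 0 ≤ c j) → 1 ≤ n →
      SortedWeights n p →
      (∀ m < d % t i, Valid t n (i + 1) m (d - m) → OPT t c p n (i + 1) m (d - m) = ⊤) ∧
      (Valid t n (i + 1) (d % t i) (d - d % t i) →
        OPT t c p n (i + 1) (d % t i) (d - d % t i) = gam t c p n i d (d / t i)) ∧
      (∀ m, d % t i < m → m ≤ d → Valid t n (i + 1) (m - 1) (d - (m - 1)) →
        Valid t n (i + 1) m (d - m) →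
        OPT t c p n (i + 1) m (d - m) =
          if t i ∣ d - m then
            min (OPT t c p n (i + 1) (m - 1) (d - (m - 1))) (gam t c p n i d ((d - m) / t i))
          else OPT t c p n (i + 1) (m - 1) (d - (m - 1)))) ∧
    -- one batch in time O(d)
    (∃ (P : Prog) (K : ℕ), ∀ (t : ℕ → ℕ) (c p : ℕ → ℝ) (n i d : ℕ),
      (∀ j, 2 ≤ t j) → (∀ j, 0 ≤ c j) → 1 ≤ n → SortedWeights n p → 1 ≤ d →
      P.Solves (K * d)
        (fun s => s.nvar 0 = n ∧ s.nvar 1 = i ∧ s.nvar 2 = d ∧ s.HasArities t (i + 1) ∧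
          s.HasLengths c (i + 1) ∧ s.HasTails p n ∧ s.HasLevel t c p n i)
        (fun s => s.HasBatch t c p n (i + 1) d)) ∧
    -- one level in time O(n ^ 2)
    (∃ (P : Prog) (K : ℕ), ∀ (t : ℕ → ℕ) (c p : ℕ → ℝ) (n i : ℕ),
      (∀ j, 2 ≤ t j) → (∀ j, 0 ≤ c j) → 1 ≤ n → SortedWeights n p →
      P.Solves (K * n ^ 2)
        (fun s => s.nvar 0 = n ∧ s.nvar 1 = i ∧ s.HasArities t (i + 1) ∧
          s.HasLengths c (i + 1) ∧ s.HasWeights (fun k : Fin n => p k) ∧ s.HasLevel t c p n i)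
        (fun s => s.HasLevel t c p n (i + 1))) ∧
    -- all levels up to n in time O(n ^ 3)
    (∃ (P : Prog) (K : ℕ), ∀ (t : ℕ → ℕ) (c p : ℕ → ℝ) (n : ℕ),
      (∀ j, 2 ≤ t j) → (∀ j, 0 ≤ c j) → 1 ≤ n → SortedWeights n p →
      P.Solves (K * n ^ 3)
        (fun s => s.nvar 0 = n ∧ s.HasArities t n ∧ s.HasLengths c n ∧
          s.HasWeights (fun k : Fin n => p k))
        (fun s => ∀ i ≤ n, s.HasLevel t c p n i)) ∧
    -- the optimal cost is the least table entry with b = 0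
    (∀ (t : ℕ → ℕ) (c p : ℕ → ℝ) (n : ℕ), (∀ j, 2 ≤ t j) → (∀ j, 0 ≤ c j) → 2 ≤ n →
      SortedWeights n p → ∀ v : Fin n → List ℕ, IsOptimalTree t c (fun k : Fin n => p k) v →
      ((treeCost c (fun k : Fin n => p k) v : ℝ) : WithTop ℝ) =
        (Finset.Icc 1 n).inf fun i =>
          (Finset.Icc (max n (t (i - 1))) (n + t (i - 1) - 1)).inf fun m => OPT t c p n i m 0) ∧
    -- an optimal generalized mixed-radix tree in time O(n ^ 3)
    (∃ (P : Prog) (K : ℕ), ∀ (t : ℕ → ℕ) (c : ℕ → ℝ) (n : ℕ) (p : Fin n → ℝ),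
      (∀ j, 2 ≤ t j) → (∀ j, 0 ≤ c j) → 1 ≤ n → (∀ k, 0 ≤ p k) →
      P.Solves (K * n ^ 3)
        (fun s => s.nvar 0 = n ∧ s.HasArities t n ∧ s.HasLengths c n ∧ s.HasWeights p)
        (fun s => IsOptimalTree t c p (s.words n))) ∧
    -- an optimal mixed-radix code in time O(n ^ 3)
    (∃ (P : Prog) (K : ℕ), ∀ (t : ℕ → ℕ) (n : ℕ) (p : Fin n → ℝ),
      (∀ j, 2 ≤ t j) → 1 ≤ n → (∀ k, 0 ≤ p k) →
      P.Solves (K * n ^ 3)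
        (fun s => s.nvar 0 = n ∧ s.HasArities t n ∧ s.HasWeights p)
        (fun s => IsOptimalCode t p (s.words n))) := by
  refine ⟨?_, ?_, ?_, ?_, ?_, ?_, ?_, ?_⟩
  · intro t c p n i m b ht hc _ hp hv
    exact OPT_succ ht hc hp hv
  · intro t c p n i d ht hc _ hp
    exact OPT_batch ht hc hp d
  · exact ⟨batchProg, batchProg_solves⟩
  · exact ⟨levelProg, levelProg_solves⟩
  · obtain ⟨K, hK⟩ := tableProg_runs
    refine ⟨tableProg, K, ?_⟩
    rintro t c p n ht hc hn hp s ⟨h0, h1, h2, h3⟩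
    exact hK t c p n s ht hc hn hp h0 h1 h2 h3
  · intro t c p n ht hc hn hp v hv
    exact treeCost_eq_bestEntry ht hc hn hp hv
  · obtain ⟨K, hK⟩ := treeProg_runs
    refine ⟨treeProg, K, ?_⟩
    rintro t c n p ht hc hn hp s ⟨h0, h1, h2, h3⟩
    exact hK t c n p s ht hc hn hp h0 h1 h2 h3
  · obtain ⟨K, hK⟩ := codeProg_runs
    refine ⟨codeProg, K, ?_⟩
    rintro t n p ht hn hp s ⟨h0, h1, h2⟩
    exact hK t n p s ht hn hp h0 h1 h2
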